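/- **Theorem (Adams type result).** Let $n\ge 2$, let $P$ be a real $n\times n$ matrix all of whose eigenvalues have positive real part, $\gamma=\operatorname{tr}P$ and $A_t=t^P=\exp((\log t)P)$ for $t>0$. Let $\rho:\mathbb R^n\to[0,\infty)$ be a quasi-distance associated with $P$, i.e. a measurable function with $\rho(x)=0$ iff $x=0$, $\rho(A_tx)=t\rho(x)$ for $t>0$, $\rho(x-y)=\rho(y-x)$ and $\rho(x-y)\le k(\rho(x-z)+\rho(y-z))$ for some constant $k$. Put $E(x,r)=\{y:\rho(x-y)<r\}$ and let $|\cdot|$ be Lebesgue measure. For $1\le p<\infty$ and a positive function $\psi$ on $\mathbb R^n\times(0,\infty)$, let $M_{p,\psi,P}$ be the space of $f\in L_p^{loc}(\mathbb R^n)$ with $$\|f\|_{M_{p,\psi,P}}=\sup_{x\in\mathbb R^n,\,r>0}\psi(x,r)^{-1}|E(x,r)|^{-1/p}\|f\|_{L_p(E(x,r))}<\infty,$$ and let $WM_{p,\psi,P}$ be the space defined in the same way with $L_p$ replaced by weak $L_p$, where $\|f\|_{WL_p(B)}=\sup_{\lambda>0}\lambda\,|\{y\in B:|f(y)|>\lambda\}|^{1/p}$.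 Let $1<s\le\infty$ and $\frac1s+\frac1{s'}=1$. Let $\Omega:\mathbb R^n\to\mathbb R$ be measurable, $\Omega(A_tx)=\Omega(x)$ for all $t>0$ and $x\in\mathbb R^n$, and $\Omega\in L_s(S^{n-1})$, where the Euclidean unit sphere $S^{n-1}$ carries its normalized surface measure. Let $$M_\Omega^Pf(x)=\sup_{t>0}|E(x,t)|^{-1}\int_{E(x,t)}|\Omega(x-y)|\,|f(y)|\,dy .$$ Let $1\le p<q<\infty$ and $0<\alpha<\gamma/p$, and assume that $s'<p$, or that $p=s'=1$ (so $s=\infty$). Let $\varphi$ be a positive measurable function on $\mathbb R^n\times(0,\infty)$ such that, with a constant $C$ independent of $x\in\mathbb R^n$ and $r>0$, $$\sup_{r<t<\infty}t^{-\gamma}\operatorname*{ess\,inf}_{t<\tau<\infty}\varphi(x,\tau)\,\tau^{\gamma}\le C\varphi(x,r),\qquad \int_r^\infty t^{\alpha}\varphi(x,t)^{1/p}\frac{dt}{t}\le C r^{-\frac{\alpha p}{q-p}} .$$ Let $T$ be a sublinear operator, defined on $M_{p,\varphi^{1/p},P}$ and with measurable functions as values: $|T(f+g)|\le|Tf|+|Tg|$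 and $|T(cf)|=|c|\,|Tf|$ almost everywhere, for all $f,g\in M_{p,\varphi^{1/p},P}$ and scalars $c$. Suppose that there is a constant $C$ such that for all $f\in M_{p,\varphi^{1/p},P}$ $$|Tf(x)|\le C\int_{\mathbb R^n}\frac{|\Omega(x-y)|}{\rho(x-y)^{\gamma-\alpha}}|f(y)|\,dy\quad\text{for a.e. }x,$$ and, for all $x_0\in\mathbb R^n$ and $r>0$, $$|T(f\chi_{E(x_0,r)})(x)|\le C\,r^{\alpha}M_\Omega^Pf(x)\quad\text{for a.e. }x\in E(x_0,r).$$ Then $T$ is bounded from $M_{p,\varphi^{1/p},P}$ to $M_{q,\varphi^{1/q},P}$ if $p>1$, and from $M_{1,\varphi,P}$ to $WM_{q,\varphi^{1/q},P}$ if $p=1$: there is a constant $C$, independent of $f$, such that for all $f\in M_{p,\varphi^{1/p},P}$ one has $Tf\in M_{q,\varphi^{1/q},P}$ and $\|Tf\|_{M_{q,\varphi^{1/q},P}}\le C\|f\|_{M_{p,\varphi^{1/p},P}}$ if $p>1$, and $Tf\in WM_{q,\varphi^{1/q},P}$ and $\|Tf\|_{WM_{q,\varphi^{1/q},P}}\le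 C\|f\|_{M_{1,\varphi,P}}$ if $p=1$. -/

import Mathlib

open MeasureTheory Set
open scoped ENNReal NNReal

noncomputable section

namespace ParabolicMorrey

variable {n : ℕ}

/-- All (complex) eigenvalues of the real matrix `P` have positive real part. -/
def HasPositiveEigenvalues (P : Matrix (Fin n) (Fin n) ℝ) : Prop :=
  ∀ z : ℂ, Module.End.HasEigenvalue (Matrix.toLin' (P.map Complex.ofReal)) z → 0 < z.re

/-- The dilation `A_t = t ^ P = exp ((log t) P)`, `t > 0`, as a linear map of `ℝⁿ`. -/
def dilation (P : Matrix (Fin n) (Fin n) ℝ) (t : ℝ) :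
    EuclideanSpace ℝ (Fin n) →ₗ[ℝ] EuclideanSpace ℝ (Fin n) :=
  Matrix.toEuclideanLin (NormedSpace.exp (Real.log t • P))

/-- `ρ` is a quasi-distance associated with `P`. The polar decomposition
`dx = ρ ^ (γ - 1) dσ(w) dρ`, `γ = tr P`, is a consequence of these properties (together with the
positivity of the eigenvalues of `P`), so it is not required separately. -/
structure IsQuasiDistance (P : Matrix (Fin n) (Fin n) ℝ)
    (ρ : EuclideanSpace ℝ (Fin n) → ℝ) : Prop where
  measurable : Measurable ρ
  map_dilation : ∀ t : ℝ, 0 < t → ∀ x, ρ (dilation P t x) = t * ρ x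
  nonneg : ∀ x, 0 ≤ ρ x
  eq_zero_iff : ∀ x, ρ x = 0 ↔ x = 0
  symm : ∀ x y, ρ (x - y) = ρ (y - x)
  quasi_triangle : ∃ k : ℝ, ∀ x y z, ρ (x - y) ≤ k * (ρ (x - z) + ρ (y - z))

/-- The ellipsoid `E(x, r)`. -/
def ellipsoid (ρ : EuclideanSpace ℝ (Fin n) → ℝ) (x : EuclideanSpace ℝ (Fin n)) (r : ℝ) :
    Set (EuclideanSpace ℝ (Fin n)) :=
  {y | ρ (x - y) < r}

/-- The normalized surface measure on the Euclidean unit sphere `S^{n-1}`. -/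
def sphereMeasure (n : ℕ) : Measure (Metric.sphere (0 : EuclideanSpace ℝ (Fin n)) 1) :=
  ((volume : Measure (EuclideanSpace ℝ (Fin n))).toSphere univ)⁻¹ •
    (volume : Measure (EuclideanSpace ℝ (Fin n))).toSphere

/-- `Ω` is a measurable function on `ℝⁿ`, homogeneous of degree zero with respect to `A_t`,
whose restriction to the unit sphere belongs to `L_s(S^{n-1})`. -/
structure IsRoughKernel (P : Matrix (Fin n) (Fin n) ℝ) (s : ℝ≥0∞)
    (Ω : EuclideanSpace ℝ (Fin n) → ℝ) : Prop where
  measurable : Measurable Ω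
  homogeneous : ∀ t : ℝ, 0 < t → ∀ x, Ω (dilation P t x) = Ω x
  memLp : MemLp (fun w : Metric.sphere (0 : EuclideanSpace ℝ (Fin n)) 1 => Ω w) s
    (sphereMeasure n)

variable {𝕜 : Type*} [RCLike 𝕜]

/-- The parabolic maximal operator with rough kernel,
`M_Ω^P f(x) = sup_{t > 0} |E(x,t)|⁻¹ ∫_{E(x,t)} |Ω(x - y)| |f(y)| dy`. -/
def roughMaximal (ρ Ω : EuclideanSpace ℝ (Fin n) → ℝ) (f : EuclideanSpace ℝ (Fin n) → 𝕜)
    (x : EuclideanSpace ℝ (Fin n)) : ℝ≥0∞ :=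
  ⨆ t ∈ Ioi (0 : ℝ), (volume (ellipsoid ρ x t))⁻¹ *
    ∫⁻ y in ellipsoid ρ x t, ‖Ω (x - y)‖ₑ * ‖f y‖ₑ

/-- The size integral `∫ |Ω(x - y)| / ρ(x - y)^(γ - α) |f(y)| dy`, possibly infinite. -/
def roughPotential (γ α : ℝ) (ρ Ω : EuclideanSpace ℝ (Fin n) → ℝ)
    (f : EuclideanSpace ℝ (Fin n) → 𝕜) (x : EuclideanSpace ℝ (Fin n)) : ℝ≥0∞ :=
  ∫⁻ y, ‖Ω (x - y)‖ₑ / ENNReal.ofReal (ρ (x - y) ^ (γ - α)) * ‖f y‖ₑ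

/-- The weak Lebesgue quasi-norm on a set,
`‖f‖_{WL_p(B)} = sup_{l > 0} l |{y ∈ B : |f(y)| > l}|^(1/p)`. -/
def weakLpNorm (p : ℝ) (f : EuclideanSpace ℝ (Fin n) → 𝕜)
    (B : Set (EuclideanSpace ℝ (Fin n))) : ℝ≥0∞ :=
  ⨆ l ∈ Ioi (0 : ℝ), ENNReal.ofReal l * volume {y ∈ B | l < ‖f y‖} ^ (1 / p)

/-- The norm of the parabolic generalized Morrey space `M_{p,φ,P}`. -/
def morreyNorm (ρ : EuclideanSpace ℝ (Fin n) → ℝ) (p : ℝ)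
    (φ : EuclideanSpace ℝ (Fin n) → ℝ → ℝ) (f : EuclideanSpace ℝ (Fin n) → 𝕜) : ℝ≥0∞ :=
  ⨆ (x : EuclideanSpace ℝ (Fin n)) (r ∈ Ioi (0 : ℝ)), (ENNReal.ofReal (φ x r))⁻¹ *
    volume (ellipsoid ρ x r) ^ (-(1 / p)) *
      eLpNorm f (ENNReal.ofReal p) (volume.restrict (ellipsoid ρ x r))

/-- The quasi-norm of the weak parabolic generalized Morrey space `WM_{p,φ,P}`. -/
def weakMorreyNorm (ρ : EuclideanSpace ℝ (Fin n) → ℝ) (p : ℝ)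
    (φ : EuclideanSpace ℝ (Fin n) → ℝ → ℝ) (f : EuclideanSpace ℝ (Fin n) → 𝕜) : ℝ≥0∞ :=
  ⨆ (x : EuclideanSpace ℝ (Fin n)) (r ∈ Ioi (0 : ℝ)), (ENNReal.ofReal (φ x r))⁻¹ *
    volume (ellipsoid ρ x r) ^ (-(1 / p)) * weakLpNorm p f (ellipsoid ρ x r)

/-- Membership in the parabolic generalized Morrey space `M_{p,φ,P}`. -/
structure MemMorrey (ρ : EuclideanSpace ℝ (Fin n) → ℝ) (p : ℝ)
    (φ : EuclideanSpace ℝ (Fin n) → ℝ → ℝ) (f : EuclideanSpace ℝ (Fin n) → 𝕜) : Prop where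
  aestronglyMeasurable : AEStronglyMeasurable f volume
  memLp_compact : ∀ K : Set (EuclideanSpace ℝ (Fin n)), IsCompact K →
    MemLp f (ENNReal.ofReal p) (volume.restrict K)
  norm_lt_top : morreyNorm ρ p φ f < ∞

/-- Membership in the weak parabolic generalized Morrey space `WM_{p,φ,P}`. -/
structure MemWeakMorrey (ρ : EuclideanSpace ℝ (Fin n) → ℝ) (p : ℝ)
    (φ : EuclideanSpace ℝ (Fin n) → ℝ → ℝ) (f : EuclideanSpace ℝ (Fin n) → 𝕜) : Prop where
  aestronglyMeasurable : AEStronglyMeasurable f volume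
  weakLp_compact : ∀ K : Set (EuclideanSpace ℝ (Fin n)), IsCompact K → weakLpNorm p f K < ∞
  norm_lt_top : weakMorreyNorm ρ p φ f < ∞

/-- `T`, restricted to the class `D` of functions, is a sublinear operator with measurable
values: `|T(f + g)| ≤ |Tf| + |Tg|` and `|T(c f)| = |c| |Tf|` almost everywhere. -/
structure IsSublinearOn (D : (EuclideanSpace ℝ (Fin n) → 𝕜) → Prop)
    (T : (EuclideanSpace ℝ (Fin n) → 𝕜) → (EuclideanSpace ℝ (Fin n) → 𝕜)) : Prop where
  aestronglyMeasurable : ∀ f, D f → AEStronglyMeasurable (T f) volume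
  add_le : ∀ f g, D f → D g → ∀ᵐ x, ‖T (f + g) x‖ ≤ ‖T f x‖ + ‖T g x‖
  smul : ∀ (c : 𝕜) (f), D f → ∀ᵐ x, ‖T (c • f) x‖ = ‖c‖ * ‖T f x‖

end ParabolicMorrey

end

/-! The proof is Hedberg's argument. Fix `x` and a radius `r`, and split `f` at an ellipsoid of
radius comparable to `r` containing `x`. The local hypothesis bounds `T` of the inner piece by `r ^
α` times the rough maximal function. For the outer piece the size hypothesis is used: writing `ρ ^
(-(γ - α))` as an integral of `t ^ (-(γ - α) - 1)` over `t > ρ` turns the potential into an integral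
of means of `|Ω| |f|` over ellipsoids. Hölder and the Morrey norm bound these means by `φ(x, t) ^
(1/p)`, and the integral condition gives `r ^ (-δ) ‖f‖` with `δ = α p / (q - p)`. Optimizing in `r`
yields, almost everywhere, `|T f| ≤ C ‖f‖ ^ (1 - p/q) (M_Ω f) ^ (p/q)` (`operator_pointwise_bound`,
`le_of_forall_rpow_add`).

The `L_q` mass of `T f` on an ellipsoid is thus controlled by the `L_p` mass of `M_Ω f`, so it
remains to bound `M_Ω` on the Morrey space with exponent `p` (`roughMaximal_morrey_strong`,
`roughMaximal_morrey_weak`). Hölder gives `M_Ω f ≤ K (M |f| ^ s') ^ (1/s')`. Small radii see only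
`f` near `E(x₀, r)` and are handled by the maximal theorem, in exponent `p / s' > 1` or in weak
form. For radii beyond `r`, the essential infimum condition bounds every mean by a multiple of
`φ(x₀, r) ^ (1/p) ‖f‖`.

All this rests on three geometric facts: `A_t` tends to `0` with `t`, `det A_t = t ^ γ`, and `Ω ∈
L_s` on the sphere implies `Ω ∈ L_s` on the unit ellipsoid (`memLp_kernel`). Since `ρ` is only
assumed measurable, its boundedness near the origin comes from the Steinhaus theorem. -/

noncomputable section

namespace ParabolicMorrey

variable {n : ℕ}

open Filter Topology

/-! ### Dilations: decay and determinant of the matrix exponential. -/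

section MatrixExponential

open scoped Matrix.Norms.Operator

lemma exp_mulVec_of_mulVec_eq_smul (M : Matrix (Fin n) (Fin n) ℂ) (v : Fin n → ℂ) (z : ℂ)
    (h : M.mulVec v = z • v) : (NormedSpace.exp M).mulVec v = Complex.exp z • v := by
  have hpow : ∀ k : ℕ, (M ^ k).mulVec v = z ^ k • v := by
    intro k
    induction k with
    | zero => simp
    | succ k ih =>
      rw [pow_succ, ← Matrix.mulVec_mulVec, h, Matrix.mulVec_smul, ih, smul_smul, pow_succ, mul_comm]
  have h1 : HasSum (fun k : ℕ => ((k.factorial : ℂ)⁻¹ • M ^ k)) (NormedSpace.exp M) :=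
    NormedSpace.exp_series_hasSum_exp' M
  let L : Matrix (Fin n) (Fin n) ℂ →ₗ[ℂ] (Fin n → ℂ) := (Matrix.mulVecBilin ℂ ℂ).flip v
  have hL : Continuous L := L.continuous_of_finiteDimensional
  have h2 := h1.mapL (⟨L, hL⟩ : Matrix (Fin n) (Fin n) ℂ →L[ℂ] (Fin n → ℂ))
  have h3 : HasSum (fun k : ℕ => ((k.factorial : ℂ)⁻¹ • z ^ k)) (NormedSpace.exp z) :=
    NormedSpace.exp_series_hasSum_exp' z
  have h4 := h3.smul_const v
  have h5 : (fun k : ℕ => ((k.factorial : ℂ)⁻¹ • z ^ k) • v) =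
      fun k : ℕ => (⟨L, hL⟩ : Matrix (Fin n) (Fin n) ℂ →L[ℂ] (Fin n → ℂ))
        ((k.factorial : ℂ)⁻¹ • M ^ k) := by
    funext k
    rw [map_smul]
    show _ = (k.factorial : ℂ)⁻¹ • ((M ^ k).mulVec v)
    rw [hpow, smul_assoc]
  rw [h5] at h4
  rw [Complex.exp_eq_exp_ℂ]
  exact h2.unique h4

/-- The eigenspace of `exp (-M)` is invariant under `M` because the two commute. Over `ℂ`, `M`
therefore has an eigenvector inside it, on which `exp (-M)` acts by `exp (-z)`. -/
lemma exists_eigenvalue_of_mem_spectrum_exp_neg (M : Matrix (Fin n) (Fin n) ℂ) {μ : ℂ}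
    (hμ : μ ∈ spectrum ℂ (NormedSpace.exp (-M))) :
    ∃ z, Module.End.HasEigenvalue (Matrix.toLin' M) z ∧ μ = Complex.exp (-z) := by
  rw [← Matrix.spectrum_toLin', ← Module.End.hasEigenvalue_iff_mem_spectrum] at hμ
  set B := NormedSpace.exp (-M) with hB
  have hcommM : Commute B M := by
    have : Commute (-M) M := (Commute.refl M).neg_left
    exact this.exp_left
  have hcomm : Commute (Matrix.toLin' B) (Matrix.toLin' M) := by
    show _ * _ = _ * _
    rw [Module.End.mul_eq_comp, Module.End.mul_eq_comp, ← Matrix.toLin'_mul, ← Matrix.toLin'_mul,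
      hcommM.eq]
  have hmaps := Module.End.mapsTo_genEigenspace_of_comm hcomm μ 1
  have : Nontrivial (Module.End.eigenspace (Matrix.toLin' B) μ) :=
    Submodule.nontrivial_iff_ne_bot.2 hμ
  obtain ⟨z, hz⟩ := Module.End.exists_eigenvalue ((Matrix.toLin' M).restrict hmaps)
  obtain ⟨v, hv⟩ := hz.exists_hasEigenvector
  have hv1 : M.mulVec v.1 = z • v.1 := by
    have : Matrix.toLin' M v.1 = z • v.1 := congrArg Subtype.val hv.apply_eq_smul
    rwa [Matrix.toLin'_apply] at this
  have hv0 : v.1 ≠ 0 := fun h => hv.2 (Subtype.ext h)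
  refine ⟨z, Module.End.hasEigenvalue_of_hasEigenvector (x := v.1) ⟨?_, hv0⟩, ?_⟩
  · rw [Module.End.mem_eigenspace_iff]; simpa using hv1
  · have h1 := exp_mulVec_of_mulVec_eq_smul (-M) v.1 (-z) (by
      rw [Matrix.neg_mulVec, hv1, neg_smul])
    have h2 : B.mulVec v.1 = μ • v.1 := by
      have := Module.End.mem_eigenspace_iff.1 v.2
      simpa using this
    rw [← hB, h2] at h1
    have h3 : (μ - Complex.exp (-z)) • v.1 = 0 := by rw [sub_smul, h1, sub_self]
    rcases smul_eq_zero.1 h3 with h | h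
    · exact sub_eq_zero.1 h
    · exact absurd h hv0

/-- By Gelfand's formula `‖a ^ k‖ ≤ r ^ k` eventually, for some `r < 1`. -/
lemma tendsto_pow_zero_of_spectralRadius_lt_one {A : Type*} [NormedRing A] [NormedAlgebra ℂ A]
    [CompleteSpace A] (a : A) (h : spectralRadius ℂ a < 1) :
    Tendsto (fun k : ℕ => a ^ k) atTop (𝓝 0) := by
  obtain ⟨r, hr1, hr2⟩ := ENNReal.lt_iff_exists_nnreal_btwn.1 h
  have hev := (spectrum.pow_nnnorm_pow_one_div_tendsto_nhds_spectralRadius a).eventually_lt_const hr1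
  have hr3 : r < 1 := by exact_mod_cast hr2
  have hlim : Tendsto (fun k : ℕ => (r : ℝ) ^ k) atTop (𝓝 0) :=
    tendsto_pow_atTop_nhds_zero_of_lt_one r.2 hr3
  refine squeeze_zero_norm' ?_ hlim
  filter_upwards [hev, eventually_gt_atTop 0] with k hk hk0
  have hk' : (0 : ℝ) < k := by exact_mod_cast hk0
  have h1 : (‖a ^ k‖₊ : ℝ≥0∞) ≤ (r : ℝ≥0∞) ^ (k : ℝ) := by
    have := ENNReal.rpow_le_rpow hk.le hk'.le
    rwa [← ENNReal.rpow_mul, one_div, inv_mul_cancel₀ hk'.ne', ENNReal.rpow_one] at this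
  rw [ENNReal.rpow_natCast] at h1
  exact_mod_cast h1

lemma spectralRadius_exp_neg_lt_one (hn : 0 < n) (P : Matrix (Fin n) (Fin n) ℝ)
    (hP : HasPositiveEigenvalues P) :
    spectralRadius ℂ (NormedSpace.exp (-(P.map Complex.ofReal))) < 1 := by
  have : Nonempty (Fin n) := ⟨⟨0, hn⟩⟩
  obtain ⟨μ, hμ, hμr⟩ := spectrum.exists_nnnorm_eq_spectralRadius
    (NormedSpace.exp (-(P.map Complex.ofReal)))
  obtain ⟨z, hz, rfl⟩ := exists_eigenvalue_of_mem_spectrum_exp_neg _ hμ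
  rw [← hμr]
  have : ‖Complex.exp (-z)‖ < 1 := by
    rw [Complex.norm_exp, Real.exp_lt_one_iff]
    simpa using hP z hz
  have h2 : ‖Complex.exp (-z)‖₊ < 1 := this
  exact_mod_cast h2

lemma tendsto_exp_neg_pow (hn : 0 < n) (P : Matrix (Fin n) (Fin n) ℝ)
    (hP : HasPositiveEigenvalues P) :
    Tendsto (fun k : ℕ => NormedSpace.exp (-P) ^ k) atTop (𝓝 0) := by
  have h := tendsto_pow_zero_of_spectralRadius_lt_one _ (spectralRadius_exp_neg_lt_one hn P hP)
  let φ : Matrix (Fin n) (Fin n) ℝ →+* Matrix (Fin n) (Fin n) ℂ := Complex.ofRealHom.mapMatrix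
  have hφc : Continuous φ := by
    show Continuous (fun M : Matrix (Fin n) (Fin n) ℝ => M.map Complex.ofReal)
    exact Continuous.matrix_map continuous_id Complex.continuous_ofReal
  have hexp : NormedSpace.exp (-(P.map Complex.ofReal)) = φ (NormedSpace.exp (-P)) := by
    have := NormedSpace.map_exp φ hφc (-P)
    rw [map_neg] at this
    exact this.symm
  rw [hexp] at h
  -- The spectral argument lives over `ℂ`; entrywise real parts bring the limit back to the real
  -- matrices.
  have h2 : Tendsto (fun k : ℕ => (φ (NormedSpace.exp (-P)) ^ k).map Complex.re) atTop
      (𝓝 ((0 : Matrix (Fin n) (Fin n) ℂ).map Complex.re)) :=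
    ((Continuous.matrix_map continuous_id Complex.continuous_re).tendsto _).comp h
  have h3 : (fun k : ℕ => (φ (NormedSpace.exp (-P)) ^ k).map Complex.re) =
      fun k => NormedSpace.exp (-P) ^ k := by
    funext k
    rw [← map_pow]
    ext i j
    simp [φ]
  rw [h3] at h2
  convert h2 using 2
  ext i j; simp

/-- Split `s` into integer and fractional parts: the integer power tends to zero and the fractional
factor stays bounded by compactness of `[0, 1]`. -/
lemma tendsto_exp_neg_smul (hn : 0 < n) (P : Matrix (Fin n) (Fin n) ℝ)
    (hP : HasPositiveEigenvalues P) :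
    Tendsto (fun s : ℝ => NormedSpace.exp (-(s • P))) atTop (𝓝 0) := by
  have hcont : Continuous (fun s : ℝ => NormedSpace.exp (-(s • P))) :=
    NormedSpace.exp_continuous.comp (by fun_prop)
  obtain ⟨C, hC⟩ := (isCompact_Icc (a := (0 : ℝ)) (b := 1)).exists_bound_of_continuousOn
    hcont.continuousOn
  have h1 : Tendsto (fun s : ℝ => C * ‖NormedSpace.exp (-P) ^ ⌊s⌋₊‖) atTop (𝓝 0) := by
    have := ((tendsto_exp_neg_pow hn P hP).comp (tendsto_nat_floor_atTop (α := ℝ))).norm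
    simpa using this.const_mul C
  refine squeeze_zero_norm' ?_ h1
  filter_upwards [eventually_ge_atTop 0] with s hs
  have hdec : NormedSpace.exp (-(s • P)) =
      NormedSpace.exp (-((s - ⌊s⌋₊) • P)) * NormedSpace.exp (-P) ^ ⌊s⌋₊ := by
    rw [← Matrix.exp_nsmul, ← Matrix.exp_add_of_commute]
    · congr 1
      rw [← Nat.cast_smul_eq_nsmul ℝ, sub_smul, smul_neg]; abel
    · exact (((Commute.refl P).smul_left _).neg_left.neg_right.smul_right _)
  rw [hdec]
  refine (norm_mul_le _ _).trans ?_
  gcongr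
  refine hC _ ⟨?_, ?_⟩
  · linarith [Nat.floor_le hs]
  · linarith [Nat.lt_floor_add_one s]

/-- The curves `exp (s P)` and `1 + s P` have the same tangent at `s = 0`, so `det` has the same
derivative along both; along the second, it is a polynomial with linear coefficient `tr P`. -/
lemma hasDerivAt_det_exp_zero (P : Matrix (Fin n) (Fin n) ℝ) :
    HasDerivAt (fun s : ℝ => (NormedSpace.exp (s • P)).det) P.trace 0 := by
  have hdiff : DifferentiableAt ℝ (fun M : Matrix (Fin n) (Fin n) ℝ => M.det) 1 := by
    have hent : ∀ i j, Differentiable ℝ (fun M : Matrix (Fin n) (Fin n) ℝ => M i j) := by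
      intro i j
      let L : Matrix (Fin n) (Fin n) ℝ →ₗ[ℝ] ℝ := Matrix.entryLinearMap ℝ ℝ i j
      exact (⟨L, L.continuous_of_finiteDimensional⟩ : Matrix (Fin n) (Fin n) ℝ →L[ℝ] ℝ).differentiable
    simp only [Matrix.det_apply]
    refine DifferentiableAt.fun_sum fun σ _ => ?_
    refine DifferentiableAt.const_smul ?_ _
    exact (HasFDerivAt.finsetProd (u := Finset.univ)
      (g := fun i (M : Matrix (Fin n) (Fin n) ℝ) => M (σ i) i)
      fun i _ => (hent (σ i) i).differentiableAt.hasFDerivAt).differentiableAt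
  have hD := hdiff.hasFDerivAt
  have h1 : HasDerivAt (fun s : ℝ => (1 : Matrix (Fin n) (Fin n) ℝ) + s • P) P 0 := by
    have := ((hasDerivAt_id (0 : ℝ)).smul_const P).const_add (1 : Matrix (Fin n) (Fin n) ℝ)
    rw [one_smul] at this
    exact this
  have h2 : HasDerivAt (fun s : ℝ => ((1 : Matrix (Fin n) (Fin n) ℝ) + s • P).det) P.trace 0 := by
    set p := (Matrix.det (1 + (Polynomial.X : Polynomial ℝ) • P.map Polynomial.C)).divX.divX
    have ha : HasDerivAt (fun s : ℝ => 1 + P.trace * s) P.trace 0 := by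
      simpa using ((hasDerivAt_id (0 : ℝ)).const_mul P.trace).const_add 1
    have hb : HasDerivAt (fun s : ℝ => p.eval s * s ^ 2) 0 0 := by
      have := (p.hasDerivAt 0).mul (hasDerivAt_pow 2 (0 : ℝ))
      simp only [Nat.cast_ofNat, Nat.add_one_sub_one, pow_one, mul_zero, ne_eq, OfNat.ofNat_ne_zero,
        not_false_eq_true, zero_pow, add_zero] at this
      exact this
    have hab := ha.add hb
    rw [add_zero] at hab
    exact hab.congr_of_eventuallyEq (Eventually.of_forall fun s => Matrix.det_one_add_smul s P)
  have h3 : HasDerivAt (fun s : ℝ => ((1 : Matrix (Fin n) (Fin n) ℝ) + s • P).det)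
      (fderiv ℝ (fun M : Matrix (Fin n) (Fin n) ℝ => M.det) 1 P) 0 :=
    HasFDerivAt.comp_hasDerivAt (0 : ℝ) (f := fun s : ℝ => (1 : Matrix (Fin n) (Fin n) ℝ) + s • P)
      (by rw [zero_smul, add_zero]; exact hD) h1
  have h4 : HasDerivAt (fun s : ℝ => NormedSpace.exp (s • P)) P 0 := by
    have := hasDerivAt_exp_smul_const (𝕂 := ℝ) P (0 : ℝ)
    rw [zero_smul, NormedSpace.exp_zero, one_mul] at this
    exact this
  have h5 : HasDerivAt (fun s : ℝ => (NormedSpace.exp (s • P)).det)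
      (fderiv ℝ (fun M : Matrix (Fin n) (Fin n) ℝ => M.det) 1 P) 0 :=
    HasFDerivAt.comp_hasDerivAt (0 : ℝ) (f := fun s : ℝ => NormedSpace.exp (s • P))
      (by rw [zero_smul, NormedSpace.exp_zero]; exact hD) h4
  rwa [h3.unique h2] at h5

/-- Multiplicativity in `s` propagates the derivative at `0` to the equation `u' = (tr P) u`; then
`u(s) exp (-s tr P)` is constant. -/
lemma det_exp_smul (P : Matrix (Fin n) (Fin n) ℝ) (s : ℝ) :
    (NormedSpace.exp (s • P)).det = Real.exp (s * P.trace) := by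
  have hadd : ∀ a b : ℝ, (NormedSpace.exp ((a + b) • P)).det =
      (NormedSpace.exp (a • P)).det * (NormedSpace.exp (b • P)).det := by
    intro a b
    rw [add_smul, Matrix.exp_add_of_commute _ _ (((Commute.refl P).smul_left _).smul_right _),
      Matrix.det_mul]
  have hder : ∀ a : ℝ, HasDerivAt (fun s : ℝ => (NormedSpace.exp (s • P)).det)
      ((NormedSpace.exp (a • P)).det * P.trace) a := by
    intro a
    have h0 := hasDerivAt_det_exp_zero P
    have h1 : HasDerivAt (fun s : ℝ => (NormedSpace.exp (a • P)).det *
        (NormedSpace.exp ((s - a) • P)).det) ((NormedSpace.exp (a • P)).det * P.trace) a := by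
      refine HasDerivAt.const_mul _ ?_
      have := HasDerivAt.comp_sub_const a a (f := fun s : ℝ => (NormedSpace.exp (s • P)).det)
        (by simpa using h0)
      exact this
    convert h1 using 1
    funext s
    rw [← hadd]; congr 3; ring
  have hconst : ∀ a : ℝ, HasDerivAt (fun s : ℝ => (NormedSpace.exp (s • P)).det *
      Real.exp (-(s * P.trace))) 0 a := by
    intro a
    have h2 : HasDerivAt (fun s : ℝ => Real.exp (-(s * P.trace)))
        (Real.exp (-(a * P.trace)) * (-(P.trace))) a := by
      have := (((hasDerivAt_id a).mul_const P.trace).neg).exp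
      simpa using this
    have h3 := (hder a).mul h2
    have hz : (NormedSpace.exp (a • P)).det * P.trace * Real.exp (-(a * P.trace)) +
      (NormedSpace.exp (a • P)).det * (Real.exp (-(a * P.trace)) * -P.trace) = 0 := by ring
    rw [hz] at h3
    exact h3
  have h := is_const_of_deriv_eq_zero (fun a => (hconst a).differentiableAt)
    (fun a => (hconst a).deriv) s 0
  simp only [zero_smul, NormedSpace.exp_zero, Matrix.det_one, zero_mul, neg_zero, Real.exp_zero,
    mul_one] at h
  rw [Real.exp_neg] at h
  field_simp at h
  exact h

lemma dilation_one (P : Matrix (Fin n) (Fin n) ℝ) (x : EuclideanSpace ℝ (Fin n)) :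
    dilation P 1 x = x := by
  simp [dilation]

lemma dilation_mul (P : Matrix (Fin n) (Fin n) ℝ) {t u : ℝ} (ht : 0 < t) (hu : 0 < u)
    (x : EuclideanSpace ℝ (Fin n)) : dilation P (t * u) x = dilation P t (dilation P u x) := by
  simp only [dilation]
  rw [Real.log_mul ht.ne' hu.ne', add_smul,
    Matrix.exp_add_of_commute _ _ (((Commute.refl P).smul_left _).smul_right _)]
  simp [Matrix.toLpLin_apply, Matrix.mulVec_mulVec]

lemma dilation_inv_dilation (P : Matrix (Fin n) (Fin n) ℝ) {t : ℝ} (ht : 0 < t)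
    (x : EuclideanSpace ℝ (Fin n)) : dilation P t⁻¹ (dilation P t x) = x := by
  rw [← dilation_mul P (inv_pos.2 ht) ht, inv_mul_cancel₀ ht.ne', dilation_one]

lemma dilation_dilation_inv (P : Matrix (Fin n) (Fin n) ℝ) {t : ℝ} (ht : 0 < t)
    (x : EuclideanSpace ℝ (Fin n)) : dilation P t (dilation P t⁻¹ x) = x := by
  rw [← dilation_mul P ht (inv_pos.2 ht), mul_inv_cancel₀ ht.ne', dilation_one]

lemma det_dilation (P : Matrix (Fin n) (Fin n) ℝ) {t : ℝ} (ht : 0 < t) :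
    LinearMap.det (dilation P t) = t ^ P.trace := by
  rw [Real.rpow_def_of_pos ht, ← det_exp_smul, dilation, Matrix.toEuclideanLin,
    LinearMap.det_toLpLin]

/-- The dilation as a function of the matrix exponent, valued in continuous linear maps. -/
def expMap (P : Matrix (Fin n) (Fin n) ℝ) (s : ℝ) :
    EuclideanSpace ℝ (Fin n) →L[ℝ] EuclideanSpace ℝ (Fin n) :=
  Matrix.toEuclideanCLM (n := Fin n) (𝕜 := ℝ) (NormedSpace.exp (s • P))

lemma dilation_eq_expMap (P : Matrix (Fin n) (Fin n) ℝ) (t : ℝ) (x : EuclideanSpace ℝ (Fin n)) :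
    dilation P t x = expMap P (Real.log t) x := by
  rfl

lemma continuous_toEuclideanCLM :
    Continuous (fun M : Matrix (Fin n) (Fin n) ℝ =>
      (Matrix.toEuclideanCLM (n := Fin n) (𝕜 := ℝ) M)) :=
  LinearMap.continuous_of_finiteDimensional
    (Matrix.toEuclideanCLM (n := Fin n) (𝕜 := ℝ)).toAlgEquiv.toLinearEquiv.toLinearMap

lemma tendsto_expMap_atBot (hn : 0 < n) (P : Matrix (Fin n) (Fin n) ℝ)
    (hP : HasPositiveEigenvalues P) : Tendsto (expMap P) atBot (𝓝 0) := by
  have h1 := (tendsto_exp_neg_smul hn P hP).comp tendsto_neg_atBot_atTop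
  have h2 := ((continuous_toEuclideanCLM (n := n)).tendsto 0).comp h1
  rw [map_zero] at h2
  refine h2.congr fun s => ?_
  simp [expMap]

lemma hasDerivAt_expMap (P : Matrix (Fin n) (Fin n) ℝ) (s : ℝ) :
    HasDerivAt (expMap P)
      (Matrix.toEuclideanCLM (n := Fin n) (𝕜 := ℝ) (NormedSpace.exp (s • P) * P)) s := by
  have h := hasDerivAt_exp_smul_const (𝕂 := ℝ) P s
  let L : Matrix (Fin n) (Fin n) ℝ →L[ℝ] (EuclideanSpace ℝ (Fin n) →L[ℝ] EuclideanSpace ℝ (Fin n)) :=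
    ⟨(Matrix.toEuclideanCLM (n := Fin n) (𝕜 := ℝ)).toAlgEquiv.toLinearEquiv.toLinearMap,
      continuous_toEuclideanCLM⟩
  exact L.hasFDerivAt.comp_hasDerivAt s h

lemma contDiff_expMap (P : Matrix (Fin n) (Fin n) ℝ) : ContDiff ℝ 1 (expMap P) := by
  rw [contDiff_one_iff_deriv]
  refine ⟨fun s => (hasDerivAt_expMap P s).differentiableAt, ?_⟩
  have : deriv (expMap P) = fun s =>
      Matrix.toEuclideanCLM (n := Fin n) (𝕜 := ℝ) (NormedSpace.exp (s • P) * P) :=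
    funext fun s => (hasDerivAt_expMap P s).deriv
  rw [this]
  refine continuous_toEuclideanCLM.comp ?_
  exact (NormedSpace.exp_continuous.comp (by fun_prop)).mul continuous_const

end MatrixExponential

lemma norm_expMap_bounded_Iic (hn : 0 < n) (P : Matrix (Fin n) (Fin n) ℝ)
    (hP : HasPositiveEigenvalues P) (a : ℝ) :
    ∃ C : ℝ, 0 < C ∧ ∀ s ≤ a, ‖expMap P s‖ ≤ C := by
  have h1 := (tendsto_expMap_atBot hn P hP).norm
  rw [norm_zero] at h1
  obtain ⟨b, hb⟩ := eventually_atBot.1 (h1.eventually_lt_const one_pos)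
  obtain ⟨C, hC⟩ := (isCompact_Icc (a := b) (b := a)).exists_bound_of_continuousOn
    (contDiff_expMap P).continuous.continuousOn
  refine ⟨max C 1, by positivity, fun s hs => ?_⟩
  rcases le_total s b with h | h
  · exact (hb s h).le.trans (le_max_right _ _)
  · exact (hC s ⟨h, hs⟩).trans (le_max_left _ _)

/-- Intermediate value theorem along the orbit of `x`. The norm is small near `-∞`; it is large
somewhere because the inverse of a strong contraction expands. -/
lemma exists_norm_expMap_eq_one (hn : 0 < n) (P : Matrix (Fin n) (Fin n) ℝ)
    (hP : HasPositiveEigenvalues P) {x : EuclideanSpace ℝ (Fin n)} (hx : x ≠ 0) :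
    ∃ s : ℝ, ‖expMap P s x‖ = 1 := by
  have hcont : Continuous fun s => ‖expMap P s x‖ :=
    ((contDiff_expMap P).continuous.clm_apply continuous_const).norm
  have h1 := (tendsto_expMap_atBot hn P hP).norm
  rw [norm_zero] at h1
  have hx' : 0 < ‖x‖ := norm_pos_iff.2 hx
  obtain ⟨a, ha⟩ := eventually_atBot.1 (h1.eventually_lt_const (inv_pos.2 hx'))
  obtain ⟨b, hb⟩ := eventually_atBot.1 (h1.eventually_lt_const hx')
  refine mem_range_of_exists_le_of_exists_ge hcont ⟨a, ?_⟩ ⟨-b, ?_⟩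
  · refine ((expMap P a).le_opNorm x).trans ?_
    have := mul_le_mul_of_nonneg_right (ha a le_rfl).le hx'.le
    rwa [inv_mul_cancel₀ hx'.ne'] at this
  · have h2 : expMap P b (expMap P (-b) x) = x := by
      have := dilation_dilation_inv P (Real.exp_pos b) x
      rwa [dilation_eq_expMap, dilation_eq_expMap, Real.log_inv, Real.log_exp] at this
    have h3 : ‖x‖ ≤ ‖x‖ * ‖expMap P (-b) x‖ := by
      calc ‖x‖ = ‖expMap P b (expMap P (-b) x)‖ := by rw [h2]
        _ ≤ ‖expMap P b‖ * ‖expMap P (-b) x‖ := (expMap P b).le_opNorm _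
        _ ≤ _ := by gcongr; exact (hb b le_rfl).le
    exact le_of_mul_le_mul_left (by simpa using h3) hx'

/-! ### Topology and volume of the ellipsoids. -/

namespace IsQuasiDistance

variable {P : Matrix (Fin n) (Fin n) ℝ} {ρ : EuclideanSpace ℝ (Fin n) → ℝ}

lemma map_zero (hρ : IsQuasiDistance P ρ) : ρ 0 = 0 := (hρ.eq_zero_iff 0).2 rfl

lemma map_neg (hρ : IsQuasiDistance P ρ) (x : EuclideanSpace ℝ (Fin n)) : ρ (-x) = ρ x := by
  have := hρ.symm 0 x
  simpa using this

lemma pos (hρ : IsQuasiDistance P ρ) {x : EuclideanSpace ℝ (Fin n)} (hx : x ≠ 0) : 0 < ρ x :=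
  lt_of_le_of_ne (hρ.nonneg x) fun h => hx ((hρ.eq_zero_iff x).1 h.symm)

lemma exists_triangle (hρ : IsQuasiDistance P ρ) :
    ∃ k : ℝ, 1 ≤ k ∧ ∀ x y, ρ (x + y) ≤ k * (ρ x + ρ y) := by
  obtain ⟨k, hk⟩ := hρ.quasi_triangle
  refine ⟨max k 1, le_max_right _ _, fun x y => ?_⟩
  have h := hk x (-y) 0
  rw [sub_neg_eq_add, sub_zero, sub_zero, hρ.map_neg] at h
  refine h.trans ?_
  have := hρ.nonneg x
  have := hρ.nonneg y
  gcongr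
  exact le_max_left _ _

lemma measurableSet_sublevel (hρ : IsQuasiDistance P ρ) (r : ℝ) : MeasurableSet {x | ρ x < r} :=
  hρ.measurable measurableSet_Iio

/-- Steinhaus: some sublevel set of `ρ` has positive measure, so its difference set contains a ball,
and the quasi-triangle inequality bounds `ρ` on differences. -/
lemma exists_lt_on_ball (hρ : IsQuasiDistance P ρ) :
    ∃ δ > 0, ∃ C > 0, ∀ x, ‖x‖ < δ → ρ x < C := by
  obtain ⟨k, hk1, hk⟩ := hρ.exists_triangle
  have hU : (⋃ N : ℕ, {x | ρ x < N + 1}) = univ := by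
    refine eq_univ_of_forall fun x => mem_iUnion.2 ?_
    obtain ⟨N, hN⟩ := exists_nat_gt (ρ x)
    exact ⟨N, by simp only [mem_ofPred_eq]; linarith⟩
  obtain ⟨N, hN⟩ : ∃ N : ℕ, 0 < volume {x | ρ x < N + 1} := by
    by_contra! h
    have h0 : volume (⋃ N : ℕ, {x | ρ x < N + 1}) = 0 :=
      measure_iUnion_null fun N => le_antisymm (h N) bot_le
    rw [hU] at h0
    exact isOpen_univ.measure_ne_zero volume univ_nonempty h0
  have hS := Measure.sub_mem_nhds_zero_of_addHaar_pos volume _ (hρ.measurableSet_sublevel (N + 1)) hN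
  obtain ⟨δ, hδ, hball⟩ := Metric.mem_nhds_iff.1 hS
  refine ⟨δ, hδ, k * ((N + 1) + (N + 1)), by positivity, fun x hx => ?_⟩
  obtain ⟨a, ha, b, hb, rfl⟩ := Set.mem_sub.1 (hball (mem_ball_zero_iff.2 hx))
  have h1 := hk a (-b)
  rw [hρ.map_neg, ← sub_eq_add_neg] at h1
  refine h1.trans_lt ?_
  simp only [mem_ofPred_eq] at ha hb
  exact mul_lt_mul_of_pos_left (add_lt_add ha hb) (by linarith)

/-- Homogeneity upgrades boundedness near `0` to continuity at `0`: apply the bound `C` to the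
dilate of `x` by `C / ε`. -/
lemma lt_mem_nhds_zero (hρ : IsQuasiDistance P ρ) {ε : ℝ} (hε : 0 < ε) :
    {x | ρ x < ε} ∈ 𝓝 (0 : EuclideanSpace ℝ (Fin n)) := by
  obtain ⟨δ, hδ, C, hC, h⟩ := hρ.exists_lt_on_ball
  have hc : Continuous (dilation P (C / ε)) := (dilation P (C / ε)).continuous_of_finiteDimensional
  have h1 : (dilation P (C / ε)) ⁻¹' (Metric.ball 0 δ) ∈ 𝓝 (0 : EuclideanSpace ℝ (Fin n)) := by
    apply hc.continuousAt.preimage_mem_nhds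
    rw [_root_.map_zero]
    exact Metric.ball_mem_nhds _ hδ
  filter_upwards [h1] with x hx
  have h2 := h _ (mem_ball_zero_iff.1 hx)
  rw [hρ.map_dilation _ (by positivity)] at h2
  rw [div_mul_eq_mul_div, div_lt_iff₀ hε] at h2
  exact lt_of_mul_lt_mul_left h2 hC.le

lemma lt_sub_mem_nhds (hρ : IsQuasiDistance P ρ) (x : EuclideanSpace ℝ (Fin n)) {ε : ℝ}
    (hε : 0 < ε) : ∀ᶠ y in 𝓝 x, ρ (x - y) < ε := by
  have hc : Continuous fun y : EuclideanSpace ℝ (Fin n) => x - y := by fun_prop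
  have : Tendsto (fun y => x - y) (𝓝 x) (𝓝 0) := by
    simpa using hc.tendsto x
  exact this (hρ.lt_mem_nhds_zero hε)

/-- No continuity of `ρ` is available away from `0`, but the sets `{y | ρ (x - y) < 1}` are
neighbourhoods of `x` on which `ρ` is bounded; compactness does the rest. -/
lemma bddAbove_on_compact (hρ : IsQuasiDistance P ρ) {K : Set (EuclideanSpace ℝ (Fin n))}
    (hK : IsCompact K) : ∃ M > 0, ∀ x ∈ K, ρ x < M := by
  obtain ⟨k, hk1, hk⟩ := hρ.exists_triangle
  refine hK.induction_on (p := fun S => ∃ M > 0, ∀ x ∈ S, ρ x < M) ⟨1, one_pos, by simp⟩ ?_ ?_ ?_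
  · rintro S S' hS ⟨M, hM, h⟩
    exact ⟨M, hM, fun x hx => h x (hS hx)⟩
  · rintro S S' ⟨M, hM, h⟩ ⟨M', hM', h'⟩
    refine ⟨max M M', by positivity, fun x hx => ?_⟩
    rcases hx with hx | hx
    · exact (h x hx).trans_le (le_max_left _ _)
    · exact (h' x hx).trans_le (le_max_right _ _)
  · intro x _
    refine ⟨{y | ρ (x - y) < 1}, mem_nhdsWithin_of_mem_nhds (hρ.lt_sub_mem_nhds x one_pos),
      k * (ρ x + 1), ?_, fun y hy => ?_⟩
    · have := hρ.nonneg x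
      positivity
    · have h1 := hk x (-(x - y))
      rw [hρ.map_neg] at h1
      have h2 : x + -(x - y) = y := by abel
      rw [h2] at h1
      refine h1.trans_lt (mul_lt_mul_of_pos_left ?_ (by linarith))
      simpa using hy

lemma bddBelow_on_sphere (hρ : IsQuasiDistance P ρ) :
    ∃ m > 0, ∀ x : EuclideanSpace ℝ (Fin n), ‖x‖ = 1 → m ≤ ρ x := by
  obtain ⟨k, hk1, hk⟩ := hρ.exists_triangle
  have hk0 : 0 < k := by linarith
  have key : ∃ m > 0, ∀ x ∈ Metric.sphere (0 : EuclideanSpace ℝ (Fin n)) 1, m ≤ ρ x := by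
    refine (isCompact_sphere _ _).induction_on (p := fun S => ∃ m > 0, ∀ x ∈ S, m ≤ ρ x)
      ⟨1, one_pos, by simp⟩ ?_ ?_ ?_
    · rintro S S' hS ⟨M, hM, h⟩
      exact ⟨M, hM, fun x hx => h x (hS hx)⟩
    · rintro S S' ⟨M, hM, h⟩ ⟨M', hM', h'⟩
      refine ⟨min M M', by positivity, fun x hx => ?_⟩
      rcases hx with hx | hx
      · exact (min_le_left _ _).trans (h x hx)
      · exact (min_le_right _ _).trans (h' x hx)
    · intro x hx
      have hx0 : 0 < ρ x := hρ.pos (by rintro rfl; simp at hx)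
      -- From `ρ x ≤ k (ρ (x - y) + ρ y)`: if the first term uses less than half of `ρ x / k`, the
      -- second is at least the other half.
      refine ⟨{y | ρ (x - y) < ρ x / (2 * k)},
        mem_nhdsWithin_of_mem_nhds (hρ.lt_sub_mem_nhds x (by positivity)),
        ρ x / (2 * k), by positivity, fun y hy => ?_⟩
      have h1 := hk (x - y) y
      rw [sub_add_cancel] at h1
      simp only [mem_ofPred_eq] at hy
      have h3 : ρ x / (2 * k) + ρ x / (2 * k) = ρ x / k := by field_simp; norm_num
      have h4 : ρ x / k ≤ ρ (x - y) + ρ y := by rw [div_le_iff₀ hk0]; linarith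
      linarith
  obtain ⟨m, hm, h⟩ := key
  exact ⟨m, hm, fun x hx => h x (by simpa using hx)⟩

lemma exists_dilation_norm_eq_one (hn : 0 < n) (hP : HasPositiveEigenvalues P)
    {x : EuclideanSpace ℝ (Fin n)} (hx : x ≠ 0) :
    ∃ t > 0, ‖dilation P t x‖ = 1 := by
  obtain ⟨s, hs⟩ := exists_norm_expMap_eq_one hn P hP hx
  exact ⟨Real.exp s, Real.exp_pos s, by rw [dilation_eq_expMap, Real.log_exp]; exact hs⟩

/-- Write `x = A_u w` with `|w| = 1`. Then `u = ρ x / ρ w` is at most `1 / m`, and the operators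
`A_u` are uniformly bounded for such `u`. -/
lemma bounded_lt_one (hn : 0 < n) (hP : HasPositiveEigenvalues P) (hρ : IsQuasiDistance P ρ) :
    ∃ R : ℝ, ∀ x, ρ x < 1 → ‖x‖ ≤ R := by
  obtain ⟨m, hm, hmle⟩ := hρ.bddBelow_on_sphere
  obtain ⟨C, hC, hCle⟩ := norm_expMap_bounded_Iic hn P hP (Real.log m⁻¹)
  refine ⟨C, fun x hx => ?_⟩
  by_cases hx0 : x = 0
  · simp [hx0, hC.le]
  obtain ⟨t, ht, hw⟩ := exists_dilation_norm_eq_one hn hP hx0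
  have h1 := hmle _ hw
  rw [hρ.map_dilation t ht] at h1
  have hmt : m ≤ t := by
    refine h1.trans ?_
    simpa using mul_le_mul_of_nonneg_left hx.le ht.le
  have h2 : x = expMap P (Real.log t⁻¹) (dilation P t x) := by
    rw [← dilation_eq_expMap, dilation_inv_dilation P ht]
  rw [h2]
  refine ((expMap P _).le_opNorm _).trans ?_
  rw [hw, mul_one]
  refine hCle _ (Real.log_le_log (by positivity) ?_)
  exact inv_anti₀ hm hmt

lemma lt_eq_preimage_dilation (hρ : IsQuasiDistance P ρ) {t : ℝ} (ht : 0 < t) :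
    {x | ρ x < t} = dilation P t⁻¹ ⁻¹' {x | ρ x < 1} := by
  ext x
  simp only [mem_ofPred_eq, mem_preimage]
  rw [hρ.map_dilation _ (inv_pos.2 ht), inv_mul_lt_iff₀ ht, mul_one]

lemma volume_preimage_dilation_inv {t : ℝ} (ht : 0 < t) (S : Set (EuclideanSpace ℝ (Fin n))) :
    volume (dilation P t⁻¹ ⁻¹' S) = ENNReal.ofReal (t ^ P.trace) * volume S := by
  have hdet : LinearMap.det (dilation P t⁻¹) = (t ^ P.trace)⁻¹ := by
    rw [det_dilation P (inv_pos.2 ht), Real.inv_rpow ht.le]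
  have hpos : 0 < t ^ P.trace := Real.rpow_pos_of_pos ht _
  rw [Measure.addHaar_preimage_linearMap _ (by rw [hdet]; positivity), hdet, inv_inv,
    abs_of_pos hpos]

lemma measurableSet_ellipsoid (hρ : IsQuasiDistance P ρ) (x : EuclideanSpace ℝ (Fin n)) (r : ℝ) :
    MeasurableSet (ellipsoid ρ x r) :=
  (hρ.measurable.comp (measurable_const.sub measurable_id)) measurableSet_Iio

lemma volume_ellipsoid (hρ : IsQuasiDistance P ρ) (x : EuclideanSpace ℝ (Fin n)) {t : ℝ}
    (ht : 0 < t) :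
    volume (ellipsoid ρ x t) = ENNReal.ofReal (t ^ P.trace) * volume {x | ρ x < 1} := by
  have h := (Measure.measurePreserving_sub_left (volume : Measure (EuclideanSpace ℝ (Fin n))) x
    ).measure_preimage (hρ.measurableSet_sublevel t).nullMeasurableSet
  have h2 : (fun y => x - y) ⁻¹' {x | ρ x < t} = ellipsoid ρ x t := rfl
  rw [← h2, h, hρ.lt_eq_preimage_dilation ht, volume_preimage_dilation_inv ht]

lemma volume_lt_one_ne_zero (hρ : IsQuasiDistance P ρ) : volume {x | ρ x < 1} ≠ 0 :=
  (Measure.measure_pos_of_mem_nhds _ (hρ.lt_mem_nhds_zero one_pos)).ne'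

lemma volume_lt_one_ne_top (hn : 0 < n) (hP : HasPositiveEigenvalues P)
    (hρ : IsQuasiDistance P ρ) : volume {x | ρ x < 1} ≠ ∞ := by
  obtain ⟨R, hR⟩ := hρ.bounded_lt_one hn hP
  refine ((measure_mono fun x hx => ?_).trans_lt
    (measure_closedBall_lt_top (x := (0 : EuclideanSpace ℝ (Fin n))) (r := R))).ne
  exact mem_closedBall_zero_iff.2 (hR x hx)

lemma volume_ellipsoid_ne_zero (hρ : IsQuasiDistance P ρ) (x : EuclideanSpace ℝ (Fin n)) {t : ℝ}
    (ht : 0 < t) : volume (ellipsoid ρ x t) ≠ 0 := by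
  rw [hρ.volume_ellipsoid x ht]
  refine mul_ne_zero ?_ hρ.volume_lt_one_ne_zero
  simpa using Real.rpow_pos_of_pos ht _

lemma volume_ellipsoid_ne_top (hn : 0 < n) (hP : HasPositiveEigenvalues P)
    (hρ : IsQuasiDistance P ρ) (x : EuclideanSpace ℝ (Fin n)) {t : ℝ}
    (ht : 0 < t) : volume (ellipsoid ρ x t) ≠ ∞ := by
  rw [hρ.volume_ellipsoid x ht]
  exact ENNReal.mul_ne_top ENNReal.ofReal_ne_top (hρ.volume_lt_one_ne_top hn hP)

lemma compact_subset_ellipsoid (hρ : IsQuasiDistance P ρ) {K : Set (EuclideanSpace ℝ (Fin n))}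
    (hK : IsCompact K) : ∃ r > 0, K ⊆ ellipsoid ρ 0 r := by
  obtain ⟨M, hM, h⟩ := hρ.bddAbove_on_compact hK
  refine ⟨M, hM, fun x hx => ?_⟩
  simp only [ellipsoid, mem_ofPred_eq, zero_sub, hρ.map_neg]
  exact h x hx

end IsQuasiDistance

/-! ### Polar coordinates: integrability of the kernel on the unit ellipsoid. -/

section PolarCoordinates

open scoped Pointwise

/-- The parabolic polar coordinate map `r w ↦ A_r w`, `r > 0`, `|w| = 1`. -/
def polarMap (P : Matrix (Fin n) (Fin n) ℝ) (y : EuclideanSpace ℝ (Fin n)) :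
    EuclideanSpace ℝ (Fin n) :=
  expMap P (Real.log ‖y‖) (‖y‖⁻¹ • y)

lemma contDiffOn_polarMap (P : Matrix (Fin n) (Fin n) ℝ) :
    ContDiffOn ℝ 1 (polarMap P) {0}ᶜ := by
  intro y hy
  have hy0 : y ≠ 0 := hy
  have hn0 : ‖y‖ ≠ 0 := norm_ne_zero_iff.2 hy0
  have h1 : ContDiffAt ℝ 1 (fun y : EuclideanSpace ℝ (Fin n) => ‖y‖) y :=
    contDiffAt_norm (n := 1) ℝ hy0
  have h2 : ContDiffAt ℝ 1 (fun y : EuclideanSpace ℝ (Fin n) => expMap P (Real.log ‖y‖)) y :=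
    ((contDiff_expMap P).contDiffAt).comp y (h1.log hn0)
  exact (h2.clm_apply ((h1.inv hn0).smul contDiffAt_id)).contDiffWithinAt

lemma exists_bound_det_fderiv_polarMap (P : Matrix (Fin n) (Fin n) ℝ) {a b : ℝ} (ha : 0 < a) :
    ∃ D : ℝ, ∀ y, a ≤ ‖y‖ → ‖y‖ ≤ b → |(fderiv ℝ (polarMap P) y).det| ≤ D := by
  have hK : IsCompact (Metric.closedBall (0 : EuclideanSpace ℝ (Fin n)) b ∩ {y | a ≤ ‖y‖}) :=
    (isCompact_closedBall _ _).inter_right (isClosed_le continuous_const continuous_norm)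
  have hsub : (Metric.closedBall (0 : EuclideanSpace ℝ (Fin n)) b ∩ {y | a ≤ ‖y‖}) ⊆ {0}ᶜ := by
    rintro y ⟨_, hy⟩ rfl
    simp only [mem_ofPred_eq, norm_zero] at hy
    linarith
  have hc : ContinuousOn (fun y => (fderiv ℝ (polarMap P) y).det)
      (Metric.closedBall (0 : EuclideanSpace ℝ (Fin n)) b ∩ {y | a ≤ ‖y‖}) :=
    ContinuousLinearMap.continuous_det.comp_continuousOn
      (((contDiffOn_polarMap P).continuousOn_fderiv_of_isOpen isOpen_compl_singleton le_rfl).mono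
        hsub)
  obtain ⟨D, hD⟩ := hK.exists_bound_of_continuousOn hc
  exact ⟨D, fun y h1 h2 => hD y ⟨mem_closedBall_zero_iff.2 h2, h1⟩⟩

namespace IsQuasiDistance

variable {P : Matrix (Fin n) (Fin n) ℝ} {ρ : EuclideanSpace ℝ (Fin n) → ℝ}

/-- A dilation-invariant set within the shell is covered by the polar image of a Euclidean sector in
an annulus, where the Jacobian is bounded. The shell keeps away from the origin, where `polarMap`
need not be smooth. Only an upper bound is needed, so injectivity plays no role. -/
lemma volume_shell_inter_le (hn : 0 < n) (hP : HasPositiveEigenvalues P)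
    (hρ : IsQuasiDistance P ρ) :
    ∃ C : ℝ≥0, ∀ A : Set (EuclideanSpace ℝ (Fin n)), MeasurableSet A →
      (∀ t : ℝ, 0 < t → ∀ x, dilation P t x ∈ A ↔ x ∈ A) →
      volume ({x | 1 / 2 ≤ ρ x ∧ ρ x < 1} ∩ A) ≤
        C * (volume : Measure (EuclideanSpace ℝ (Fin n))).toSphere {w | w.1 ∈ A} := by
  obtain ⟨m, hm, hmle⟩ := hρ.bddBelow_on_sphere
  obtain ⟨M, hM, hMle⟩ := hρ.bddAbove_on_compact
    (isCompact_sphere (0 : EuclideanSpace ℝ (Fin n)) 1)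
  -- A shell point is `A_u w` with `u = ρ x / ρ w`; `1/2 ≤ ρ x < 1` and `m ≤ ρ w < M` place `u`
  -- between `1 / (2 M)` and `1 / m`.
  obtain ⟨D, hD⟩ := exists_bound_det_fderiv_polarMap P (a := 1 / (2 * M)) (b := 1 / m)
    (by positivity)
  refine ⟨Real.toNNReal D * Real.toNNReal ((2 / m) ^ n), fun A hA hinv => ?_⟩
  set S : Set (EuclideanSpace ℝ (Fin n)) :=
    {y | 1 / (2 * M) ≤ ‖y‖} ∩ {y | ‖y‖ ≤ 1 / m} ∩ (fun y => ‖y‖⁻¹ • y) ⁻¹' A with hS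
  have hSm : MeasurableSet S := by
    refine ((measurableSet_le measurable_const measurable_norm).inter
      (measurableSet_le measurable_norm measurable_const)).inter ?_
    exact (by fun_prop : Measurable fun y : EuclideanSpace ℝ (Fin n) => ‖y‖⁻¹ • y) hA
  have hsub : {x | 1 / 2 ≤ ρ x ∧ ρ x < 1} ∩ A ⊆ polarMap P '' S := by
    rintro x ⟨⟨hx1, hx2⟩, hxA⟩
    have hx0 : x ≠ 0 := by
      rintro rfl
      rw [hρ.map_zero] at hx1
      norm_num at hx1
    obtain ⟨t, ht, hw⟩ := exists_dilation_norm_eq_one hn hP hx0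
    set w := dilation P t x with hwdef
    have hxw : dilation P t⁻¹ w = x := dilation_inv_dilation P ht x
    have ht' : 0 < t⁻¹ := inv_pos.2 ht
    have hρx : ρ x = t⁻¹ * ρ w := by rw [← hxw, hρ.map_dilation _ ht']
    have hny : ‖t⁻¹ • w‖ = t⁻¹ := by rw [norm_smul, hw, mul_one, Real.norm_of_nonneg ht'.le]
    have hyw : (t⁻¹)⁻¹ • t⁻¹ • w = w := by rw [smul_smul, inv_inv, mul_inv_cancel₀ ht.ne', one_smul]
    have hmw := hmle w hw
    have hMw := hMle w (by simpa using hw)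
    refine ⟨t⁻¹ • w, ⟨⟨?_, ?_⟩, ?_⟩, ?_⟩
    · simp only [mem_ofPred_eq, hny]
      rw [div_le_iff₀ (by positivity)]
      nlinarith
    · simp only [mem_ofPred_eq, hny]
      rw [le_div_iff₀ hm]
      nlinarith
    · simp only [mem_preimage, hny, hyw]
      exact (hinv t ht x).2 hxA
    · rw [polarMap, hny, hyw, ← dilation_eq_expMap, hxw]
  have hder : ∀ y ∈ S, HasFDerivWithinAt (polarMap P) (fderiv ℝ (polarMap P) y) S y := by
    intro y hy
    have hy0 : y ≠ 0 := by
      rintro rfl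
      have h : 1 / (2 * M) ≤ ‖(0 : EuclideanSpace ℝ (Fin n))‖ := hy.1.1
      rw [norm_zero] at h
      have : 0 < 1 / (2 * M) := by positivity
      linarith
    have := ((contDiffOn_polarMap P).contDiffAt (isOpen_compl_singleton.mem_nhds hy0)
      ).differentiableAt one_ne_zero
    exact this.hasFDerivAt.hasFDerivWithinAt
  have hSvol : volume S ≤ Real.toNNReal ((2 / m) ^ n) *
      (volume : Measure (EuclideanSpace ℝ (Fin n))).toSphere {w | w.1 ∈ A} := by
    have hAm : MeasurableSet {w : Metric.sphere (0 : EuclideanSpace ℝ (Fin n)) 1 | w.1 ∈ A} :=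
      measurable_subtype_coe hA
    -- The scale `2 / m` instead of `1 / m` makes the rescaled radius at most `1/2`, hence inside
    -- the open interval.
    have h1 : S ⊆ (2 / m) • (Ioo (0 : ℝ) 1 •
        (Subtype.val '' {w : Metric.sphere (0 : EuclideanSpace ℝ (Fin n)) 1 | w.1 ∈ A})) := by
      rintro y ⟨⟨hy1, hy2⟩, hy3⟩
      simp only [mem_ofPred_eq, mem_preimage] at hy1 hy2 hy3
      have hy0 : 0 < ‖y‖ := lt_of_lt_of_le (by positivity) hy1
      rw [mem_smul_set]
      refine ⟨((m / 2) * ‖y‖) • (‖y‖⁻¹ • y), ?_, ?_⟩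
      · refine Set.smul_mem_smul ⟨by positivity, ?_⟩ ⟨⟨‖y‖⁻¹ • y, ?_⟩, hy3, rfl⟩
        · rw [le_div_iff₀ hm] at hy2
          linarith
        · rw [mem_sphere_zero_iff_norm, norm_smul, norm_inv, norm_norm, inv_mul_cancel₀ hy0.ne']
      · rw [smul_smul, smul_smul]
        convert one_smul ℝ y using 2
        field_simp
    refine (measure_mono h1).trans ?_
    rw [Measure.addHaar_smul, finrank_euclideanSpace_fin, abs_of_pos (by positivity),
      Measure.toSphere_apply' _ hAm, finrank_euclideanSpace_fin]
    show ENNReal.ofReal _ * _ ≤ ENNReal.ofReal _ * _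
    gcongr
    refine le_mul_of_one_le_left bot_le ?_
    exact_mod_cast hn
  calc volume ({x | 1 / 2 ≤ ρ x ∧ ρ x < 1} ∩ A) ≤ volume (polarMap P '' S) := measure_mono hsub
    _ ≤ ∫⁻ y in S, ENNReal.ofReal |(fderiv ℝ (polarMap P) y).det| :=
      addHaar_image_le_lintegral_abs_det_fderiv volume hSm hder
    _ ≤ ∫⁻ y in S, (Real.toNNReal D : ℝ≥0∞) := by
      refine setLIntegral_mono measurable_const fun y hy => ?_
      exact ENNReal.ofReal_le_ofReal (hD y hy.1.1 hy.1.2)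
    _ = Real.toNNReal D * volume S := setLIntegral_const _ _
    _ ≤ _ := by
      rw [ENNReal.coe_mul, mul_assoc]
      gcongr

/-- The half-size piece is a dilate of the whole and has `θ = 2 ^ (-γ)` times its volume `V`. Hence
`V ≤ W + θ V` with `W` the shell volume, and finiteness of `V` allows solving for it. -/
lemma volume_lt_one_inter_le (hn : 0 < n) (hP : HasPositiveEigenvalues P)
    (hρ : IsQuasiDistance P ρ) (hγ : 0 < P.trace) :
    ∃ C : ℝ≥0, ∀ A : Set (EuclideanSpace ℝ (Fin n)), MeasurableSet A →
      (∀ t : ℝ, 0 < t → ∀ x, dilation P t x ∈ A ↔ x ∈ A) →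
      volume ({x | ρ x < 1} ∩ A) ≤
        C * (volume : Measure (EuclideanSpace ℝ (Fin n))).toSphere {w | w.1 ∈ A} := by
  obtain ⟨C, hC⟩ := hρ.volume_shell_inter_le hn hP
  set θ : ℝ := (1 / 2) ^ P.trace with hθ
  have hθ1 : θ < 1 := Real.rpow_lt_one (by norm_num) (by norm_num) hγ
  have hθ0 : 0 < θ := by positivity
  refine ⟨Real.toNNReal (1 - θ)⁻¹ * C, fun A hA hinv => ?_⟩
  set V := volume ({x | ρ x < 1} ∩ A) with hV
  set W := volume ({x | 1 / 2 ≤ ρ x ∧ ρ x < 1} ∩ A) with hW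
  have hVtop : V ≠ ∞ :=
    ((measure_mono inter_subset_left).trans_lt (hρ.volume_lt_one_ne_top hn hP).lt_top).ne
  have hWtop : W ≠ ∞ := ((measure_mono (by
    rintro x ⟨⟨_, h1⟩, h2⟩
    exact h1)).trans_lt (hρ.volume_lt_one_ne_top hn hP).lt_top).ne
  have hhalf : volume ({x | ρ x < 1 / 2} ∩ A) = ENNReal.ofReal θ * V := by
    rw [hV, hθ, ← volume_preimage_dilation_inv (P := P) (by norm_num : (0 : ℝ) < 1 / 2)]
    congr 1
    rw [preimage_inter, ← hρ.lt_eq_preimage_dilation (by norm_num)]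
    congr 1
    ext x
    exact (hinv _ (by norm_num) x).symm
  have hle : V ≤ W + ENNReal.ofReal θ * V := by
    rw [← hhalf]
    refine (measure_mono ?_).trans (measure_union_le _ _)
    rintro x ⟨hx1, hx2⟩
    rcases lt_or_ge (ρ x) (1 / 2) with h | h
    · exact Or.inr ⟨h, hx2⟩
    · exact Or.inl ⟨⟨h, hx1⟩, hx2⟩
  have hle' : V ≤ ENNReal.ofReal (1 - θ)⁻¹ * W := by
    lift V to ℝ≥0 using hVtop with v
    lift W to ℝ≥0 using hWtop with w
    have h1 : (v : ℝ) ≤ w + θ * v := by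
      have := ENNReal.toReal_mono (by finiteness) hle
      rw [ENNReal.toReal_add (by finiteness) (by finiteness), ENNReal.toReal_mul,
        ENNReal.toReal_ofReal hθ0.le] at this
      simpa using this
    rw [← ENNReal.ofReal_coe_nnreal, ← ENNReal.ofReal_coe_nnreal (p := w),
      ← ENNReal.ofReal_mul (by rw [inv_nonneg]; linarith)]
    refine ENNReal.ofReal_le_ofReal ?_
    rw [inv_mul_eq_div, le_div_iff₀ (by linarith)]
    linarith
  refine hle'.trans ?_
  rw [ENNReal.coe_mul, mul_assoc]
  show ENNReal.ofReal _ * _ ≤ ENNReal.ofReal _ * _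
  gcongr
  exact hC A hA hinv

/-- Preimages under `Ω` are dilation invariant, so the distribution of `Ω` on the unit ellipsoid is
dominated by a multiple of its distribution on the sphere. Membership in `L_s` depends only on the
distribution, which covers `s = ∞` as well. -/
lemma memLp_kernel (hn : 0 < n) (hP : HasPositiveEigenvalues P)
    (hρ : IsQuasiDistance P ρ) (hγ : 0 < P.trace) {s : ℝ≥0∞}
    {Ω : EuclideanSpace ℝ (Fin n) → ℝ} (hΩ : IsRoughKernel P s Ω) :
    MemLp Ω s (volume.restrict {x | ρ x < 1}) := by
  obtain ⟨C, hC⟩ := hρ.volume_lt_one_inter_le hn hP hγ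
  set σ := (volume : Measure (EuclideanSpace ℝ (Fin n))).toSphere with hσ
  have hn' : Nonempty (Fin n) := ⟨⟨0, hn⟩⟩
  have hσ0 : σ univ ≠ 0 := by
    rw [hσ, Measure.toSphere_apply_univ, finrank_euclideanSpace_fin]
    refine mul_ne_zero (by exact_mod_cast hn.ne') ?_
    exact (Metric.measure_ball_pos _ _ one_pos).ne'
  have hσt : σ univ ≠ ∞ := measure_ne_top σ univ
  have hmem : MemLp (fun w : Metric.sphere (0 : EuclideanSpace ℝ (Fin n)) 1 => Ω w) s σ := by
    have := hΩ.memLp.smul_measure (c := σ univ) hσt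
    rwa [sphereMeasure, smul_smul, ENNReal.mul_inv_cancel hσ0 hσt, one_smul] at this
  have hΩm : Measurable fun w : Metric.sphere (0 : EuclideanSpace ℝ (Fin n)) 1 => Ω w :=
    hΩ.measurable.comp measurable_subtype_coe
  have h1 : MemLp id s (Measure.map (fun w : Metric.sphere (0 : EuclideanSpace ℝ (Fin n)) 1 => Ω w)
      σ) := by
    rw [memLp_map_measure_iff aestronglyMeasurable_id hΩm.aemeasurable]
    exact hmem
  have h2 : Measure.map Ω (volume.restrict {x | ρ x < 1}) ≤ (C : ℝ≥0∞) •
      Measure.map (fun w : Metric.sphere (0 : EuclideanSpace ℝ (Fin n)) 1 => Ω w) σ := by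
    refine Measure.le_iff.2 fun B hB => ?_
    rw [Measure.map_apply hΩ.measurable hB, Measure.restrict_apply (hΩ.measurable hB),
      Measure.smul_apply, Measure.map_apply hΩm hB, inter_comm, smul_eq_mul]
    refine hC _ (hΩ.measurable hB) fun t ht x => ?_
    simp only [mem_preimage, hΩ.homogeneous t ht]
  have h3 := h1.of_measure_le_smul ENNReal.coe_ne_top h2
  rwa [memLp_map_measure_iff aestronglyMeasurable_id hΩ.measurable.aemeasurable] at h3

end IsQuasiDistance

end PolarCoordinates

/-! ### The maximal theorem for ellipsoids. -/

/-- The parabolic Hardy–Littlewood maximal function of a nonnegative function. -/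
def maximal (ρ : EuclideanSpace ℝ (Fin n) → ℝ) (g : EuclideanSpace ℝ (Fin n) → ℝ≥0∞)
    (x : EuclideanSpace ℝ (Fin n)) : ℝ≥0∞ :=
  ⨆ t ∈ Ioi (0 : ℝ), (volume (ellipsoid ρ x t))⁻¹ * ∫⁻ y in ellipsoid ρ x t, g y

/-- The maximal function over dyadic radii. -/
def dyadicMaximal (ρ : EuclideanSpace ℝ (Fin n) → ℝ) (g : EuclideanSpace ℝ (Fin n) → ℝ≥0∞)
    (x : EuclideanSpace ℝ (Fin n)) : ℝ≥0∞ :=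
  ⨆ j : ℤ, (volume (ellipsoid ρ x ((2 : ℝ) ^ j)))⁻¹ * ∫⁻ y in ellipsoid ρ x ((2 : ℝ) ^ j), g y

lemma le_maximal (ρ : EuclideanSpace ℝ (Fin n) → ℝ) (g : EuclideanSpace ℝ (Fin n) → ℝ≥0∞)
    (x : EuclideanSpace ℝ (Fin n)) {t : ℝ} (ht : 0 < t) :
    (volume (ellipsoid ρ x t))⁻¹ * ∫⁻ y in ellipsoid ρ x t, g y ≤ maximal ρ g x :=
  le_iSup₂_of_le (f := fun t (_ : t ∈ Ioi (0 : ℝ)) =>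
    (volume (ellipsoid ρ x t))⁻¹ * ∫⁻ y in ellipsoid ρ x t, g y) t ht le_rfl

lemma maximal_congr_ae (ρ : EuclideanSpace ℝ (Fin n) → ℝ)
    {g h : EuclideanSpace ℝ (Fin n) → ℝ≥0∞} (hgh : g =ᵐ[volume] h) :
    maximal ρ g = maximal ρ h := by
  funext x
  have h1 : ∀ t, ∫⁻ y in ellipsoid ρ x t, g y = ∫⁻ y in ellipsoid ρ x t, h y := fun t =>
    lintegral_congr_ae (ae_restrict_of_ae hgh)
  simp only [maximal, h1]

lemma ellipsoid_mono (ρ : EuclideanSpace ℝ (Fin n) → ℝ) (x : EuclideanSpace ℝ (Fin n)) {r t : ℝ}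
    (h : r ≤ t) : ellipsoid ρ x r ⊆ ellipsoid ρ x t := fun _ hy => lt_of_lt_of_le hy h

namespace IsQuasiDistance

variable {P : Matrix (Fin n) (Fin n) ℝ} {ρ : EuclideanSpace ℝ (Fin n) → ℝ}

lemma volume_ellipsoid_mul (hρ : IsQuasiDistance P ρ) (x z : EuclideanSpace ℝ (Fin n)) {a t : ℝ}
    (ha : 0 < a) (ht : 0 < t) :
    volume (ellipsoid ρ x (a * t)) = ENNReal.ofReal (a ^ P.trace) * volume (ellipsoid ρ z t) := by
  rw [hρ.volume_ellipsoid x (mul_pos ha ht), hρ.volume_ellipsoid z ht,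
    Real.mul_rpow ha.le ht.le, ENNReal.ofReal_mul (by positivity), mul_assoc]

/-- Vitali covering. Outer measure suffices throughout, so measurability of neither `g` nor the
level set is required. -/
lemma maximal_weak_type (hn : 0 < n) (hP : HasPositiveEigenvalues P)
    (hρ : IsQuasiDistance P ρ) (hγ : 0 < P.trace) :
    ∃ C : ℝ≥0, ∀ (g : EuclideanSpace ℝ (Fin n) → ℝ≥0∞) (l : ℝ≥0∞), l ≠ 0 → l ≠ ∞ →
      l * volume {x | l < maximal ρ g x} ≤ C * ∫⁻ y, g y := by
  obtain ⟨k, hk1, hk⟩ := hρ.exists_triangle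
  have hk0 : 0 < k := by linarith
  refine ⟨Real.toNNReal ((3 * k) ^ P.trace), fun g l hl0 hlt => ?_⟩
  have hCpos : (Real.toNNReal ((3 * k) ^ P.trace) : ℝ≥0∞) ≠ 0 := by
    have : 0 < (3 * k) ^ P.trace := by positivity
    simpa using this
  set A := {x | l < maximal ρ g x} with hA
  by_cases hg : ∫⁻ y, g y = ∞
  · rw [hg, ENNReal.mul_top hCpos]; exact le_top
  have hex : ∀ x ∈ A, ∃ t > 0, l * volume (ellipsoid ρ x t) < ∫⁻ y in ellipsoid ρ x t, g y := by
    intro x hx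
    obtain ⟨t, ht⟩ := lt_iSup_iff.1 (show l < maximal ρ g x from hx)
    obtain ⟨ht0, ht⟩ := lt_iSup_iff.1 ht
    refine ⟨t, ht0, ?_⟩
    have h0 := hρ.volume_ellipsoid_ne_zero x ht0
    have h1 := hρ.volume_ellipsoid_ne_top hn hP x ht0
    rw [mul_comm, ← div_eq_mul_inv] at ht
    exact (ENNReal.lt_div_iff_mul_lt (Or.inl h0) (Or.inl h1)).1 ht
  choose! t ht0 ht using hex
  set V := volume {x | ρ x < 1} with hV
  have hV0 : V ≠ 0 := hρ.volume_lt_one_ne_zero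
  have hVt : V ≠ ∞ := hρ.volume_lt_one_ne_top hn hP
  -- Vitali's lemma requires bounded radii: `l |E(x, t)| ≤ ∫ g` bounds `t ^ γ`.
  have hR : ∀ x ∈ A, t x ≤ (((∫⁻ y, g y) / (l * V)).toReal) ^ (P.trace)⁻¹ := by
    intro x hx
    have h1 : l * (ENNReal.ofReal (t x ^ P.trace) * V) ≤ ∫⁻ y, g y := by
      rw [← hρ.volume_ellipsoid x (ht0 x hx)]
      exact (ht x hx).le.trans (setLIntegral_le_lintegral _ _)
    have h2 : ENNReal.ofReal (t x ^ P.trace) ≤ (∫⁻ y, g y) / (l * V) := by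
      rw [ENNReal.le_div_iff_mul_le (Or.inl (mul_ne_zero hl0 hV0))
        (Or.inl (ENNReal.mul_ne_top hlt hVt))]
      refine le_trans (le_of_eq ?_) h1
      ring
    have h3 := ENNReal.toReal_mono
      (ENNReal.div_ne_top hg (mul_ne_zero hl0 hV0)) h2
    rw [ENNReal.toReal_ofReal (Real.rpow_nonneg (ht0 x hx).le _)] at h3
    have h4 := Real.rpow_le_rpow (Real.rpow_nonneg (ht0 x hx).le _) h3 (inv_nonneg.2 hγ.le)
    rwa [Real.rpow_rpow_inv (ht0 x hx).le hγ.ne'] at h4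
  obtain ⟨u, huA, hdisj, hcov⟩ := Vitali.exists_disjoint_subfamily_covering_enlargement
    (fun x => ellipsoid ρ x (t x)) A t 2 one_lt_two (fun x hx => (ht0 x hx).le) _ hR
    (fun x hx => ⟨x, by simpa [ellipsoid, hρ.map_zero] using ht0 x hx⟩)
  -- Disjoint sets with nonempty interior in a separable space are countably many; the centre is
  -- interior to its ellipsoid.
  have hucount : u.Countable := by
    refine hdisj.countable_of_nonempty_interior fun x hx => ?_
    exact ⟨x, mem_interior_iff_mem_nhds.2 (hρ.lt_sub_mem_nhds x (ht0 x (huA hx)))⟩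
  -- Each ellipsoid meets a selected one of at least half its radius, so the quasi-triangle
  -- inequality gives `k (1 + 2) = 3 k`.
  have hAsub : A ⊆ ⋃ b ∈ u, ellipsoid ρ b (3 * k * t b) := by
    intro a ha
    obtain ⟨b, hb, ⟨z, hz1, hz2⟩, hab⟩ := hcov a ha
    refine mem_iUnion₂.2 ⟨b, hb, ?_⟩
    have h1 := hk (b - z) (-(a - z))
    rw [hρ.map_neg] at h1
    have h2 : b - z + -(a - z) = b - a := by abel
    rw [h2] at h1
    simp only [ellipsoid, mem_ofPred_eq] at hz1 hz2 ⊢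
    refine h1.trans_lt ?_
    have : ρ (b - z) + ρ (a - z) < 3 * t b := by linarith
    nlinarith
  have hucount' : Countable u := hucount.to_subtype
  calc l * volume A ≤ l * volume (⋃ b ∈ u, ellipsoid ρ b (3 * k * t b)) := by gcongr
    _ ≤ l * ∑' b : u, volume (ellipsoid ρ b.1 (3 * k * t b.1)) := by
      gcongr
      exact measure_biUnion_le volume hucount _
    _ = ∑' b : u, Real.toNNReal ((3 * k) ^ P.trace) * (l * volume (ellipsoid ρ b.1 (t b.1))) := by
      rw [← ENNReal.tsum_mul_left]
      congr 1
      funext b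
      rw [hρ.volume_ellipsoid_mul b.1 b.1 (by positivity) (ht0 _ (huA b.2)), ENNReal.ofReal]
      ring
    _ ≤ ∑' b : u, Real.toNNReal ((3 * k) ^ P.trace) * ∫⁻ y in ellipsoid ρ b.1 (t b.1), g y := by
      refine ENNReal.tsum_le_tsum fun b => ?_
      gcongr
      exact (ht _ (huA b.2)).le
    _ = Real.toNNReal ((3 * k) ^ P.trace) * ∑' b : u, ∫⁻ y in ellipsoid ρ b.1 (t b.1), g y :=
      ENNReal.tsum_mul_left
    _ = Real.toNNReal ((3 * k) ^ P.trace) * ∫⁻ y in ⋃ b ∈ u, ellipsoid ρ b (t b), g y := by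
      rw [lintegral_biUnion hucount (fun b _ => hρ.measurableSet_ellipsoid b _) hdisj]
    _ ≤ _ := by
      gcongr
      exact Measure.restrict_le_self

/-- Enlarging the radius to the next power of two at most multiplies the volume by `2 ^ γ`. The
countable supremum is measurable, as the layer-cake formula requires. -/
lemma maximal_le_dyadicMaximal (hρ : IsQuasiDistance P ρ) (g : EuclideanSpace ℝ (Fin n) → ℝ≥0∞)
    (x : EuclideanSpace ℝ (Fin n)) :
    maximal ρ g x ≤ ENNReal.ofReal (2 ^ P.trace) * dyadicMaximal ρ g x := by
  refine iSup₂_le fun t (ht : 0 < t) => ?_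
  obtain ⟨j, hj1, hj2⟩ := exists_mem_Ioc_zpow ht one_lt_two
  refine le_trans ?_ (mul_le_mul_right (le_iSup (fun j : ℤ => (volume (ellipsoid ρ x ((2 : ℝ) ^ j)))⁻¹ *
    ∫⁻ y in ellipsoid ρ x ((2 : ℝ) ^ j), g y) (j + 1)) _)
  rw [← mul_assoc]
  refine mul_le_mul' ?_ (lintegral_mono_set (ellipsoid_mono ρ x hj2))
  rw [zpow_add_one₀ two_ne_zero, mul_comm ((2 : ℝ) ^ j), hρ.volume_ellipsoid_mul x x two_pos
    (by positivity), ENNReal.mul_inv (Or.inl (by simpa using Real.rpow_pos_of_pos two_pos _))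
    (Or.inl ENNReal.ofReal_ne_top), ← mul_assoc, ENNReal.mul_inv_cancel
    (by simpa using Real.rpow_pos_of_pos two_pos _) ENNReal.ofReal_ne_top, one_mul]
  exact ENNReal.inv_le_inv.2 (measure_mono (ellipsoid_mono ρ x hj1.le))

lemma measurable_dyadicMaximal (hρ : IsQuasiDistance P ρ)
    {g : EuclideanSpace ℝ (Fin n) → ℝ≥0∞} (hg : Measurable g) :
    Measurable (dyadicMaximal ρ g) := by
  refine Measurable.iSup fun j => ?_
  have h1 : (fun x => volume (ellipsoid ρ x ((2 : ℝ) ^ j))) =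
      fun _ => volume (ellipsoid ρ 0 ((2 : ℝ) ^ j)) := by
    funext x
    rw [hρ.volume_ellipsoid x (by positivity), hρ.volume_ellipsoid 0 (by positivity)]
  have h2 : Measurable fun x => ∫⁻ y in ellipsoid ρ x ((2 : ℝ) ^ j), g y := by
    simp_rw [← lintegral_indicator (hρ.measurableSet_ellipsoid _ _)]
    refine Measurable.lintegral_prod_right' (f := fun z : EuclideanSpace ℝ (Fin n) ×
      EuclideanSpace ℝ (Fin n) => (ellipsoid ρ z.1 ((2 : ℝ) ^ j)).indicator g z.2) ?_
    have hset : MeasurableSet {z : EuclideanSpace ℝ (Fin n) × EuclideanSpace ℝ (Fin n) |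
        ρ (z.1 - z.2) < (2 : ℝ) ^ j} :=
      (hρ.measurable.comp (measurable_fst.sub measurable_snd)) measurableSet_Iio
    exact (hg.comp measurable_snd).indicator hset
  have h3 : Measurable fun x => volume (ellipsoid ρ x ((2 : ℝ) ^ j)) := by
    rw [h1]; exact measurable_const
  exact h3.inv.mul h2

end IsQuasiDistance

/-- Finite values are the layer-cake formula for a Dirac mass; the value `∞` follows by comparison
with all finite ones. -/
lemma rpow_eq_lintegral {r : ℝ} (hr : 0 < r) (a : ℝ≥0∞) :
    a ^ r = ENNReal.ofReal r * ∫⁻ l in Ioi (0 : ℝ),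
      {l : ℝ | ENNReal.ofReal l < a}.indicator (fun l => ENNReal.ofReal (l ^ (r - 1))) l := by
  have hfin : ∀ b : ℝ, 0 ≤ b → ENNReal.ofReal b ^ r = ENNReal.ofReal r * ∫⁻ l in Ioi (0 : ℝ),
      {l : ℝ | ENNReal.ofReal l < ENNReal.ofReal b}.indicator
        (fun l => ENNReal.ofReal (l ^ (r - 1))) l := by
    intro b hb
    have h := lintegral_rpow_eq_lintegral_meas_lt_mul (Measure.dirac ()) (f := fun _ => b)
      (ae_of_all _ fun _ => hb) aemeasurable_const hr
    rw [lintegral_dirac] at h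
    rw [ENNReal.ofReal_rpow_of_nonneg hb hr.le, h]
    congr 1
    refine setLIntegral_congr_fun measurableSet_Ioi fun l (hl : 0 < l) => ?_
    by_cases hlb : l < b
    · have : ENNReal.ofReal l < ENNReal.ofReal b := (ENNReal.ofReal_lt_ofReal_iff (hl.trans hlb)).2 hlb
      simp [hlb, this]
    · have : ¬ ENNReal.ofReal l < ENNReal.ofReal b := by
        rw [not_lt] at hlb ⊢
        exact ENNReal.ofReal_le_ofReal hlb
      simp [hlb, this]
  by_cases ha : a = ∞
  · subst ha
    rw [ENNReal.top_rpow_of_pos hr]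
    symm
    rw [eq_top_iff]
    refine ENNReal.le_of_forall_nnreal_lt fun c _ => ?_
    have h1 : (c : ℝ≥0∞) = ENNReal.ofReal ((c : ℝ) ^ r⁻¹) ^ r := by
      rw [ENNReal.ofReal_rpow_of_nonneg (by positivity) hr.le, Real.rpow_inv_rpow c.coe_nonneg hr.ne',
        ENNReal.ofReal_coe_nnreal]
    rw [h1, hfin _ (by positivity)]
    gcongr
    exact le_top
  · rw [← ENNReal.ofReal_toReal ha]
    exact hfin _ ENNReal.toReal_nonneg

lemma measurableSet_ofReal_lt_prod {α : Type*} [MeasurableSpace α] {h : α → ℝ≥0∞}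
    (hh : Measurable h) : MeasurableSet {z : α × ℝ | ENNReal.ofReal z.2 < h z.1} :=
  measurableSet_lt (ENNReal.measurable_ofReal.comp measurable_snd) (hh.comp measurable_fst)

/-- Tonelli applied to `rpow_eq_lintegral`. The weight `g` allows two uses in the interpolation:
with weight `1` for the maximal function, and with weight `g` for the superlevel sets of `2 g`. -/
lemma lintegral_mul_rpow_eq {α : Type*} [MeasurableSpace α] (μ : Measure α) [SFinite μ] {r : ℝ}
    (hr : 0 < r) {g h : α → ℝ≥0∞} (hg : Measurable g) (hh : Measurable h) :
    ∫⁻ x, g x * h x ^ r ∂μ = ENNReal.ofReal r * ∫⁻ l in Ioi (0 : ℝ),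
      ENNReal.ofReal (l ^ (r - 1)) * ∫⁻ x in {x | ENNReal.ofReal l < h x}, g x ∂μ := by
  have hm : Measurable (fun z : α × ℝ => {z : α × ℝ | ENNReal.ofReal z.2 < h z.1}.indicator
      (fun z => g z.1 * ENNReal.ofReal (z.2 ^ (r - 1))) z) := by
    refine Measurable.indicator ?_ (measurableSet_ofReal_lt_prod hh)
    exact (hg.comp measurable_fst).mul
      (ENNReal.measurable_ofReal.comp (measurable_snd.pow_const _))
  calc ∫⁻ x, g x * h x ^ r ∂μ
      = ∫⁻ x, (ENNReal.ofReal r * ∫⁻ l in Ioi (0 : ℝ),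
        {z : α × ℝ | ENNReal.ofReal z.2 < h z.1}.indicator
          (fun z => g z.1 * ENNReal.ofReal (z.2 ^ (r - 1))) (x, l)) ∂μ := by
        refine lintegral_congr fun x => ?_
        rw [rpow_eq_lintegral hr, mul_left_comm, ← lintegral_const_mul]
        · congr 1
          refine lintegral_congr fun l => ?_
          by_cases hl : ENNReal.ofReal l < h x <;> simp [hl]
        · refine Measurable.indicator (by fun_prop) ?_
          exact measurableSet_lt ENNReal.measurable_ofReal measurable_const
    _ = ENNReal.ofReal r * ∫⁻ l in Ioi (0 : ℝ), (∫⁻ x,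
        {z : α × ℝ | ENNReal.ofReal z.2 < h z.1}.indicator
          (fun z => g z.1 * ENNReal.ofReal (z.2 ^ (r - 1))) (x, l) ∂μ) := by
        rw [lintegral_const_mul _ hm.lintegral_prod_right', lintegral_lintegral_swap hm.aemeasurable]
    _ = _ := by
        congr 1
        refine lintegral_congr fun l => ?_
        rw [← lintegral_indicator (measurableSet_lt measurable_const hh), ← lintegral_const_mul]
        · refine lintegral_congr fun x => ?_
          by_cases hl : ENNReal.ofReal l < h x <;> simp [hl, mul_comm]
        · exact hg.indicator (measurableSet_lt measurable_const hh)

namespace IsQuasiDistance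

variable {P : Matrix (Fin n) (Fin n) ℝ} {ρ : EuclideanSpace ℝ (Fin n) → ℝ}

/-- Truncation at height `l`: the part of `g` not exceeding `l` has means at most `l`. -/
lemma dyadicMaximal_le_add (hn : 0 < n) (hP : HasPositiveEigenvalues P) (hρ : IsQuasiDistance P ρ)
    (g : EuclideanSpace ℝ (Fin n) → ℝ≥0∞) (hg : Measurable g) (l : ℝ≥0∞)
    (x : EuclideanSpace ℝ (Fin n)) :
    dyadicMaximal ρ g x ≤ maximal ρ ({y | l < g y}.indicator g) x + l := by
  refine iSup_le fun j => ?_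
  have ht : (0 : ℝ) < 2 ^ j := by positivity
  refine le_trans ?_ (add_le_add_left (le_maximal ρ _ x ht) l)
  have h0 := hρ.volume_ellipsoid_ne_zero x ht
  have h1 := hρ.volume_ellipsoid_ne_top hn hP x ht
  have hm : MeasurableSet {y | l < g y} := measurableSet_lt measurable_const hg
  have h2 : ∫⁻ y in ellipsoid ρ x (2 ^ j), g y ≤
      (∫⁻ y in ellipsoid ρ x (2 ^ j), {y | l < g y}.indicator g y) +
        l * volume (ellipsoid ρ x (2 ^ j)) := by
    rw [← setLIntegral_const, ← lintegral_add_left (hg.indicator hm)]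
    refine lintegral_mono fun y => ?_
    by_cases hy : l < g y
    · simp [hy]
    · simpa [hy] using not_lt.1 hy
  calc _ ≤ (volume (ellipsoid ρ x (2 ^ j)))⁻¹ *
      ((∫⁻ y in ellipsoid ρ x (2 ^ j), {y | l < g y}.indicator g y) +
        l * volume (ellipsoid ρ x (2 ^ j))) := by gcongr
    _ = _ := by
      rw [mul_add, mul_comm l, ← mul_assoc, ENNReal.inv_mul_cancel h0 h1, one_mul]

/-- Marcinkiewicz interpolation between the weak `(1, 1)` bound and the trivial `L_∞` bound. -/
lemma maximal_strong_type (hn : 0 < n) (hP : HasPositiveEigenvalues P)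
    (hρ : IsQuasiDistance P ρ) (hγ : 0 < P.trace) {r : ℝ} (hr : 1 < r) :
    ∃ C : ℝ≥0, ∀ g : EuclideanSpace ℝ (Fin n) → ℝ≥0∞, AEMeasurable g →
      ∫⁻ x, maximal ρ g x ^ r ≤ C * ∫⁻ y, g y ^ r := by
  obtain ⟨C, hC⟩ := hρ.maximal_weak_type hn hP hγ
  have hr0 : 0 < r := by linarith
  have hr1 : 0 < r - 1 := by linarith
  suffices h : ∃ C : ℝ≥0, ∀ g : EuclideanSpace ℝ (Fin n) → ℝ≥0∞, Measurable g →
      ∫⁻ x, maximal ρ g x ^ r ≤ C * ∫⁻ y, g y ^ r by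
    obtain ⟨C, hC⟩ := h
    refine ⟨C, fun g hg => ?_⟩
    rw [maximal_congr_ae ρ hg.ae_eq_mk]
    refine (hC _ hg.measurable_mk).trans_eq ?_
    congr 1
    refine lintegral_congr_ae ?_
    filter_upwards [hg.ae_eq_mk] with x hx
    rw [hx]
  -- The factors come from passing to dyadic radii, the outer layer-cake formula, the weak type
  -- bound at level `l / 2`, and the inner layer-cake formula for `(2 g) ^ (r - 1)`.
  set D : ℝ≥0∞ := ENNReal.ofReal (2 ^ P.trace) ^ r *
    (ENNReal.ofReal r * (2 * C * (2 ^ (r - 1) / ENNReal.ofReal (r - 1)))) with hD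
  have hDt : D ≠ ∞ := by
    have h1 : ENNReal.ofReal (2 ^ P.trace) ^ r ≠ ∞ :=
      ENNReal.rpow_ne_top_of_nonneg hr0.le ENNReal.ofReal_ne_top
    have h2 : (2 : ℝ≥0∞) ^ (r - 1) ≠ ∞ := ENNReal.rpow_ne_top_of_nonneg hr1.le (by simp)
    have h3 : (2 : ℝ≥0∞) ^ (r - 1) / ENNReal.ofReal (r - 1) ≠ ∞ :=
      ENNReal.div_ne_top h2 (by simpa using hr)
    finiteness
  refine ⟨D.toNNReal, fun g hg => ?_⟩
  rw [ENNReal.coe_toNNReal hDt]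
  have hMm := hρ.measurable_dyadicMaximal hg
  have hlayer := lintegral_mul_rpow_eq (volume : Measure (EuclideanSpace ℝ (Fin n))) hr0
    (measurable_const (a := (1 : ℝ≥0∞))) hMm
  have h2g : Measurable fun y => 2 * g y := hg.const_mul 2
  have hlayer2 := lintegral_mul_rpow_eq (volume : Measure (EuclideanSpace ℝ (Fin n))) hr1 hg h2g
  have hlevel : ∀ l : ℝ, 0 < l →
      ENNReal.ofReal (l ^ (r - 1)) * ∫⁻ _ in {x | ENNReal.ofReal l < dyadicMaximal ρ g x}, 1 ≤
      2 * C * (ENNReal.ofReal (l ^ (r - 1 - 1)) *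
        ∫⁻ x in {x | ENNReal.ofReal l < 2 * g x}, g x) := by
    intro l hl
    set m := ENNReal.ofReal (l / 2) with hm
    have hm0 : m ≠ 0 := by simpa [hm] using hl
    have hmt : m ≠ ∞ := ENNReal.ofReal_ne_top
    have h2m : ENNReal.ofReal l = 2 * m := by
      rw [hm, ← ENNReal.ofReal_ofNat 2, ← ENNReal.ofReal_mul two_pos.le]
      congr 1; ring
    have hsetm : MeasurableSet {y | m < g y} := measurableSet_lt measurable_const hg
    have hset : {x | ENNReal.ofReal l < 2 * g x} = {y | m < g y} := by
      ext y
      simp only [mem_ofPred_eq, h2m]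
      exact ENNReal.mul_lt_mul_iff_right two_ne_zero (by simp)
    -- With `l = 2 m`, the part of `g` below `m` uses up half of the level.
    have hsub : {x | ENNReal.ofReal l < dyadicMaximal ρ g x} ⊆
        {x | m < maximal ρ ({y | m < g y}.indicator g) x} := by
      intro x hx
      have h1 := lt_of_lt_of_le (show ENNReal.ofReal l < dyadicMaximal ρ g x from hx)
        (hρ.dyadicMaximal_le_add hn hP g hg m x)
      rw [h2m, two_mul] at h1
      exact lt_of_add_lt_add_right h1
    have hw := hC ({y | m < g y}.indicator g) m hm0 hmt
    rw [lintegral_indicator hsetm] at hw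
    rw [setLIntegral_one, hset]
    have hpow : ENNReal.ofReal (l ^ (r - 1)) = ENNReal.ofReal (l ^ (r - 1 - 1)) * (2 * m) := by
      rw [← h2m, ← ENNReal.ofReal_mul (by positivity), ← Real.rpow_add_one hl.ne']
      congr 2; ring
    calc _ ≤ ENNReal.ofReal (l ^ (r - 1 - 1)) * (2 * m) *
        volume {x | m < maximal ρ ({y | m < g y}.indicator g) x} := by
          rw [hpow]; gcongr
      _ = ENNReal.ofReal (l ^ (r - 1 - 1)) * 2 *
        (m * volume {x | m < maximal ρ ({y | m < g y}.indicator g) x}) := by ring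
      _ ≤ ENNReal.ofReal (l ^ (r - 1 - 1)) * 2 * (C * ∫⁻ x in {y | m < g y}, g x) := by gcongr
      _ = _ := by ring
  have hr1' : ENNReal.ofReal (r - 1) ≠ 0 := by simpa using hr
  calc ∫⁻ x, maximal ρ g x ^ r
      ≤ ∫⁻ x, ENNReal.ofReal (2 ^ P.trace) ^ r * dyadicMaximal ρ g x ^ r := by
        refine lintegral_mono fun x => ?_
        rw [← ENNReal.mul_rpow_of_nonneg _ _ hr0.le]
        exact ENNReal.rpow_le_rpow (hρ.maximal_le_dyadicMaximal g x) hr0.le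
    _ = ENNReal.ofReal (2 ^ P.trace) ^ r * ∫⁻ x, 1 * dyadicMaximal ρ g x ^ r := by
        rw [lintegral_const_mul _ (hMm.pow_const _)]
        simp
    _ ≤ ENNReal.ofReal (2 ^ P.trace) ^ r * (ENNReal.ofReal r * ∫⁻ l in Ioi (0 : ℝ),
        2 * C * (ENNReal.ofReal (l ^ (r - 1 - 1)) *
          ∫⁻ x in {x | ENNReal.ofReal l < 2 * g x}, g x)) := by
        rw [hlayer]
        refine mul_le_mul_right (mul_le_mul_right ?_ _) _
        exact setLIntegral_mono' measurableSet_Ioi fun l hl => hlevel l hl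
    _ = ENNReal.ofReal (2 ^ P.trace) ^ r * (ENNReal.ofReal r * (2 * C *
          ((∫⁻ x, g x * (2 * g x) ^ (r - 1)) / ENNReal.ofReal (r - 1)))) := by
        rw [lintegral_const_mul' _ _ (by finiteness), hlayer2, mul_comm (ENNReal.ofReal (r - 1)),
          ENNReal.mul_div_cancel_right hr1' ENNReal.ofReal_ne_top]
    _ = D * ∫⁻ y, g y ^ r := by
        have : ∀ x, g x * (2 * g x) ^ (r - 1) = 2 ^ (r - 1) * g x ^ r := by
          intro x
          rw [ENNReal.mul_rpow_of_nonneg _ _ hr1.le, mul_left_comm]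
          congr 1
          conv_lhs => rw [← ENNReal.rpow_one (g x), ← ENNReal.rpow_mul, one_mul]
          rw [← ENNReal.rpow_add_of_nonneg _ _ zero_le_one hr1.le]
          congr 1; ring
        simp_rw [this]
        rw [lintegral_const_mul _ (hg.pow_const _), hD, div_eq_mul_inv, div_eq_mul_inv]
        ring

end IsQuasiDistance

/-! ### Means over ellipsoids and Hölder's inequality. -/

/-- Normalized Lebesgue measure on the ellipsoid `E(x, t)`. -/
def ellipsoidMean (ρ : EuclideanSpace ℝ (Fin n) → ℝ) (x : EuclideanSpace ℝ (Fin n)) (t : ℝ) :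
    Measure (EuclideanSpace ℝ (Fin n)) :=
  (volume (ellipsoid ρ x t))⁻¹ • volume.restrict (ellipsoid ρ x t)

lemma lintegral_ellipsoidMean (ρ : EuclideanSpace ℝ (Fin n) → ℝ) (x : EuclideanSpace ℝ (Fin n))
    (t : ℝ) (g : EuclideanSpace ℝ (Fin n) → ℝ≥0∞) :
    ∫⁻ y, g y ∂(ellipsoidMean ρ x t) =
      (volume (ellipsoid ρ x t))⁻¹ * ∫⁻ y in ellipsoid ρ x t, g y := by
  rw [ellipsoidMean, lintegral_smul_measure, smul_eq_mul]

lemma ellipsoidMean_absolutelyContinuous (ρ : EuclideanSpace ℝ (Fin n) → ℝ)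
    (x : EuclideanSpace ℝ (Fin n)) (t : ℝ) : ellipsoidMean ρ x t ≪ volume :=
  Measure.absolutelyContinuous_of_le Measure.restrict_le_self |>.smul_left _

lemma eLpNorm_ellipsoidMean {E : Type*} [NormedAddCommGroup E]
    (ρ : EuclideanSpace ℝ (Fin n) → ℝ) (x : EuclideanSpace ℝ (Fin n))
    (t : ℝ) {p : ℝ} (hp : 0 < p) (f : EuclideanSpace ℝ (Fin n) → E) :
    eLpNorm f (ENNReal.ofReal p) (ellipsoidMean ρ x t) =
      volume (ellipsoid ρ x t) ^ (-(1 / p)) *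
        eLpNorm f (ENNReal.ofReal p) (volume.restrict (ellipsoid ρ x t)) := by
  rw [ellipsoidMean, eLpNorm_smul_measure_of_ne_top ENNReal.ofReal_ne_top, smul_eq_mul,
    ENNReal.inv_rpow, ENNReal.rpow_neg]
  congr 3
  rw [one_div, ENNReal.toReal_inv, ENNReal.toReal_ofReal hp.le, one_div]

lemma eLpNorm_ofReal_rpow {α E : Type*} [MeasurableSpace α] [NormedAddCommGroup E] (μ : Measure α)
    {p : ℝ} (hp : 0 < p) (f : α → E) :
    eLpNorm f (ENNReal.ofReal p) μ ^ p = ∫⁻ y, ‖f y‖ₑ ^ p ∂μ := by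
  rw [eLpNorm_eq_lintegral_rpow_enorm_toReal (by simpa using hp) ENNReal.ofReal_ne_top,
    ENNReal.toReal_ofReal hp.le, ← ENNReal.rpow_mul, one_div, inv_mul_cancel₀ hp.ne',
    ENNReal.rpow_one]

lemma eLpNorm_ofReal_eq {α E : Type*} [MeasurableSpace α] [NormedAddCommGroup E] (μ : Measure α)
    {p : ℝ} (hp : 0 < p) (f : α → E) :
    eLpNorm f (ENNReal.ofReal p) μ = (∫⁻ y, ‖f y‖ₑ ^ p ∂μ) ^ (1 / p) := by
  rw [eLpNorm_eq_lintegral_rpow_enorm_toReal (by simpa using hp) ENNReal.ofReal_ne_top,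
    ENNReal.toReal_ofReal hp.le]

namespace IsQuasiDistance

variable {P : Matrix (Fin n) (Fin n) ℝ} {ρ : EuclideanSpace ℝ (Fin n) → ℝ}

lemma isProbabilityMeasure_ellipsoidMean (hn : 0 < n) (hP : HasPositiveEigenvalues P)
    (hρ : IsQuasiDistance P ρ) (x : EuclideanSpace ℝ (Fin n)) {t : ℝ} (ht : 0 < t) :
    IsProbabilityMeasure (ellipsoidMean ρ x t) := by
  constructor
  rw [ellipsoidMean, Measure.smul_apply, Measure.restrict_apply_univ, smul_eq_mul,
    ENNReal.inv_mul_cancel (hρ.volume_ellipsoid_ne_zero x ht)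
      (hρ.volume_ellipsoid_ne_top hn hP x ht)]

lemma measurable_dilation (t : ℝ) : Measurable (dilation P t) :=
  ((dilation P t).continuous_of_finiteDimensional).measurable

lemma map_ellipsoidMean (hρ : IsQuasiDistance P ρ)
    (x : EuclideanSpace ℝ (Fin n)) {t : ℝ} (ht : 0 < t) :
    Measure.map (fun y => dilation P t⁻¹ (x - y)) (ellipsoidMean ρ x t) =
      (volume {x | ρ x < 1})⁻¹ • volume.restrict {x | ρ x < 1} := by
  have hm : Measurable (fun y => dilation P t⁻¹ (x - y)) :=
    (measurable_dilation t⁻¹).comp (measurable_const.sub measurable_id)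
  have hset : ∀ S, volume ((fun y => dilation P t⁻¹ (x - y)) ⁻¹' S) =
      ENNReal.ofReal (t ^ P.trace) * volume S := by
    intro S
    rw [← volume_preimage_dilation_inv ht]
    have h2 := (Measure.measurePreserving_sub_left (volume : Measure (EuclideanSpace ℝ (Fin n))) x
      ).measure_preimage_emb (Homeomorph.subLeft x).measurableEmbedding (dilation P t⁻¹ ⁻¹' S)
    exact h2
  have hpre : (fun y => dilation P t⁻¹ (x - y)) ⁻¹' {x | ρ x < 1} = ellipsoid ρ x t := by
    have := hρ.lt_eq_preimage_dilation ht
    ext y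
    have h3 : x - y ∈ {x | ρ x < t} ↔ x - y ∈ dilation P t⁻¹ ⁻¹' {x | ρ x < 1} := by rw [this]
    exact h3.symm
  have hpos : ENNReal.ofReal (t ^ P.trace) ≠ 0 := by
    simpa using Real.rpow_pos_of_pos ht _
  ext S hS
  rw [Measure.map_apply hm hS, ellipsoidMean, Measure.smul_apply, Measure.smul_apply,
    Measure.restrict_apply (hm hS), Measure.restrict_apply hS, ← hpre, ← preimage_inter, hset, hset,
    smul_eq_mul, smul_eq_mul, ENNReal.mul_inv (Or.inl hpos) (Or.inl ENNReal.ofReal_ne_top),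
    mul_mul_mul_comm, ENNReal.inv_mul_cancel hpos ENNReal.ofReal_ne_top, one_mul]

/-- The substitution `y ↦ A_{1/t} (x - y)` carries the mean over `E(x, t)` to the mean over the unit
ellipsoid and leaves `Ω (x - y)` unchanged. The Hölder constant is therefore uniform in `x` and `t`.
-/
lemma eLpNorm_kernel (hρ : IsQuasiDistance P ρ) {s : ℝ≥0∞}
    {Ω : EuclideanSpace ℝ (Fin n) → ℝ} (hΩ : IsRoughKernel P s Ω)
    (x : EuclideanSpace ℝ (Fin n)) {t : ℝ} (ht : 0 < t) :
    eLpNorm (fun y => Ω (x - y)) s (ellipsoidMean ρ x t) =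
      eLpNorm Ω s ((volume {x | ρ x < 1})⁻¹ • volume.restrict {x | ρ x < 1}) := by
  have hm : Measurable (fun y => dilation P t⁻¹ (x - y)) :=
    (measurable_dilation t⁻¹).comp (measurable_const.sub measurable_id)
  rw [← hρ.map_ellipsoidMean x ht, eLpNorm_map_measure hΩ.measurable.aestronglyMeasurable
    hm.aemeasurable]
  congr 1
  funext y
  exact (hΩ.homogeneous _ (inv_pos.2 ht) _).symm

variable {𝕜 : Type*} [RCLike 𝕜]

lemma mean_kernel_le (hn : 0 < n) (hP : HasPositiveEigenvalues P)
    (hρ : IsQuasiDistance P ρ) (hγ : 0 < P.trace) {s s' : ℝ≥0∞} (hss' : s.HolderConjugate s')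
    {Ω : EuclideanSpace ℝ (Fin n) → ℝ} (hΩ : IsRoughKernel P s Ω) :
    ∃ K : ℝ≥0, K ≠ 0 ∧ ∀ f : EuclideanSpace ℝ (Fin n) → 𝕜, AEStronglyMeasurable f volume →
      ∀ x (t : ℝ), 0 < t → (volume (ellipsoid ρ x t))⁻¹ *
        ∫⁻ y in ellipsoid ρ x t, ‖Ω (x - y)‖ₑ * ‖f y‖ₑ ≤
          K * eLpNorm f s' (ellipsoidMean ρ x t) := by
  have hmem := (hρ.memLp_kernel hn hP hγ hΩ).smul_measure
    (ENNReal.inv_ne_top.2 hρ.volume_lt_one_ne_zero)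
  set K₀ := eLpNorm Ω s ((volume {x | ρ x < 1})⁻¹ • volume.restrict {x | ρ x < 1}) with hK₀
  -- The `+ 1` makes the constant nonzero, since the weak type estimate divides by it.
  refine ⟨K₀.toNNReal + 1, by positivity, fun f hf x t ht => ?_⟩
  have hΩx : Measurable fun y => Ω (x - y) :=
    hΩ.measurable.comp (measurable_const.sub measurable_id)
  have h1 := eLpNorm_smul_le_mul_eLpNorm (p := s) (q := s') (r := 1)
    (hf.mono_ac (ellipsoidMean_absolutelyContinuous ρ x t))
    (hΩx.aestronglyMeasurable (μ := ellipsoidMean ρ x t)) (hpqr := hss')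
  rw [hρ.eLpNorm_kernel hΩ x ht, eLpNorm_one_eq_lintegral_enorm, lintegral_ellipsoidMean] at h1
  have h2 : ∀ y, ‖((fun y => Ω (x - y)) • f) y‖ₑ = ‖Ω (x - y)‖ₑ * ‖f y‖ₑ := fun y => by
    simp [enorm_smul]
  simp_rw [h2] at h1
  refine h1.trans ?_
  gcongr
  rw [ENNReal.coe_add, ENNReal.coe_toNNReal hmem.2.ne]
  exact le_self_add

lemma roughMaximal_le_maximal {ρ Ω : EuclideanSpace ℝ (Fin n) → ℝ} {s' : ℝ≥0∞} (hs0 : s' ≠ 0)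
    (hst : s' ≠ ∞) {K : ℝ≥0} {f : EuclideanSpace ℝ (Fin n) → 𝕜}
    (hK : ∀ x (t : ℝ), 0 < t → (volume (ellipsoid ρ x t))⁻¹ *
        ∫⁻ y in ellipsoid ρ x t, ‖Ω (x - y)‖ₑ * ‖f y‖ₑ ≤ K * eLpNorm f s' (ellipsoidMean ρ x t))
    (x : EuclideanSpace ℝ (Fin n)) :
    roughMaximal ρ Ω f x ≤ K * maximal ρ (fun y => ‖f y‖ₑ ^ s'.toReal) x ^ (1 / s'.toReal) := by
  refine iSup₂_le fun t (ht : 0 < t) => (hK x t ht).trans ?_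
  gcongr
  rw [eLpNorm_eq_lintegral_rpow_enorm_toReal hs0 hst, lintegral_ellipsoidMean]
  gcongr
  exact le_maximal ρ _ x ht

end IsQuasiDistance

/-! ### Morrey bounds for the rough maximal operator. -/

namespace IsQuasiDistance

variable {P : Matrix (Fin n) (Fin n) ℝ} {ρ : EuclideanSpace ℝ (Fin n) → ℝ}
variable {𝕜 : Type*} [RCLike 𝕜]

lemma eLpNorm_mean_le_morreyNorm {p : ℝ} (hp : 0 < p)
    {ψ : EuclideanSpace ℝ (Fin n) → ℝ → ℝ} (hψ : ∀ x r, 0 < r → 0 < ψ x r)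
    (f : EuclideanSpace ℝ (Fin n) → 𝕜) (x : EuclideanSpace ℝ (Fin n)) {t : ℝ} (ht : 0 < t) :
    eLpNorm f (ENNReal.ofReal p) (ellipsoidMean ρ x t) ≤
      ENNReal.ofReal (ψ x t) * morreyNorm ρ p ψ f := by
  rw [eLpNorm_ellipsoidMean ρ x t hp]
  have h1 : (ENNReal.ofReal (ψ x t))⁻¹ * volume (ellipsoid ρ x t) ^ (-(1 / p)) *
      eLpNorm f (ENNReal.ofReal p) (volume.restrict (ellipsoid ρ x t)) ≤ morreyNorm ρ p ψ f :=
    le_iSup_of_le (f := fun x => ⨆ r ∈ Ioi (0 : ℝ), (ENNReal.ofReal (ψ x r))⁻¹ *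
      volume (ellipsoid ρ x r) ^ (-(1 / p)) *
      eLpNorm f (ENNReal.ofReal p) (volume.restrict (ellipsoid ρ x r))) x
      (le_iSup₂_of_le (f := fun r (_ : r ∈ Ioi (0 : ℝ)) => (ENNReal.ofReal (ψ x r))⁻¹ *
      volume (ellipsoid ρ x r) ^ (-(1 / p)) *
      eLpNorm f (ENNReal.ofReal p) (volume.restrict (ellipsoid ρ x r))) t ht le_rfl)
  have h0 : ENNReal.ofReal (ψ x t) ≠ 0 := by simpa using hψ x t ht
  rw [mul_assoc, ENNReal.inv_mul_le_iff h0 ENNReal.ofReal_ne_top] at h1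
  exact h1

lemma lintegral_rpow_le_morreyNorm (hn : 0 < n) (hP : HasPositiveEigenvalues P)
    (hρ : IsQuasiDistance P ρ) {p : ℝ} (hp : 0 < p)
    {φ : EuclideanSpace ℝ (Fin n) → ℝ → ℝ} (hφ : ∀ x r, 0 < r → 0 < φ x r)
    (f : EuclideanSpace ℝ (Fin n) → 𝕜) (x : EuclideanSpace ℝ (Fin n)) {t : ℝ} (ht : 0 < t) :
    ∫⁻ y in ellipsoid ρ x t, ‖f y‖ₑ ^ p ≤ volume (ellipsoid ρ x t) *
      (ENNReal.ofReal (φ x t) * morreyNorm ρ p (fun x r => φ x r ^ (1 / p)) f ^ p) := by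
  have h := ENNReal.rpow_le_rpow (eLpNorm_mean_le_morreyNorm (ρ := ρ) hp
    (ψ := fun x r => φ x r ^ (1 / p)) (fun x r hr => Real.rpow_pos_of_pos (hφ x r hr) _) f x ht) hp.le
  rw [eLpNorm_ofReal_rpow _ hp, lintegral_ellipsoidMean, ENNReal.mul_rpow_of_nonneg _ _ hp.le,
    ENNReal.ofReal_rpow_of_nonneg (Real.rpow_nonneg (hφ x t ht).le _) hp.le,
    ← Real.rpow_mul (hφ x t ht).le, one_div, inv_mul_cancel₀ hp.ne', Real.rpow_one,
    ENNReal.inv_mul_le_iff (hρ.volume_ellipsoid_ne_zero x ht)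
      (hρ.volume_ellipsoid_ne_top hn hP x ht)] at h
  simpa only [one_div] using h

/-- The essential infimum condition on `φ`, with `γ = tr P`. -/
def EssInfCondition (γ : ℝ) (φ : EuclideanSpace ℝ (Fin n) → ℝ → ℝ) (C : ℝ≥0) : Prop :=
  ∀ x r, 0 < r → ⨆ t ∈ Ioi r, ENNReal.ofReal (t ^ (-γ)) *
    essInf (fun τ : ℝ => ENNReal.ofReal (φ x τ * τ ^ γ)) (volume.restrict (Ioi t))
      ≤ C * ENNReal.ofReal (φ x r)

/-- The mass on `E(x, t)` is at most the mass on every larger `E(x, τ)`, hence at most a constant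
times `φ(x, τ) τ ^ γ` for all `τ > t`. Passing to the essential infimum brings in the condition and
replaces `φ(x, t)` by `φ(x, r)`. -/
lemma lintegral_rpow_le_of_essInfCondition (hn : 0 < n) (hP : HasPositiveEigenvalues P)
    (hρ : IsQuasiDistance P ρ) {p : ℝ} (hp : 0 < p)
    {φ : EuclideanSpace ℝ (Fin n) → ℝ → ℝ} (hφ : ∀ x r, 0 < r → 0 < φ x r) {C : ℝ≥0}
    (hC : EssInfCondition P.trace φ C)
    {f : EuclideanSpace ℝ (Fin n) → 𝕜} (hf : morreyNorm ρ p (fun x r => φ x r ^ (1 / p)) f < ∞)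
    (x : EuclideanSpace ℝ (Fin n)) {r t : ℝ} (hr : 0 < r) (hrt : r < t) :
    ∫⁻ y in ellipsoid ρ x t, ‖f y‖ₑ ^ p ≤ volume (ellipsoid ρ x t) *
      (C * ENNReal.ofReal (φ x r) * morreyNorm ρ p (fun x r => φ x r ^ (1 / p)) f ^ p) := by
  have ht : 0 < t := hr.trans hrt
  set N := morreyNorm ρ p (fun x r => φ x r ^ (1 / p)) f with hN
  set V := volume {x | ρ x < 1} with hV
  have hV0 : V ≠ 0 := hρ.volume_lt_one_ne_zero
  have hVt : V ≠ ∞ := hρ.volume_lt_one_ne_top hn hP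
  set L := ∫⁻ y in ellipsoid ρ x t, ‖f y‖ₑ ^ p with hL
  have hle : ∀ τ, t < τ → L ≤ ENNReal.ofReal (φ x τ * τ ^ P.trace) * (V * N ^ p) := by
    intro τ hτ
    have hτ0 : 0 < τ := ht.trans hτ
    refine (lintegral_mono_set (ellipsoid_mono ρ x hτ.le)).trans
      ((hρ.lintegral_rpow_le_morreyNorm hn hP hp hφ f x hτ0).trans_eq ?_)
    rw [hρ.volume_ellipsoid x hτ0, ENNReal.ofReal_mul (hφ x τ hτ0).le]
    ring
  have hNp : N ^ p ≠ ∞ := ENNReal.rpow_ne_top_of_nonneg hp.le hf.ne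
  -- The argument below divides by `N ^ p`.
  by_cases hN0 : N ^ p = 0
  · have := hle (t + 1) (by linarith)
    rw [hN0, mul_zero, mul_zero] at this
    exact this.trans bot_le
  have hess : L / (V * N ^ p) ≤
      essInf (fun τ : ℝ => ENNReal.ofReal (φ x τ * τ ^ P.trace)) (volume.restrict (Ioi t)) := by
    refine le_essInf_of_ae_le _ ?_
    filter_upwards [ae_restrict_mem measurableSet_Ioi] with τ hτ
    exact ENNReal.div_le_of_le_mul (hle τ hτ)
  have h1 : ENNReal.ofReal (t ^ (-P.trace)) * (L / (V * N ^ p)) ≤ C * ENNReal.ofReal (φ x r) := by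
    refine le_trans ?_ (hC x r hr)
    refine le_iSup₂_of_le (f := fun t (_ : t ∈ Ioi r) => ENNReal.ofReal (t ^ (-P.trace)) *
      essInf (fun τ : ℝ => ENNReal.ofReal (φ x τ * τ ^ P.trace)) (volume.restrict (Ioi t))) t hrt ?_
    gcongr
  have htγ : 0 < t ^ P.trace := Real.rpow_pos_of_pos ht _
  have h2 : L = volume (ellipsoid ρ x t) *
      (ENNReal.ofReal (t ^ (-P.trace)) * (L / (V * N ^ p)) * N ^ p) := by
    have h3 : ENNReal.ofReal (t ^ P.trace) * ENNReal.ofReal (t ^ (-P.trace)) = 1 := by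
      rw [← ENNReal.ofReal_mul htγ.le, Real.rpow_neg ht.le, mul_inv_cancel₀ htγ.ne',
        ENNReal.ofReal_one]
    calc L = L / (V * N ^ p) * (V * N ^ p) :=
          (ENNReal.div_mul_cancel (mul_ne_zero hV0 hN0) (ENNReal.mul_ne_top hVt hNp)).symm
      _ = (ENNReal.ofReal (t ^ P.trace) * ENNReal.ofReal (t ^ (-P.trace))) *
          (L / (V * N ^ p) * (V * N ^ p)) := by rw [h3, one_mul]
      _ = _ := by rw [hρ.volume_ellipsoid x ht]; ring
  rw [h2]
  gcongr

lemma eLpNorm_mean_le_of_essInfCondition (hn : 0 < n) (hP : HasPositiveEigenvalues P)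
    (hρ : IsQuasiDistance P ρ) {p : ℝ} (hp : 0 < p)
    {φ : EuclideanSpace ℝ (Fin n) → ℝ → ℝ} (hφ : ∀ x r, 0 < r → 0 < φ x r) {C : ℝ≥0}
    (hC : EssInfCondition P.trace φ C)
    {f : EuclideanSpace ℝ (Fin n) → 𝕜} (hf : morreyNorm ρ p (fun x r => φ x r ^ (1 / p)) f < ∞)
    (x : EuclideanSpace ℝ (Fin n)) {r t : ℝ} (hr : 0 < r) (hrt : r < t) :
    eLpNorm f (ENNReal.ofReal p) (ellipsoidMean ρ x t) ≤
      (C * ENNReal.ofReal (φ x r)) ^ (1 / p) *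
        morreyNorm ρ p (fun x r => φ x r ^ (1 / p)) f := by
  have ht : 0 < t := hr.trans hrt
  have h := hρ.lintegral_rpow_le_of_essInfCondition hn hP hp hφ hC hf x hr hrt
  rw [← ENNReal.inv_mul_le_iff (hρ.volume_ellipsoid_ne_zero x ht)
      (hρ.volume_ellipsoid_ne_top hn hP x ht), ← lintegral_ellipsoidMean] at h
  rw [eLpNorm_ofReal_eq _ hp]
  refine (ENNReal.rpow_le_rpow h (by positivity)).trans_eq ?_
  rw [ENNReal.mul_rpow_of_nonneg _ _ (by positivity), ← ENNReal.rpow_mul, mul_one_div,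
    div_self hp.ne', ENNReal.rpow_one]

lemma exists_subset_ellipsoid (hρ : IsQuasiDistance P ρ) :
    ∃ k : ℝ, 1 ≤ k ∧ ∀ x x₀ (r t : ℝ), r ≤ t → x ∈ ellipsoid ρ x₀ r →
      ellipsoid ρ x t ⊆ ellipsoid ρ x₀ (k * t) := by
  obtain ⟨k, hk1, hk⟩ := hρ.exists_triangle
  refine ⟨2 * k, by linarith, fun x x₀ r t hrt hx y hy => ?_⟩
  simp only [ellipsoid, mem_ofPred_eq] at hx hy ⊢
  have h1 := hk (x₀ - x) (x - y)
  rw [sub_add_sub_cancel] at h1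
  have : 0 < k := by linarith
  nlinarith

/-- The means of a Morrey function over ellipsoids of radius at least `r` centred in `E(x₀, r)`. -/
lemma exists_mean_le (hn : 0 < n) (hP : HasPositiveEigenvalues P)
    (hρ : IsQuasiDistance P ρ) {p : ℝ} (hp : 0 < p)
    {φ : EuclideanSpace ℝ (Fin n) → ℝ → ℝ} (hφ : ∀ x r, 0 < r → 0 < φ x r) {C : ℝ≥0}
    (hC : EssInfCondition P.trace φ C) :
    ∃ D : ℝ≥0, ∀ f : EuclideanSpace ℝ (Fin n) → 𝕜,
      morreyNorm ρ p (fun x r => φ x r ^ (1 / p)) f < ∞ →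
      ∀ x₀ x (r t : ℝ), 0 < r → r < t → x ∈ ellipsoid ρ x₀ r →
      eLpNorm f (ENNReal.ofReal p) (ellipsoidMean ρ x t) ≤
        D * (ENNReal.ofReal (φ x₀ r) ^ (1 / p) *
          morreyNorm ρ p (fun x r => φ x r ^ (1 / p)) f) := by
  obtain ⟨k, hk1, hk⟩ := hρ.exists_subset_ellipsoid
  have hk0 : 0 < k := by linarith
  set D : ℝ≥0∞ := ENNReal.ofReal (k ^ P.trace) ^ (1 / p) * (C : ℝ≥0∞) ^ (1 / p) with hD
  have hDt : D ≠ ∞ := ENNReal.mul_ne_top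
    (ENNReal.rpow_ne_top_of_nonneg (by positivity) ENNReal.ofReal_ne_top)
    (ENNReal.rpow_ne_top_of_nonneg (by positivity) ENNReal.coe_ne_top)
  refine ⟨D.toNNReal, fun f hf x₀ x r t hr hrt hx => ?_⟩
  rw [ENNReal.coe_toNNReal hDt]
  have ht : 0 < t := hr.trans hrt
  have hkt : r < k * t := by nlinarith
  have h1 := hρ.eLpNorm_mean_le_of_essInfCondition hn hP hp hφ hC hf x₀ hr hkt
  have hkγ : ENNReal.ofReal (k ^ P.trace) ≠ 0 := by simpa using Real.rpow_pos_of_pos hk0 _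
  -- Recentring at `x₀` costs `k ^ γ`, the volume ratio of `E(x₀, k t)` and `E(x, t)`.
  have h2 : ellipsoidMean ρ x t ≤ ENNReal.ofReal (k ^ P.trace) • ellipsoidMean ρ x₀ (k * t) := by
    rw [ellipsoidMean, ellipsoidMean, smul_smul, hρ.volume_ellipsoid_mul x₀ x hk0 ht,
      ENNReal.mul_inv (Or.inl hkγ) (Or.inl ENNReal.ofReal_ne_top), ← mul_assoc,
      ENNReal.mul_inv_cancel hkγ ENNReal.ofReal_ne_top, one_mul]
    gcongr
    exact hk x x₀ r t hrt.le hx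
  refine (eLpNorm_mono_measure f h2).trans ?_
  rw [eLpNorm_smul_measure_of_ne_top ENNReal.ofReal_ne_top, smul_eq_mul, one_div,
    ENNReal.toReal_inv, ENNReal.toReal_ofReal hp.le, ← one_div]
  refine (mul_le_mul_right h1 _).trans_eq ?_
  rw [hD, ENNReal.mul_rpow_of_nonneg _ _ (by positivity)]
  ring

/-- Ellipsoids of radius at most `r` around `x` stay in an enlargement of `E(x₀, r)` and see only
the truncated function; larger ones are covered by Hölder and `exists_mean_le`. -/
lemma roughMaximal_le_add (hn : 0 < n) (hP : HasPositiveEigenvalues P)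
    (hρ : IsQuasiDistance P ρ) {p : ℝ} (hp : 0 < p)
    {φ : EuclideanSpace ℝ (Fin n) → ℝ → ℝ} (hφ : ∀ x r, 0 < r → 0 < φ x r) {C : ℝ≥0}
    (hC : EssInfCondition P.trace φ C) {s' : ℝ≥0∞} (hsp : s' ≤ ENNReal.ofReal p) :
    ∃ k : ℝ, 1 < k ∧ ∃ D : ℝ≥0, ∀ (Ω : EuclideanSpace ℝ (Fin n) → ℝ) (K : ℝ≥0)
      (f : EuclideanSpace ℝ (Fin n) → 𝕜), AEStronglyMeasurable f volume →
      morreyNorm ρ p (fun x r => φ x r ^ (1 / p)) f < ∞ →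
      (∀ x (t : ℝ), 0 < t → (volume (ellipsoid ρ x t))⁻¹ *
        ∫⁻ y in ellipsoid ρ x t, ‖Ω (x - y)‖ₑ * ‖f y‖ₑ ≤ K * eLpNorm f s' (ellipsoidMean ρ x t)) →
      ∀ x₀ (r : ℝ), 0 < r → ∀ x ∈ ellipsoid ρ x₀ r,
        roughMaximal ρ Ω f x ≤ roughMaximal ρ Ω ((ellipsoid ρ x₀ (k * r)).indicator f) x +
          K * (D * (ENNReal.ofReal (φ x₀ r) ^ (1 / p) *
            morreyNorm ρ p (fun x r => φ x r ^ (1 / p)) f)) := by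
  obtain ⟨k, hk1, hk⟩ := hρ.exists_subset_ellipsoid
  obtain ⟨D, hD⟩ := hρ.exists_mean_le (𝕜 := 𝕜) hn hP hp hφ hC
  -- The enlargement factor must exceed `1` strictly, because the essential infimum bound concerns
  -- radii strictly larger than `r`.
  refine ⟨k + 1, by linarith, D, fun Ω K f hfm hf hK x₀ r hr x hx => ?_⟩
  refine iSup₂_le fun t (ht : 0 < t) => ?_
  rcases le_or_gt t r with htr | hrt
  · refine le_trans ?_ le_self_add
    have hsub : ellipsoid ρ x t ⊆ ellipsoid ρ x₀ ((k + 1) * r) :=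
      (ellipsoid_mono ρ x htr).trans ((hk x x₀ r r le_rfl hx).trans
        (ellipsoid_mono ρ x₀ (by nlinarith)))
    refine le_trans (le_of_eq ?_) (le_iSup₂_of_le (f := fun t (_ : t ∈ Ioi (0 : ℝ)) =>
      (volume (ellipsoid ρ x t))⁻¹ * ∫⁻ y in ellipsoid ρ x t, ‖Ω (x - y)‖ₑ *
        ‖(ellipsoid ρ x₀ ((k + 1) * r)).indicator f y‖ₑ) t ht le_rfl)
    congr 1
    refine setLIntegral_congr_fun (hρ.measurableSet_ellipsoid x t) fun y hy => ?_
    simp only [indicator_of_mem (hsub hy)]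
  · refine le_trans ?_ le_add_self
    refine (hK x t ht).trans ?_
    gcongr
    have := hρ.isProbabilityMeasure_ellipsoidMean hn hP x ht
    exact (eLpNorm_le_eLpNorm_of_exponent_le hsp
      (hfm.mono_ac (ellipsoidMean_absolutelyContinuous ρ x t))).trans (hD f hf x₀ x r t hr hrt hx)

end IsQuasiDistance

namespace IsQuasiDistance

variable {P : Matrix (Fin n) (Fin n) ℝ} {ρ : EuclideanSpace ℝ (Fin n) → ℝ}
variable {𝕜 : Type*} [RCLike 𝕜]

/-- The `L_p` mass of `f` on the enlarged ellipsoid `E(x₀, k r)`, `k > 1`. -/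
lemma lintegral_enlarged_le (hn : 0 < n) (hP : HasPositiveEigenvalues P)
    (hρ : IsQuasiDistance P ρ) {p : ℝ} (hp : 0 < p)
    {φ : EuclideanSpace ℝ (Fin n) → ℝ → ℝ} (hφ : ∀ x r, 0 < r → 0 < φ x r) {C : ℝ≥0}
    (hC : EssInfCondition P.trace φ C) {k : ℝ} (hk : 1 < k)
    {f : EuclideanSpace ℝ (Fin n) → 𝕜} (hf : morreyNorm ρ p (fun x r => φ x r ^ (1 / p)) f < ∞)
    (x₀ : EuclideanSpace ℝ (Fin n)) {r : ℝ} (hr : 0 < r) :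
    ∫⁻ y, ‖(ellipsoid ρ x₀ (k * r)).indicator f y‖ₑ ^ p ≤
      ENNReal.ofReal (k ^ P.trace) * C * (volume (ellipsoid ρ x₀ r) * (ENNReal.ofReal (φ x₀ r) *
        morreyNorm ρ p (fun x r => φ x r ^ (1 / p)) f ^ p)) := by
  have h1 : ∀ y, ‖(ellipsoid ρ x₀ (k * r)).indicator f y‖ₑ ^ p =
      (ellipsoid ρ x₀ (k * r)).indicator (fun y => ‖f y‖ₑ ^ p) y := by
    intro y
    by_cases hy : y ∈ ellipsoid ρ x₀ (k * r) <;> simp [hy, hp]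
  simp_rw [h1]
  rw [lintegral_indicator (hρ.measurableSet_ellipsoid _ _)]
  refine (hρ.lintegral_rpow_le_of_essInfCondition hn hP hp hφ hC hf x₀ hr
    (by nlinarith : r < k * r)).trans_eq ?_
  rw [hρ.volume_ellipsoid_mul x₀ x₀ (by linarith) hr]
  ring

/-- The local part is bounded by the maximal theorem for `|f₁| ^ s'` in exponent `p / s' > 1`; the
far part is a constant on `E(x₀, r)`. -/
lemma roughMaximal_morrey_strong (hn : 0 < n) (hP : HasPositiveEigenvalues P)
    (hρ : IsQuasiDistance P ρ) (hγ : 0 < P.trace) {s s' : ℝ≥0∞} (hss' : s.HolderConjugate s')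
    {Ω : EuclideanSpace ℝ (Fin n) → ℝ} (hΩ : IsRoughKernel P s Ω)
    {p : ℝ} (hsp : s' < ENNReal.ofReal p)
    {φ : EuclideanSpace ℝ (Fin n) → ℝ → ℝ} (hφ : ∀ x r, 0 < r → 0 < φ x r) {C : ℝ≥0}
    (hC : EssInfCondition P.trace φ C) :
    ∃ D : ℝ≥0, ∀ f : EuclideanSpace ℝ (Fin n) → 𝕜, AEStronglyMeasurable f volume →
      morreyNorm ρ p (fun x r => φ x r ^ (1 / p)) f < ∞ → ∀ x₀ (r : ℝ), 0 < r →
      ∫⁻ x in ellipsoid ρ x₀ r, roughMaximal ρ Ω f x ^ p ≤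
        D * (volume (ellipsoid ρ x₀ r) * (ENNReal.ofReal (φ x₀ r) *
          morreyNorm ρ p (fun x r => φ x r ^ (1 / p)) f ^ p)) := by
  have hconj : s'.HolderConjugate s := ENNReal.HolderTriple.symm
  have hs1 : 1 ≤ s' := ENNReal.HolderConjugate.one_le s' s
  have hs0 : s' ≠ 0 := (zero_lt_one.trans_le hs1).ne'
  have hst : s' ≠ ∞ := (hsp.trans ENNReal.ofReal_lt_top).ne
  have hσ0 : 0 < s'.toReal := ENNReal.toReal_pos hs0 hst
  have hσp : s'.toReal < p := (ENNReal.lt_ofReal_iff_toReal_lt hst).1 hsp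
  have hσ1 : 1 ≤ s'.toReal := by
    have := ENNReal.toReal_mono hst hs1
    simpa using this
  have hp : 0 < p := hσ0.trans hσp
  have hp1 : 1 ≤ p := hσ1.trans hσp.le
  set σ := s'.toReal with hσ
  obtain ⟨K, -, hK⟩ := hρ.mean_kernel_le (𝕜 := 𝕜) hn hP hγ hss' hΩ
  obtain ⟨A, hA⟩ := hρ.maximal_strong_type hn hP hγ (r := p / σ) ((one_lt_div hσ0).2 hσp)
  obtain ⟨k, hk1, B, hB⟩ := hρ.roughMaximal_le_add (𝕜 := 𝕜) hn hP hp hφ hC hsp.le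
  set D : ℝ≥0∞ := 2 ^ (p - 1) * ((K : ℝ≥0∞) ^ p * (A * (ENNReal.ofReal (k ^ P.trace) * C)) +
    (K * B : ℝ≥0∞) ^ p) with hD
  have hDt : D ≠ ∞ := by
    have h1 : (2 : ℝ≥0∞) ^ (p - 1) ≠ ∞ :=
      ENNReal.rpow_ne_top_of_nonneg (by linarith) ENNReal.ofNat_ne_top
    have h2 : (K : ℝ≥0∞) ^ p ≠ ∞ := ENNReal.rpow_ne_top_of_nonneg hp.le ENNReal.coe_ne_top
    have h3 : (K * B : ℝ≥0∞) ^ p ≠ ∞ :=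
      ENNReal.rpow_ne_top_of_nonneg hp.le (ENNReal.mul_ne_top ENNReal.coe_ne_top ENNReal.coe_ne_top)
    finiteness
  refine ⟨D.toNNReal, fun f hfm hf x₀ r hr => ?_⟩
  rw [ENNReal.coe_toNNReal hDt]
  set N := morreyNorm ρ p (fun x r => φ x r ^ (1 / p)) f with hN
  set E := ellipsoid ρ x₀ r with hE
  set f₁ := (ellipsoid ρ x₀ (k * r)).indicator f with hf₁
  have hf₁m : AEStronglyMeasurable f₁ volume := hfm.indicator (hρ.measurableSet_ellipsoid _ _)
  set b : ℝ≥0∞ := K * (B * (ENNReal.ofReal (φ x₀ r) ^ (1 / p) * N)) with hb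
  have hbp : b ^ p = (K * B : ℝ≥0∞) ^ p * (ENNReal.ofReal (φ x₀ r) * N ^ p) := by
    rw [hb, ← mul_assoc, ENNReal.mul_rpow_of_nonneg _ _ hp.le,
      ENNReal.mul_rpow_of_nonneg (ENNReal.ofReal (φ x₀ r) ^ (1 / p)) _ hp.le, ← ENNReal.rpow_mul,
      one_div, inv_mul_cancel₀ hp.ne', ENNReal.rpow_one]
  have hpt : ∀ x ∈ E, roughMaximal ρ Ω f x ^ p ≤ 2 ^ (p - 1) *
      ((K : ℝ≥0∞) ^ p * maximal ρ (fun y => ‖f₁ y‖ₑ ^ σ) x ^ (p / σ) + b ^ p) := by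
    intro x hx
    refine (ENNReal.rpow_le_rpow (hB Ω K f hfm hf (hK f hfm) x₀ r hr x hx) hp.le).trans ?_
    refine (ENNReal.rpow_add_le_mul_rpow_add_rpow _ _ hp1).trans ?_
    gcongr
    refine (ENNReal.rpow_le_rpow (roughMaximal_le_maximal hs0 hst (hK f₁ hf₁m) x) hp.le).trans_eq ?_
    rw [ENNReal.mul_rpow_of_nonneg _ _ hp.le, ← ENNReal.rpow_mul, one_div_mul_eq_div]
  have hEm : MeasurableSet E := hρ.measurableSet_ellipsoid _ _
  have hg : AEMeasurable (fun y => ‖f₁ y‖ₑ ^ σ) := hf₁m.enorm.pow_const _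
  have h2t : (2 : ℝ≥0∞) ^ (p - 1) ≠ ∞ :=
    ENNReal.rpow_ne_top_of_nonneg (by linarith) ENNReal.ofNat_ne_top
  have hKt : (K : ℝ≥0∞) ^ p ≠ ∞ := ENNReal.rpow_ne_top_of_nonneg hp.le ENNReal.coe_ne_top
  have hstrong : ∫⁻ x, maximal ρ (fun y => ‖f₁ y‖ₑ ^ σ) x ^ (p / σ) ≤
      A * (ENNReal.ofReal (k ^ P.trace) * C * (volume E * (ENNReal.ofReal (φ x₀ r) * N ^ p))) := by
    refine (hA _ hg).trans ?_
    gcongr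
    refine le_trans (le_of_eq ?_) (hρ.lintegral_enlarged_le hn hP hp hφ hC hk1 hf x₀ hr)
    refine lintegral_congr fun y => ?_
    rw [← ENNReal.rpow_mul, mul_div_cancel₀ _ hσ0.ne']
  calc ∫⁻ x in E, roughMaximal ρ Ω f x ^ p
      ≤ ∫⁻ x in E, 2 ^ (p - 1) *
        ((K : ℝ≥0∞) ^ p * maximal ρ (fun y => ‖f₁ y‖ₑ ^ σ) x ^ (p / σ) + b ^ p) :=
        setLIntegral_mono' hEm hpt
    _ = 2 ^ (p - 1) * ((K : ℝ≥0∞) ^ p *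
        (∫⁻ x in E, maximal ρ (fun y => ‖f₁ y‖ₑ ^ σ) x ^ (p / σ)) + b ^ p * volume E) := by
        rw [lintegral_const_mul' _ _ h2t, lintegral_add_right _ measurable_const,
          lintegral_const_mul' _ _ hKt, setLIntegral_const]
    _ ≤ 2 ^ (p - 1) * ((K : ℝ≥0∞) ^ p * (A * (ENNReal.ofReal (k ^ P.trace) * C *
        (volume E * (ENNReal.ofReal (φ x₀ r) * N ^ p)))) + b ^ p * volume E) := by
        gcongr
        exact (setLIntegral_le_lintegral _ _).trans hstrong
    _ = D * (volume E * (ENNReal.ofReal (φ x₀ r) * N ^ p)) := by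
        rw [hbp, hD]
        ring

lemma roughMaximal_morrey_weak (hn : 0 < n) (hP : HasPositiveEigenvalues P)
    (hρ : IsQuasiDistance P ρ) (hγ : 0 < P.trace) {s : ℝ≥0∞} (hss' : s.HolderConjugate 1)
    {Ω : EuclideanSpace ℝ (Fin n) → ℝ} (hΩ : IsRoughKernel P s Ω)
    {φ : EuclideanSpace ℝ (Fin n) → ℝ → ℝ} (hφ : ∀ x r, 0 < r → 0 < φ x r) {C : ℝ≥0}
    (hC : EssInfCondition P.trace φ C) :
    ∃ D : ℝ≥0, ∀ f : EuclideanSpace ℝ (Fin n) → 𝕜, AEStronglyMeasurable f volume →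
      morreyNorm ρ 1 (fun x r => φ x r ^ (1 / (1 : ℝ))) f < ∞ → ∀ x₀ (r : ℝ), 0 < r →
      ∀ l : ℝ≥0∞, l ≠ 0 → l ≠ ∞ →
      l * volume {x ∈ ellipsoid ρ x₀ r | l < roughMaximal ρ Ω f x} ≤
        D * (volume (ellipsoid ρ x₀ r) * (ENNReal.ofReal (φ x₀ r) *
          morreyNorm ρ 1 (fun x r => φ x r ^ (1 / (1 : ℝ))) f)) := by
  obtain ⟨K, hK0, hK⟩ := hρ.mean_kernel_le (𝕜 := 𝕜) hn hP hγ hss' hΩ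
  obtain ⟨A, hA⟩ := hρ.maximal_weak_type hn hP hγ
  obtain ⟨k, hk1, B, hB⟩ := hρ.roughMaximal_le_add (𝕜 := 𝕜) hn hP one_pos hφ hC (s' := 1) (by simp)
  set D : ℝ≥0∞ := 2 * K * (A * (ENNReal.ofReal (k ^ P.trace) * C)) + 2 * (K * B) with hD
  have hDt : D ≠ ∞ := by finiteness
  refine ⟨D.toNNReal, fun f hfm hf x₀ r hr l hl0 hlt => ?_⟩
  rw [ENNReal.coe_toNNReal hDt]
  set N := morreyNorm ρ 1 (fun x r => φ x r ^ (1 / (1 : ℝ))) f with hN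
  set E := ellipsoid ρ x₀ r with hE
  set f₁ := (ellipsoid ρ x₀ (k * r)).indicator f with hf₁
  have hf₁m : AEStronglyMeasurable f₁ volume := hfm.indicator (hρ.measurableSet_ellipsoid _ _)
  set b : ℝ≥0∞ := K * (B * (ENNReal.ofReal (φ x₀ r) * N)) with hb
  have hK0' : (K : ℝ≥0∞) ≠ 0 := by exact_mod_cast hK0
  have h2K0 : (2 * K : ℝ≥0∞) ≠ 0 := mul_ne_zero two_ne_zero hK0'
  have h2Kt : (2 * K : ℝ≥0∞) ≠ ∞ := by finiteness
  have hpt : ∀ x ∈ E, roughMaximal ρ Ω f x ≤ K * maximal ρ (fun y => ‖f₁ y‖ₑ) x + b := by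
    intro x hx
    have h1 := hB Ω K f hfm hf (hK f hfm) x₀ r hr x hx
    have h2 := roughMaximal_le_maximal one_ne_zero ENNReal.one_ne_top (hK f₁ hf₁m) x
    simp only [ENNReal.toReal_one, ENNReal.rpow_one, div_one] at h1 h2
    refine h1.trans (add_le_add h2 ?_)
    simp only [hb, hN, div_one, le_refl]
  -- At this level `K` times the maximal function reaches `l / 2`, leaving the other half of `l` to
  -- the constant `b`.
  set m : ℝ≥0∞ := l / (2 * K) with hm
  have hm0 : m ≠ 0 := ENNReal.div_ne_zero.2 ⟨hl0, h2Kt⟩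
  have hmt : m ≠ ∞ := ENNReal.div_ne_top hlt h2K0
  have hlm : 2 * K * m = l := ENNReal.mul_div_cancel h2K0 h2Kt
  have hweak : m * volume {x | m < maximal ρ (fun y => ‖f₁ y‖ₑ) x} ≤
      A * (ENNReal.ofReal (k ^ P.trace) * C * (volume E * (ENNReal.ofReal (φ x₀ r) * N))) := by
    refine (hA _ m hm0 hmt).trans ?_
    gcongr
    have := hρ.lintegral_enlarged_le hn hP one_pos hφ hC hk1 hf x₀ hr
    simpa only [ENNReal.rpow_one] using this
  -- The constant contributes all of `E` or nothing, and all of it only when `l < 2 b`.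
  have hbE : l * volume {x ∈ E | l / 2 < b} ≤ 2 * b * volume E := by
    by_cases h : l / 2 < b
    · have h3 : l ≤ 2 * b := by
        rw [ENNReal.div_lt_iff (Or.inl two_ne_zero) (Or.inl ENNReal.ofNat_ne_top)] at h
        rw [mul_comm]; exact h.le
      gcongr
      exact fun x hx => hx.1
    · simp [h]
  have hsub : {x ∈ E | l < roughMaximal ρ Ω f x} ⊆
      {x | m < maximal ρ (fun y => ‖f₁ y‖ₑ) x} ∪ {x ∈ E | l / 2 < b} := by
    rintro x ⟨hxE, hx⟩
    by_contra hcon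
    simp only [mem_union, mem_ofPred_eq, not_or, not_and, not_lt] at hcon
    have h3 : K * maximal ρ (fun y => ‖f₁ y‖ₑ) x ≤ l / 2 := by
      calc _ ≤ K * m := by gcongr; exact hcon.1
        _ = l / 2 := by
          rw [← hlm, mul_assoc, mul_comm 2, ENNReal.mul_div_cancel_right two_ne_zero
            ENNReal.ofNat_ne_top]
    have h4 := (hpt x hxE).trans (add_le_add h3 (hcon.2 hxE))
    rw [ENNReal.add_halves] at h4
    exact absurd hx (not_lt.2 h4)
  calc l * volume {x ∈ E | l < roughMaximal ρ Ω f x}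
      ≤ l * (volume {x | m < maximal ρ (fun y => ‖f₁ y‖ₑ) x} + volume {x ∈ E | l / 2 < b}) := by
        gcongr
        exact (measure_mono hsub).trans (measure_union_le _ _)
    _ = 2 * K * (m * volume {x | m < maximal ρ (fun y => ‖f₁ y‖ₑ) x}) +
        l * volume {x ∈ E | l / 2 < b} := by
        rw [mul_add, ← mul_assoc (2 * K : ℝ≥0∞), hlm]
    _ ≤ 2 * K * (A * (ENNReal.ofReal (k ^ P.trace) * C * (volume E *
        (ENNReal.ofReal (φ x₀ r) * N)))) + 2 * b * volume E := by gcongr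
    _ = _ := by
        rw [hb, hD]
        ring

end IsQuasiDistance

/-! ### The potential away from the centre. -/

lemma inv_rpow_le_lintegral {β r a : ℝ} (hβ : 0 < β) (hr : 0 < r) (hra : r ≤ a) :
    (ENNReal.ofReal (a ^ β))⁻¹ ≤ ENNReal.ofReal β * ∫⁻ t in Ioi r,
      {t : ℝ | a < t}.indicator (fun t => ENNReal.ofReal (t ^ (-β - 1))) t := by
  have ha : 0 < a := hr.trans_le hra
  rw [lintegral_indicator (measurableSet_lt measurable_const measurable_id'),
    Measure.restrict_restrict (measurableSet_lt measurable_const measurable_id')]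
  have h1 : {t : ℝ | a < t} ∩ Ioi r = Ioi a := by
    ext t
    simp only [mem_inter_iff, mem_ofPred_eq, mem_Ioi]
    exact ⟨fun h => h.1, fun h => ⟨h, hra.trans_lt h⟩⟩
  rw [h1, ← ofReal_integral_eq_lintegral_ofReal
    (integrableOn_Ioi_rpow_of_lt (by linarith) ha) ?_, integral_Ioi_rpow_of_lt (by linarith) ha,
    ← ENNReal.ofReal_mul hβ.le, ← ENNReal.ofReal_inv_of_pos (Real.rpow_pos_of_pos ha _)]
  · refine ENNReal.ofReal_le_ofReal (le_of_eq ?_)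
    rw [sub_add_cancel, Real.rpow_neg ha.le]
    field_simp
  · filter_upwards [ae_restrict_mem measurableSet_Ioi] with t ht
    exact Real.rpow_nonneg (ha.trans ht).le _

namespace IsQuasiDistance

variable {P : Matrix (Fin n) (Fin n) ℝ} {ρ : EuclideanSpace ℝ (Fin n) → ℝ}
variable {𝕜 : Type*} [RCLike 𝕜]

/-- Insert `inv_rpow_le_lintegral` at `a = ρ (x - y) ≥ r` and exchange the integrals; the condition
`ρ (x - y) < t` becomes integration over `E(x, t)`. -/
lemma potential_tail_le (hρ : IsQuasiDistance P ρ) {β : ℝ} (hβ : 0 < β)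
    {w : EuclideanSpace ℝ (Fin n) → ℝ≥0∞} (hw : AEMeasurable w)
    (x : EuclideanSpace ℝ (Fin n)) {r : ℝ} (hr : 0 < r) :
    ∫⁻ y in (ellipsoid ρ x r)ᶜ, w y * (ENNReal.ofReal (ρ (x - y) ^ β))⁻¹ ≤
      ENNReal.ofReal β * ∫⁻ t in Ioi r, ENNReal.ofReal (t ^ (-β - 1)) *
        ∫⁻ y in ellipsoid ρ x t, w y := by
  have hset : MeasurableSet {z : EuclideanSpace ℝ (Fin n) × ℝ | ρ (x - z.1) < z.2} :=
    measurableSet_lt (hρ.measurable.comp (measurable_const.sub measurable_fst)) measurable_snd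
  have hind : Measurable (fun z : EuclideanSpace ℝ (Fin n) × ℝ =>
      {z : EuclideanSpace ℝ (Fin n) × ℝ | ρ (x - z.1) < z.2}.indicator
        (fun z => ENNReal.ofReal (z.2 ^ (-β - 1))) z) :=
    (ENNReal.measurable_ofReal.comp (measurable_snd.pow_const _)).indicator hset
  have hpair : ∀ y t, {z : EuclideanSpace ℝ (Fin n) × ℝ | ρ (x - z.1) < z.2}.indicator
      (fun z => ENNReal.ofReal (z.2 ^ (-β - 1))) (y, t) =
      {t : ℝ | ρ (x - y) < t}.indicator (fun t => ENNReal.ofReal (t ^ (-β - 1))) t := by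
    intro y t
    by_cases h : ρ (x - y) < t <;> simp [h]
  have hwr : AEMeasurable w (volume.restrict (ellipsoid ρ x r)ᶜ) := hw.restrict
  have hjoint : AEMeasurable (fun z : EuclideanSpace ℝ (Fin n) × ℝ => w z.1 *
      {z : EuclideanSpace ℝ (Fin n) × ℝ | ρ (x - z.1) < z.2}.indicator
        (fun z => ENNReal.ofReal (z.2 ^ (-β - 1))) z)
      ((volume.restrict (ellipsoid ρ x r)ᶜ).prod (volume.restrict (Ioi r))) :=
    hwr.comp_fst.mul hind.aemeasurable
  calc ∫⁻ y in (ellipsoid ρ x r)ᶜ, w y * (ENNReal.ofReal (ρ (x - y) ^ β))⁻¹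
      ≤ ∫⁻ y in (ellipsoid ρ x r)ᶜ, ENNReal.ofReal β * (∫⁻ t in Ioi r, w y *
        {z : EuclideanSpace ℝ (Fin n) × ℝ | ρ (x - z.1) < z.2}.indicator
          (fun z => ENNReal.ofReal (z.2 ^ (-β - 1))) (y, t)) := by
        refine setLIntegral_mono' (hρ.measurableSet_ellipsoid x r).compl fun y hy => ?_
        simp_rw [hpair]
        rw [lintegral_const_mul _ (Measurable.indicator (by fun_prop)
          (measurableSet_lt measurable_const measurable_id')), mul_left_comm]
        gcongr
        refine inv_rpow_le_lintegral hβ hr ?_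
        simpa [ellipsoid] using hy
    _ = ENNReal.ofReal β * ∫⁻ t in Ioi r, (∫⁻ y in (ellipsoid ρ x r)ᶜ, w y *
        {z : EuclideanSpace ℝ (Fin n) × ℝ | ρ (x - z.1) < z.2}.indicator
          (fun z => ENNReal.ofReal (z.2 ^ (-β - 1))) (y, t)) := by
        rw [lintegral_const_mul' _ _ ENNReal.ofReal_ne_top, lintegral_lintegral_swap hjoint]
    _ ≤ _ := by
        refine mul_le_mul_right (lintegral_mono fun t => ?_) _
        rw [← lintegral_const_mul' _ _ ENNReal.ofReal_ne_top,
          ← lintegral_indicator (hρ.measurableSet_ellipsoid x t)]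
        refine (lintegral_mono' Measure.restrict_le_self le_rfl).trans
          (lintegral_mono fun y => ?_)
        by_cases h : ρ (x - y) < t
        · have h' : y ∈ ellipsoid ρ x t := h
          simp [h, h', mul_comm]
        · simp [h]

/-- Since `|E(x, t)|` is proportional to `t ^ γ`, the kernel `t ^ (-(γ - α) - 1)` turns into `t ^ (α
- 1)`, which is the weight of the integral condition. -/
lemma roughPotential_tail_le (hn : 0 < n) (hP : HasPositiveEigenvalues P)
    (hρ : IsQuasiDistance P ρ) {α : ℝ} (hα : α < P.trace) {p : ℝ} (hp : 0 < p) {s' : ℝ≥0∞}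
    (hsp : s' ≤ ENNReal.ofReal p)
    {φ : EuclideanSpace ℝ (Fin n) → ℝ → ℝ} (hφ : ∀ x r, 0 < r → 0 < φ x r)
    {Ω : EuclideanSpace ℝ (Fin n) → ℝ} (hΩ : Measurable Ω) {K : ℝ≥0}
    {f : EuclideanSpace ℝ (Fin n) → 𝕜} (hfm : AEStronglyMeasurable f volume)
    (hf : morreyNorm ρ p (fun x r => φ x r ^ (1 / p)) f < ∞)
    (hK : ∀ x (t : ℝ), 0 < t → (volume (ellipsoid ρ x t))⁻¹ *
        ∫⁻ y in ellipsoid ρ x t, ‖Ω (x - y)‖ₑ * ‖f y‖ₑ ≤ K * eLpNorm f s' (ellipsoidMean ρ x t))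
    (x : EuclideanSpace ℝ (Fin n)) {r : ℝ} (hr : 0 < r) :
    ∫⁻ y in (ellipsoid ρ x r)ᶜ,
        ‖Ω (x - y)‖ₑ / ENNReal.ofReal (ρ (x - y) ^ (P.trace - α)) * ‖f y‖ₑ ≤
      ENNReal.ofReal (P.trace - α) * (volume {x | ρ x < 1} * (K *
        (morreyNorm ρ p (fun x r => φ x r ^ (1 / p)) f *
          ∫⁻ t in Ioi r, ENNReal.ofReal (t ^ α * φ x t ^ (1 / p) / t)))) := by
  set N := morreyNorm ρ p (fun x r => φ x r ^ (1 / p)) f with hN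
  have hw : AEMeasurable (fun y => ‖Ω (x - y)‖ₑ * ‖f y‖ₑ) :=
    (hΩ.comp (measurable_const.sub measurable_id)).enorm.aemeasurable.mul hfm.enorm
  have h1 := hρ.potential_tail_le (sub_pos.2 hα) hw x hr
  have h2 : ∀ y, ‖Ω (x - y)‖ₑ / ENNReal.ofReal (ρ (x - y) ^ (P.trace - α)) * ‖f y‖ₑ =
      ‖Ω (x - y)‖ₑ * ‖f y‖ₑ * (ENNReal.ofReal (ρ (x - y) ^ (P.trace - α)))⁻¹ := by
    intro y
    rw [div_eq_mul_inv]
    ring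
  simp_rw [h2]
  refine h1.trans ?_
  gcongr
  have hVt := hρ.volume_lt_one_ne_top hn hP
  rw [← lintegral_const_mul' _ _ hf.ne, ← lintegral_const_mul' _ _ ENNReal.coe_ne_top,
    ← lintegral_const_mul' _ _ hVt]
  refine setLIntegral_mono' measurableSet_Ioi fun t ht => ?_
  have ht0 : 0 < t := hr.trans ht
  have := hρ.isProbabilityMeasure_ellipsoidMean hn hP x ht0
  have h3 : ∫⁻ y in ellipsoid ρ x t, ‖Ω (x - y)‖ₑ * ‖f y‖ₑ ≤
      volume (ellipsoid ρ x t) * (K * (ENNReal.ofReal (φ x t ^ (1 / p)) * N)) := by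
    rw [← ENNReal.inv_mul_le_iff (hρ.volume_ellipsoid_ne_zero x ht0)
      (hρ.volume_ellipsoid_ne_top hn hP x ht0)]
    refine (hK x t ht0).trans ?_
    gcongr
    refine (eLpNorm_le_eLpNorm_of_exponent_le hsp
      (hfm.mono_ac (ellipsoidMean_absolutelyContinuous ρ x t))).trans ?_
    exact eLpNorm_mean_le_morreyNorm hp (ψ := fun x r => φ x r ^ (1 / p))
      (fun x r hr => Real.rpow_pos_of_pos (hφ x r hr) _) f x ht0
  refine (mul_le_mul_right h3 _).trans (le_of_eq ?_)
  rw [hρ.volume_ellipsoid x ht0]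
  have h4 : ENNReal.ofReal (t ^ α * φ x t ^ (1 / p) / t) =
      ENNReal.ofReal (t ^ (-(P.trace - α) - 1)) * ENNReal.ofReal (t ^ P.trace) *
        ENNReal.ofReal (φ x t ^ (1 / p)) := by
    rw [← ENNReal.ofReal_mul (Real.rpow_nonneg ht0.le _), ← Real.rpow_add ht0,
      ← ENNReal.ofReal_mul (Real.rpow_nonneg ht0.le _)]
    congr 1
    rw [show -(P.trace - α) - 1 + P.trace = α - 1 by ring, Real.rpow_sub_one ht0.ne']
    ring
  rw [h4]
  ring

end IsQuasiDistance

lemma morreyNorm_indicator_le {𝕜 : Type*} [RCLike 𝕜] (ρ : EuclideanSpace ℝ (Fin n) → ℝ) (p : ℝ)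
    (ψ : EuclideanSpace ℝ (Fin n) → ℝ → ℝ) (f : EuclideanSpace ℝ (Fin n) → 𝕜)
    (S : Set (EuclideanSpace ℝ (Fin n))) :
    morreyNorm ρ p ψ (S.indicator f) ≤ morreyNorm ρ p ψ f := by
  refine iSup_mono fun x => iSup₂_mono fun r _ => ?_
  gcongr
  exact eLpNorm_indicator_le f

lemma MemMorrey.indicator {𝕜 : Type*} [RCLike 𝕜] {ρ : EuclideanSpace ℝ (Fin n) → ℝ} {p : ℝ}
    {ψ : EuclideanSpace ℝ (Fin n) → ℝ → ℝ} {f : EuclideanSpace ℝ (Fin n) → 𝕜}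
    (hf : MemMorrey ρ p ψ f) {S : Set (EuclideanSpace ℝ (Fin n))} (hS : MeasurableSet S) :
    MemMorrey ρ p ψ (S.indicator f) where
  aestronglyMeasurable := hf.aestronglyMeasurable.indicator hS
  memLp_compact K hK := (hf.memLp_compact K hK).indicator hS
  norm_lt_top := (morreyNorm_indicator_le ρ p ψ f S).trans_lt hf.norm_lt_top

/-- Optimization in `r` of `r ^ α M + r ^ (-δ) N`. -/
lemma le_of_forall_rpow_add {α δ : ℝ} (hα : 0 < α) (hδ : 0 < δ) {a M N C : ℝ≥0∞}
    (hN : N ≠ ∞) (hC : C ≠ ∞) (hNM : N = 0 → M = 0)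
    (h : ∀ r : ℝ, 0 < r → a ≤ C * (ENNReal.ofReal (r ^ α) * M + ENNReal.ofReal (r ^ (-δ)) * N)) :
    a ≤ C * 2 * (N ^ (α / (α + δ)) * M ^ (δ / (α + δ))) := by
  have hs : 0 < α + δ := by positivity
  have hθ : 0 < α / (α + δ) := by positivity
  have hη : 0 < δ / (α + δ) := by positivity
  -- For `N = 0` and `M = ∞` the right side would be `0 * ∞ = 0` while the hypothesis bounds
  -- nothing; `hNM` excludes this.
  by_cases hN0 : N = 0
  · have h1 := h 1 one_pos
    rw [hNM hN0, hN0] at h1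
    simp only [mul_zero, add_zero] at h1
    exact h1.trans bot_le
  by_cases hC0 : C = 0
  · have h1 := h 1 one_pos
    rw [hC0, zero_mul] at h1
    exact h1.trans bot_le
  by_cases hMt : M = ∞
  · rw [hMt, ENNReal.top_rpow_of_pos hη, ENNReal.mul_top
      (by simp [ENNReal.rpow_eq_zero_iff, hN0, hN]), ENNReal.mul_top (mul_ne_zero hC0 two_ne_zero)]
    exact le_top
  by_cases hM0 : M = 0
  -- For `M = 0` there is no optimal radius; let `r → ∞`.
  · have hlim : Tendsto (fun r : ℝ => C * (ENNReal.ofReal (r ^ (-δ)) * N)) atTop (𝓝 0) := by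
      have h1 : Tendsto (fun r : ℝ => ENNReal.ofReal (r ^ (-δ))) atTop (𝓝 0) := by
        have := ENNReal.tendsto_ofReal (tendsto_rpow_neg_atTop hδ)
        simpa using this
      have h2 := ENNReal.Tendsto.mul_const h1 (b := N) (Or.inr hN)
      rw [zero_mul] at h2
      have h3 := ENNReal.Tendsto.const_mul h2 (a := C) (Or.inr hC)
      rwa [mul_zero] at h3
    have h4 : a ≤ 0 := by
      refine ge_of_tendsto hlim ?_
      filter_upwards [eventually_gt_atTop 0] with r hr
      have := h r hr
      rwa [hM0, mul_zero, zero_add] at this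
    exact h4.trans bot_le
  lift N to ℝ≥0 using hN
  lift M to ℝ≥0 using hMt
  have hNpos : (0 : ℝ) < N := by
    have : N ≠ 0 := by exact_mod_cast hN0
    exact_mod_cast pos_iff_ne_zero.2 this
  have hMpos : (0 : ℝ) < M := by
    have : M ≠ 0 := by exact_mod_cast hM0
    exact_mod_cast pos_iff_ne_zero.2 this
  -- This radius makes the two terms equal, whence the factor `2`.
  set r : ℝ := ((N : ℝ) / M) ^ (α + δ)⁻¹ with hr
  have hr0 : 0 < r := Real.rpow_pos_of_pos (div_pos hNpos hMpos) _
  have e1 : r ^ α * M = (N : ℝ) ^ (α / (α + δ)) * (M : ℝ) ^ (δ / (α + δ)) := by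
    rw [hr, ← Real.rpow_mul (div_pos hNpos hMpos).le, Real.div_rpow hNpos.le hMpos.le,
      show (α + δ)⁻¹ * α = α / (α + δ) by ring,
      show δ / (α + δ) = 1 - α / (α + δ) by field_simp; ring, Real.rpow_sub hMpos, Real.rpow_one]
    ring
  have e2 : r ^ (-δ) * N = (N : ℝ) ^ (α / (α + δ)) * (M : ℝ) ^ (δ / (α + δ)) := by
    rw [hr, ← Real.rpow_mul (div_pos hNpos hMpos).le, Real.div_rpow hNpos.le hMpos.le,
      show (α + δ)⁻¹ * -δ = -(δ / (α + δ)) by ring, Real.rpow_neg hNpos.le, Real.rpow_neg hMpos.le,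
      show α / (α + δ) = 1 - δ / (α + δ) by field_simp; ring, Real.rpow_sub hNpos, Real.rpow_one]
    field_simp
  refine (h r hr0).trans (le_of_eq ?_)
  rw [← ENNReal.ofReal_coe_nnreal (p := M), ← ENNReal.ofReal_coe_nnreal (p := N),
    ← ENNReal.ofReal_mul (Real.rpow_nonneg hr0.le _), ← ENNReal.ofReal_mul
    (Real.rpow_nonneg hr0.le _), e1, e2, ENNReal.ofReal_rpow_of_pos hNpos,
    ENNReal.ofReal_rpow_of_pos hMpos, ← ENNReal.ofReal_mul (Real.rpow_nonneg hNpos.le _)]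
  ring

lemma MemMorrey.of_morreyNorm_lt_top {𝕜 : Type*} [RCLike 𝕜] (hn : 0 < n)
    {P : Matrix (Fin n) (Fin n) ℝ} (hP : HasPositiveEigenvalues P)
    {ρ : EuclideanSpace ℝ (Fin n) → ℝ} (hρ : IsQuasiDistance P ρ) {p : ℝ} (hp : 0 < p)
    {ψ : EuclideanSpace ℝ (Fin n) → ℝ → ℝ} (hψ : ∀ x r, 0 < r → 0 < ψ x r)
    {f : EuclideanSpace ℝ (Fin n) → 𝕜} (hfm : AEStronglyMeasurable f volume)
    (hf : morreyNorm ρ p ψ f < ∞) : MemMorrey ρ p ψ f where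
  aestronglyMeasurable := hfm
  memLp_compact K hK := by
    obtain ⟨r, hr, hKr⟩ := hρ.compact_subset_ellipsoid hK
    refine MemLp.mono_measure (Measure.restrict_mono hKr le_rfl) ⟨hfm.restrict, ?_⟩
    have h := IsQuasiDistance.eLpNorm_mean_le_morreyNorm (ρ := ρ) hp hψ f 0 hr
    rw [eLpNorm_ellipsoidMean ρ 0 r hp] at h
    have h2 := h.trans_lt (ENNReal.mul_lt_top ENNReal.ofReal_lt_top hf)
    have h0 : volume (ellipsoid ρ 0 r) ^ (-(1 / p)) ≠ 0 := by
      rw [ENNReal.rpow_neg]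
      exact ENNReal.inv_ne_zero.2 (ENNReal.rpow_ne_top_of_nonneg (by positivity)
        (hρ.volume_ellipsoid_ne_top hn hP 0 hr))
    by_contra hcon
    rw [not_lt, top_le_iff] at hcon
    rw [hcon, ENNReal.mul_top h0] at h2
    exact lt_irrefl _ h2
  norm_lt_top := hf

lemma weakLpNorm_mono_set {𝕜 : Type*} [RCLike 𝕜] {p : ℝ} (hp : 0 < p)
    (f : EuclideanSpace ℝ (Fin n) → 𝕜) {A B : Set (EuclideanSpace ℝ (Fin n))} (h : A ⊆ B) :
    weakLpNorm p f A ≤ weakLpNorm p f B := by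
  refine iSup₂_mono fun l _ => ?_
  gcongr

lemma MemWeakMorrey.of_weakMorreyNorm_lt_top {𝕜 : Type*} [RCLike 𝕜] (hn : 0 < n)
    {P : Matrix (Fin n) (Fin n) ℝ} (hP : HasPositiveEigenvalues P)
    {ρ : EuclideanSpace ℝ (Fin n) → ℝ} (hρ : IsQuasiDistance P ρ) {p : ℝ} (hp : 0 < p)
    {ψ : EuclideanSpace ℝ (Fin n) → ℝ → ℝ}
    {f : EuclideanSpace ℝ (Fin n) → 𝕜} (hfm : AEStronglyMeasurable f volume)
    (hf : weakMorreyNorm ρ p ψ f < ∞) : MemWeakMorrey ρ p ψ f where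
  aestronglyMeasurable := hfm
  weakLp_compact K hK := by
    obtain ⟨r, hr, hKr⟩ := hρ.compact_subset_ellipsoid hK
    refine (weakLpNorm_mono_set hp f hKr).trans_lt ?_
    have h : (ENNReal.ofReal (ψ 0 r))⁻¹ * volume (ellipsoid ρ 0 r) ^ (-(1 / p)) *
        weakLpNorm p f (ellipsoid ρ 0 r) ≤ weakMorreyNorm ρ p ψ f :=
      le_iSup_of_le (f := fun x => ⨆ r ∈ Ioi (0 : ℝ), (ENNReal.ofReal (ψ x r))⁻¹ *
        volume (ellipsoid ρ x r) ^ (-(1 / p)) * weakLpNorm p f (ellipsoid ρ x r)) 0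
        (le_iSup₂_of_le (f := fun r (_ : r ∈ Ioi (0 : ℝ)) => (ENNReal.ofReal (ψ 0 r))⁻¹ *
        volume (ellipsoid ρ 0 r) ^ (-(1 / p)) * weakLpNorm p f (ellipsoid ρ 0 r)) r hr le_rfl)
    have h2 := h.trans_lt hf
    have h0 : (ENNReal.ofReal (ψ 0 r))⁻¹ * volume (ellipsoid ρ 0 r) ^ (-(1 / p)) ≠ 0 := by
      rw [ENNReal.rpow_neg]
      exact mul_ne_zero (ENNReal.inv_ne_zero.2 ENNReal.ofReal_ne_top)
        (ENNReal.inv_ne_zero.2 (ENNReal.rpow_ne_top_of_nonneg (by positivity)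
        (hρ.volume_ellipsoid_ne_top hn hP 0 hr)))
    by_contra hcon
    rw [not_lt, top_le_iff] at hcon
    rw [hcon, ENNReal.mul_top h0] at h2
    exact lt_irrefl _ h2
  norm_lt_top := hf

/-- Supplies the hypothesis `hNM` of `le_of_forall_rpow_add`. -/
lemma roughMaximal_eq_zero {𝕜 : Type*} [RCLike 𝕜] (hn : 0 < n)
    {P : Matrix (Fin n) (Fin n) ℝ} (hP : HasPositiveEigenvalues P)
    {ρ : EuclideanSpace ℝ (Fin n) → ℝ} (hρ : IsQuasiDistance P ρ) {p : ℝ} (hp : 0 < p)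
    {ψ : EuclideanSpace ℝ (Fin n) → ℝ → ℝ} (hψ : ∀ x r, 0 < r → 0 < ψ x r)
    {s' : ℝ≥0∞} (hsp : s' ≤ ENNReal.ofReal p) {Ω : EuclideanSpace ℝ (Fin n) → ℝ} {K : ℝ≥0}
    {f : EuclideanSpace ℝ (Fin n) → 𝕜} (hfm : AEStronglyMeasurable f volume)
    (hK : ∀ x (t : ℝ), 0 < t → (volume (ellipsoid ρ x t))⁻¹ *
        ∫⁻ y in ellipsoid ρ x t, ‖Ω (x - y)‖ₑ * ‖f y‖ₑ ≤ K * eLpNorm f s' (ellipsoidMean ρ x t))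
    (hf : morreyNorm ρ p ψ f = 0) (x : EuclideanSpace ℝ (Fin n)) : roughMaximal ρ Ω f x = 0 := by
  refine le_antisymm (iSup₂_le fun t (ht : 0 < t) => (hK x t ht).trans ?_) bot_le
  have := hρ.isProbabilityMeasure_ellipsoidMean hn hP x ht
  have h1 := (eLpNorm_le_eLpNorm_of_exponent_le hsp
      (hfm.mono_ac (ellipsoidMean_absolutelyContinuous ρ x t))).trans
    (IsQuasiDistance.eLpNorm_mean_le_morreyNorm (ρ := ρ) hp hψ f x ht)
  rw [hf, mul_zero] at h1
  rw [le_antisymm h1 bot_le, mul_zero]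

/-! ### The pointwise estimate of Hedberg type. -/

section Pointwise

variable {𝕜 : Type*} [RCLike 𝕜] {P : Matrix (Fin n) (Fin n) ℝ}
  {ρ Ω : EuclideanSpace ℝ (Fin n) → ℝ} {p α : ℝ} {φ : EuclideanSpace ℝ (Fin n) → ℝ → ℝ}
  {T : (EuclideanSpace ℝ (Fin n) → 𝕜) → (EuclideanSpace ℝ (Fin n) → 𝕜)}

/-- The hypotheses on `T` hold off null sets depending on the ellipsoid. A countable family of
centres and radii serves all `x` and `r`, so one null set suffices. -/
lemma exists_center_radius (hρ : IsQuasiDistance P ρ) (x : EuclideanSpace ℝ (Fin n)) {r : ℝ}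
    (hr : 0 < r) : ∃ (i : ℕ) (q : ℚ), r < (q : ℝ) ∧ (q : ℝ) < 2 * r ∧
      x ∈ ellipsoid ρ (TopologicalSpace.denseSeq (EuclideanSpace ℝ (Fin n)) i) q := by
  obtain ⟨q, hq1, hq2⟩ := exists_rat_btwn (show r < 2 * r by linarith)
  have hU := hρ.lt_sub_mem_nhds x (hr.trans hq1)
  obtain ⟨i, hi⟩ :=
    (TopologicalSpace.denseRange_denseSeq (EuclideanSpace ℝ (Fin n))).mem_nhds hU
  refine ⟨i, q, hq1, hq2, ?_⟩
  rw [ellipsoid, mem_ofPred_eq, hρ.symm]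
  exact hi

lemma operator_pointwise_bound (hn : 0 < n) (hP : HasPositiveEigenvalues P)
    (hρ : IsQuasiDistance P ρ) {s s' : ℝ≥0∞} (hss' : s.HolderConjugate s')
    (hΩ : IsRoughKernel P s Ω) (hp : 0 < p) (hsp : s' ≤ ENNReal.ofReal p)
    (hα : 0 < α) (hαγ : α < P.trace) {δ : ℝ} (hδ : 0 < δ)
    (hφ : ∀ x r, 0 < r → 0 < φ x r)
    (hφ_int : ∃ C : ℝ≥0, ∀ x r, 0 < r →
      ∫⁻ t in Ioi r, ENNReal.ofReal (t ^ α * φ x t ^ (1 / p) / t)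
      ≤ C * ENNReal.ofReal (r ^ (-δ)))
    (hT : IsSublinearOn (MemMorrey ρ p (fun x r => φ x r ^ (1 / p))) T)
    (hT_size : ∃ C : ℝ≥0, ∀ f, MemMorrey ρ p (fun x r => φ x r ^ (1 / p)) f →
      ∀ᵐ x, ‖T f x‖ₑ ≤ C * roughPotential P.trace α ρ Ω f x)
    (hT_loc : ∃ C : ℝ≥0, ∀ f, MemMorrey ρ p (fun x r => φ x r ^ (1 / p)) f →
      ∀ x₀ r, 0 < r → ∀ᵐ x, x ∈ ellipsoid ρ x₀ r →
        ‖T ((ellipsoid ρ x₀ r).indicator f) x‖ₑ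
          ≤ C * ENNReal.ofReal (r ^ α) * roughMaximal ρ Ω f x) :
    ∃ D : ℝ≥0, ∀ f, MemMorrey ρ p (fun x r => φ x r ^ (1 / p)) f → ∀ᵐ x,
      ‖T f x‖ₑ ≤ D * (morreyNorm ρ p (fun x r => φ x r ^ (1 / p)) f ^ (α / (α + δ)) *
        roughMaximal ρ Ω f x ^ (δ / (α + δ))) := by
  have hγ : 0 < P.trace := hα.trans hαγ
  obtain ⟨K, -, hK⟩ := hρ.mean_kernel_le (𝕜 := 𝕜) hn hP hγ hss' hΩ
  obtain ⟨k, hk1, hk⟩ := hρ.exists_subset_ellipsoid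
  obtain ⟨C₀, hC₀⟩ := hφ_int
  obtain ⟨C₁, hC₁⟩ := hT_size
  obtain ⟨C₂, hC₂⟩ := hT_loc
  have hk0 : 0 < k := by linarith
  have hVt := hρ.volume_lt_one_ne_top hn hP
  -- The splitting ellipsoid has radius `k q < 2 k r`, whence `(2 k) ^ α`.
  set A : ℝ≥0∞ := C₂ * ENNReal.ofReal ((2 * k) ^ α) with hA
  set B : ℝ≥0∞ := C₁ * (ENNReal.ofReal (P.trace - α) * (volume {x | ρ x < 1} * (K * C₀))) with hB
  have hAB : A + B ≠ ∞ := by finiteness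
  refine ⟨((A + B) * 2).toNNReal, fun f hf => ?_⟩
  set N := morreyNorm ρ p (fun x r => φ x r ^ (1 / p)) f with hN
  set d := TopologicalSpace.denseSeq (EuclideanSpace ℝ (Fin n)) with hd
  have hS : ∀ i (q : ℚ), MeasurableSet (ellipsoid ρ (d i) (k * q)) := fun i q =>
    hρ.measurableSet_ellipsoid _ _
  have hae : ∀ᵐ x, ∀ (i : ℕ) (q : ℚ), (0 : ℝ) < q →
      ‖T f x‖ ≤ ‖T ((ellipsoid ρ (d i) (k * q)).indicator f) x‖ +
        ‖T ((ellipsoid ρ (d i) (k * q))ᶜ.indicator f) x‖ ∧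
      (x ∈ ellipsoid ρ (d i) (k * q) → ‖T ((ellipsoid ρ (d i) (k * q)).indicator f) x‖ₑ ≤
        C₂ * ENNReal.ofReal ((k * q) ^ α) * roughMaximal ρ Ω f x) ∧
      ‖T ((ellipsoid ρ (d i) (k * q))ᶜ.indicator f) x‖ₑ ≤
        C₁ * roughPotential P.trace α ρ Ω ((ellipsoid ρ (d i) (k * q))ᶜ.indicator f) x := by
    rw [ae_all_iff]; intro i
    rw [ae_all_iff]; intro q
    by_cases hq : (0 : ℝ) < q
    · have h1 := hT.add_le _ _ (hf.indicator (hS i q)) (hf.indicator (hS i q).compl)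
      rw [indicator_self_add_compl] at h1
      filter_upwards [h1, hC₂ f hf (d i) (k * q) (by positivity),
        hC₁ _ (hf.indicator (hS i q).compl)] with x h1 h2 h3 _
      exact ⟨h1, h2, h3⟩
    · exact Eventually.of_forall fun x h => absurd h hq
  filter_upwards [hae] with x hx
  rw [ENNReal.coe_toNNReal (ENNReal.mul_ne_top hAB ENNReal.ofNat_ne_top)]
  refine le_of_forall_rpow_add hα hδ hf.norm_lt_top.ne hAB
    (fun h0 => roughMaximal_eq_zero hn hP hρ hp (ψ := fun x r => φ x r ^ (1 / p))
      (fun x r hr => Real.rpow_pos_of_pos (hφ x r hr) _) hsp hf.aestronglyMeasurable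
      (hK f hf.aestronglyMeasurable) h0 x) fun r hr => ?_
  obtain ⟨i, q, hq1, hq2, hxi⟩ := exists_center_radius hρ x hr
  have hq0 : (0 : ℝ) < q := hr.trans hq1
  obtain ⟨h1, h2, h3⟩ := hx i q hq0
  have hxi' : x ∈ ellipsoid ρ (d i) (k * q) :=
    ellipsoid_mono ρ (d i) (by nlinarith) hxi
  -- The factor `k` leaves room for an ellipsoid centred at `x` itself, so the outer piece of `f`
  -- lives where the tail estimate at `x` applies.
  have hsub : ellipsoid ρ x q ⊆ ellipsoid ρ (d i) (k * q) := hk x (d i) q q le_rfl hxi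
  have hpot : roughPotential P.trace α ρ Ω ((ellipsoid ρ (d i) (k * q))ᶜ.indicator f) x ≤
      ENNReal.ofReal (P.trace - α) * (volume {x | ρ x < 1} * (K * (N *
        (C₀ * ENNReal.ofReal (r ^ (-δ)))))) := by
    calc _ ≤ ∫⁻ y in (ellipsoid ρ x q)ᶜ,
          ‖Ω (x - y)‖ₑ / ENNReal.ofReal (ρ (x - y) ^ (P.trace - α)) * ‖f y‖ₑ := by
          rw [← lintegral_indicator (hρ.measurableSet_ellipsoid x q).compl]
          refine lintegral_mono fun y => ?_
          by_cases hy : y ∈ ellipsoid ρ (d i) (k * q)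
          · simp [hy]
          · have hy' : y ∉ ellipsoid ρ x q := fun h => hy (hsub h)
            simp [hy, hy']
      _ ≤ _ := by
          refine (hρ.roughPotential_tail_le hn hP hαγ hp hsp hφ hΩ.measurable
            hf.aestronglyMeasurable hf.norm_lt_top (hK f hf.aestronglyMeasurable) x hq0).trans ?_
          gcongr
          refine (hC₀ x q hq0).trans ?_
          gcongr _ * ENNReal.ofReal ?_
          exact Real.rpow_le_rpow_of_nonpos hr hq1.le (by linarith)
  have hkq : ENNReal.ofReal ((k * q) ^ α) ≤
      ENNReal.ofReal ((2 * k) ^ α) * ENNReal.ofReal (r ^ α) := by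
    rw [← ENNReal.ofReal_mul (by positivity), ← Real.mul_rpow (by positivity) hr.le]
    exact ENNReal.ofReal_le_ofReal (Real.rpow_le_rpow (by positivity) (by nlinarith) hα.le)
  have h1' : ‖T f x‖ₑ ≤ ‖T ((ellipsoid ρ (d i) (k * q)).indicator f) x‖ₑ +
        ‖T ((ellipsoid ρ (d i) (k * q))ᶜ.indicator f) x‖ₑ := by
    rw [← ofReal_norm, ← ofReal_norm, ← ofReal_norm, ← ENNReal.ofReal_add (norm_nonneg _)
      (norm_nonneg _)]
    exact ENNReal.ofReal_le_ofReal h1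
  calc ‖T f x‖ₑ ≤ C₂ * (ENNReal.ofReal ((2 * k) ^ α) * ENNReal.ofReal (r ^ α)) *
        roughMaximal ρ Ω f x + C₁ * (ENNReal.ofReal (P.trace - α) * (volume {x | ρ x < 1} *
          (K * (N * (C₀ * ENNReal.ofReal (r ^ (-δ))))))) := by
        exact h1'.trans (add_le_add ((h2 hxi').trans (mul_le_mul_left (mul_le_mul_right hkq _) _))
          (h3.trans (mul_le_mul_right hpot _)))
    _ = A * (ENNReal.ofReal (r ^ α) * roughMaximal ρ Ω f x) +
        B * (ENNReal.ofReal (r ^ (-δ)) * N) := by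
        rw [hA, hB]; ring
    _ ≤ (A + B) * (ENNReal.ofReal (r ^ α) * roughMaximal ρ Ω f x) +
        (A + B) * (ENNReal.ofReal (r ^ (-δ)) * N) := by
        gcongr
        · exact le_self_add
        · exact le_add_self
    _ = _ := (mul_add _ _ _).symm

end Pointwise

/-! ### From the pointwise estimate to Morrey norms. -/

section Assembly

variable {𝕜 : Type*} [RCLike 𝕜] {P : Matrix (Fin n) (Fin n) ℝ}
  {ρ : EuclideanSpace ℝ (Fin n) → ℝ} {q : ℝ} {φ : EuclideanSpace ℝ (Fin n) → ℝ → ℝ}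

lemma weight_mul_cancel {v a : ℝ≥0∞} (hv0 : v ≠ 0) (hvt : v ≠ ∞) (ha0 : a ≠ 0) (hat : a ≠ ∞)
    (hq : 0 < q) (c : ℝ≥0∞) :
    (a ^ (1 / q))⁻¹ * v ^ (-(1 / q)) * ((v * a) ^ (1 / q) * c) = c := by
  have hq' : 0 ≤ 1 / q := by positivity
  have h1 : a ^ (1 / q) ≠ 0 := by simp [ENNReal.rpow_eq_zero_iff, ha0, hat]
  have h2 : a ^ (1 / q) ≠ ∞ := ENNReal.rpow_ne_top_of_nonneg hq' hat
  have h3 : v ^ (1 / q) ≠ 0 := by simp [ENNReal.rpow_eq_zero_iff, hv0, hvt]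
  have h4 : v ^ (1 / q) ≠ ∞ := ENNReal.rpow_ne_top_of_nonneg hq' hvt
  rw [ENNReal.mul_rpow_of_nonneg _ _ hq', ENNReal.rpow_neg]
  calc _ = ((a ^ (1 / q))⁻¹ * a ^ (1 / q)) * ((v ^ (1 / q))⁻¹ * v ^ (1 / q)) * c := by ring
    _ = c := by rw [ENNReal.inv_mul_cancel h1 h2, ENNReal.inv_mul_cancel h3 h4, one_mul, one_mul]

lemma morreyNorm_le_of_lintegral_le (hn : 0 < n) (hP : HasPositiveEigenvalues P)
    (hρ : IsQuasiDistance P ρ) (hq : 0 < q) (hφ : ∀ x r, 0 < r → 0 < φ x r)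
    {g : EuclideanSpace ℝ (Fin n) → 𝕜} {c : ℝ≥0∞}
    (h : ∀ x (r : ℝ), 0 < r → ∫⁻ y in ellipsoid ρ x r, ‖g y‖ₑ ^ q ≤
      volume (ellipsoid ρ x r) * ENNReal.ofReal (φ x r) * c ^ q) :
    morreyNorm ρ q (fun x r => φ x r ^ (1 / q)) g ≤ c := by
  refine iSup_le fun x => iSup₂_le fun r (hr : 0 < r) => ?_
  rw [eLpNorm_ofReal_eq _ hq, ← ENNReal.ofReal_rpow_of_pos (hφ x r hr)]
  refine (mul_le_mul_right (ENNReal.rpow_le_rpow (h x r hr) (by positivity)) _).trans_eq ?_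
  rw [ENNReal.mul_rpow_of_nonneg _ (c ^ q) (by positivity), ← ENNReal.rpow_mul, mul_one_div,
    div_self hq.ne', ENNReal.rpow_one]
  exact weight_mul_cancel (hρ.volume_ellipsoid_ne_zero x hr) (hρ.volume_ellipsoid_ne_top hn hP x hr)
    (by simpa using hφ x r hr) ENNReal.ofReal_ne_top hq c

lemma weakMorreyNorm_le_of_forall (hn : 0 < n) (hP : HasPositiveEigenvalues P)
    (hρ : IsQuasiDistance P ρ) (hq : 0 < q) (hφ : ∀ x r, 0 < r → 0 < φ x r)
    {g : EuclideanSpace ℝ (Fin n) → 𝕜} {c : ℝ≥0∞}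
    (h : ∀ x (r : ℝ), 0 < r → ∀ l : ℝ, 0 < l →
      ENNReal.ofReal l * volume {y ∈ ellipsoid ρ x r | l < ‖g y‖} ^ (1 / q) ≤
      (volume (ellipsoid ρ x r) * ENNReal.ofReal (φ x r)) ^ (1 / q) * c) :
    weakMorreyNorm ρ q (fun x r => φ x r ^ (1 / q)) g ≤ c := by
  refine iSup_le fun x => iSup₂_le fun r (hr : 0 < r) => ?_
  rw [← ENNReal.ofReal_rpow_of_pos (hφ x r hr)]
  have h1 : weakLpNorm q g (ellipsoid ρ x r) ≤
      (volume (ellipsoid ρ x r) * ENNReal.ofReal (φ x r)) ^ (1 / q) * c :=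
    iSup₂_le fun l hl => h x r hr l hl
  refine (mul_le_mul_right h1 _).trans_eq ?_
  exact weight_mul_cancel (hρ.volume_ellipsoid_ne_zero x hr) (hρ.volume_ellipsoid_ne_top hn hP x hr)
    (by simpa using hφ x r hr) ENNReal.ofReal_ne_top hq c

/-- From a pointwise Hedberg type estimate to a Morrey norm bound. -/
lemma morreyNorm_le_of_pointwise (hn : 0 < n) (hP : HasPositiveEigenvalues P)
    (hρ : IsQuasiDistance P ρ) {p : ℝ} (hp : 0 < p) (hpq : p < q)
    (hφ : ∀ x r, 0 < r → 0 < φ x r) {A B : ℝ≥0} {N : ℝ≥0∞} (hN : N ≠ ∞)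
    {g : EuclideanSpace ℝ (Fin n) → 𝕜} {M : EuclideanSpace ℝ (Fin n) → ℝ≥0∞}
    (hg : ∀ᵐ x, ‖g x‖ₑ ≤ A * (N ^ (1 - p / q) * M x ^ (p / q)))
    (hM : ∀ x (r : ℝ), 0 < r → ∫⁻ y in ellipsoid ρ x r, M y ^ p ≤
      B * (volume (ellipsoid ρ x r) * (ENNReal.ofReal (φ x r) * N ^ p))) :
    morreyNorm ρ q (fun x r => φ x r ^ (1 / q)) g ≤ A * (B : ℝ≥0∞) ^ (1 / q) * N := by
  have hq : 0 < q := hp.trans hpq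
  have hθ : 0 ≤ 1 - p / q := by rw [sub_nonneg, div_le_one hq]; exact hpq.le
  refine morreyNorm_le_of_lintegral_le hn hP hρ hq hφ fun x r hr => ?_
  have hAt : (A * N ^ (1 - p / q) : ℝ≥0∞) ^ q ≠ ∞ :=
    ENNReal.rpow_ne_top_of_nonneg hq.le
      (ENNReal.mul_ne_top ENNReal.coe_ne_top (ENNReal.rpow_ne_top_of_nonneg hθ hN))
  calc ∫⁻ y in ellipsoid ρ x r, ‖g y‖ₑ ^ q
      ≤ ∫⁻ y in ellipsoid ρ x r, (A * N ^ (1 - p / q) : ℝ≥0∞) ^ q * M y ^ p := by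
        refine lintegral_mono_ae (ae_restrict_of_ae ?_)
        filter_upwards [hg] with y hy
        refine (ENNReal.rpow_le_rpow hy hq.le).trans_eq ?_
        rw [← mul_assoc, ENNReal.mul_rpow_of_nonneg _ _ hq.le, ← ENNReal.rpow_mul (M y),
          div_mul_cancel₀ _ hq.ne']
    _ ≤ (A * N ^ (1 - p / q) : ℝ≥0∞) ^ q *
        (B * (volume (ellipsoid ρ x r) * (ENNReal.ofReal (φ x r) * N ^ p))) := by
        rw [lintegral_const_mul' _ _ hAt]
        gcongr
        exact hM x r hr
    _ = _ := by
        rw [ENNReal.mul_rpow_of_nonneg _ _ hq.le, ENNReal.mul_rpow_of_nonneg _ _ hq.le,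
          ENNReal.mul_rpow_of_nonneg _ _ hq.le, ← ENNReal.rpow_mul, ← ENNReal.rpow_mul,
          one_div_mul_cancel hq.ne', ENNReal.rpow_one]
        -- The Hedberg factor contributes `N ^ (q - p)` and the maximal bound `N ^ p`.
        have h1 : N ^ ((1 - p / q) * q) * N ^ p = N ^ q := by
          rw [← ENNReal.rpow_add_of_nonneg _ _ (by positivity) hp.le, sub_mul, one_mul,
            div_mul_cancel₀ _ hq.ne', sub_add_cancel]
        rw [← h1]
        ring

/-- From a pointwise Hedberg type estimate to a weak Morrey norm bound. -/
lemma weakMorreyNorm_le_of_pointwise (hn : 0 < n) (hP : HasPositiveEigenvalues P)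
    (hρ : IsQuasiDistance P ρ) (hq : 1 < q)
    (hφ : ∀ x r, 0 < r → 0 < φ x r) {A B : ℝ≥0} {N : ℝ≥0∞} (hN : N ≠ ∞)
    {g : EuclideanSpace ℝ (Fin n) → 𝕜} {M : EuclideanSpace ℝ (Fin n) → ℝ≥0∞}
    (hg : ∀ᵐ x, ‖g x‖ₑ ≤ A * (N ^ (1 - 1 / q) * M x ^ (1 / q)))
    (hM : ∀ x (r : ℝ), 0 < r → ∀ l : ℝ≥0∞, l ≠ 0 → l ≠ ∞ →
      l * volume {y ∈ ellipsoid ρ x r | l < M y} ≤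
      B * (volume (ellipsoid ρ x r) * (ENNReal.ofReal (φ x r) * N))) :
    weakMorreyNorm ρ q (fun x r => φ x r ^ (1 / q)) g ≤ A * (B : ℝ≥0∞) ^ (1 / q) * N := by
  have hq0 : 0 < q := by linarith
  have hq' : 0 ≤ 1 / q := by positivity
  have hθ : 0 < 1 - 1 / q := by rw [sub_pos, div_lt_one hq0]; exact hq
  refine weakMorreyNorm_le_of_forall hn hP hρ hq0 hφ fun x r hr l hl => ?_
  set a : ℝ≥0∞ := A * N ^ (1 - 1 / q) with ha
  have hat : a ≠ ∞ := ENNReal.mul_ne_top ENNReal.coe_ne_top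
    (ENNReal.rpow_ne_top_of_nonneg hθ.le hN)
  have hlt : ∀ y, l < ‖g y‖ → ENNReal.ofReal l < ‖g y‖ₑ := fun y hy => by
    rw [← ofReal_norm]
    exact (ENNReal.ofReal_lt_ofReal_iff (hl.trans hy)).2 hy
  -- If `a = 0` then `g` vanishes almost everywhere; otherwise division by `a` is possible.
  by_cases ha0 : a = 0
  · have h0 : volume {y ∈ ellipsoid ρ x r | l < ‖g y‖} = 0 := by
      refine measure_mono_null (t := {y | ¬ ‖g y‖ₑ ≤ A * (N ^ (1 - 1 / q) * M y ^ (1 / q))})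
        (fun y hy hcon => ?_) hg
      rw [← mul_assoc, ← ha, ha0, zero_mul] at hcon
      exact absurd ((hlt y hy.2).trans_le hcon) (by simp)
    rw [h0, ENNReal.zero_rpow_of_pos (by positivity), mul_zero]
    exact bot_le
  -- The level solving `a m ^ (1/q) = l`, so that `|g| > l` forces `M > m` almost everywhere.
  set m : ℝ≥0∞ := (ENNReal.ofReal l / a) ^ q with hm
  have hl0 : ENNReal.ofReal l ≠ 0 := by simpa using hl
  have hla0 : ENNReal.ofReal l / a ≠ 0 := ENNReal.div_ne_zero.2 ⟨hl0, hat⟩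
  have hlat : ENNReal.ofReal l / a ≠ ∞ := ENNReal.div_ne_top ENNReal.ofReal_ne_top ha0
  have hm0 : m ≠ 0 := by simp [hm, ENNReal.rpow_eq_zero_iff, hla0, hlat]
  have hmt : m ≠ ∞ := ENNReal.rpow_ne_top_of_nonneg hq0.le hlat
  have hml : ENNReal.ofReal l = a * m ^ (1 / q) := by
    rw [hm, ← ENNReal.rpow_mul, mul_one_div, div_self hq0.ne', ENNReal.rpow_one,
      ENNReal.mul_div_cancel ha0 hat]
  have hvol : volume {y ∈ ellipsoid ρ x r | l < ‖g y‖} ≤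
      volume {y ∈ ellipsoid ρ x r | m < M y} := by
    refine measure_mono_ae ?_
    filter_upwards [hg] with y hy hyl
    refine ⟨hyl.1, ?_⟩
    have h1 := (hlt y hyl.2).trans_le hy
    rw [← mul_assoc, ← ha, hml] at h1
    have h2 : m ^ (1 / q) < M y ^ (1 / q) := (ENNReal.mul_lt_mul_iff_right ha0 hat).1 h1
    exact (ENNReal.rpow_lt_rpow_iff (by positivity)).1 h2
  calc ENNReal.ofReal l * volume {y ∈ ellipsoid ρ x r | l < ‖g y‖} ^ (1 / q)
      ≤ a * m ^ (1 / q) * volume {y ∈ ellipsoid ρ x r | m < M y} ^ (1 / q) := by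
        rw [hml]; gcongr
    _ = a * (m * volume {y ∈ ellipsoid ρ x r | m < M y}) ^ (1 / q) := by
        rw [ENNReal.mul_rpow_of_nonneg _ _ hq', mul_assoc]
    _ ≤ a * (B * (volume (ellipsoid ρ x r) * (ENNReal.ofReal (φ x r) * N))) ^ (1 / q) := by
        exact mul_le_mul_right (ENNReal.rpow_le_rpow (hM x r hr m hm0 hmt) hq') _
    _ = _ := by
        rw [← mul_assoc (volume _), ENNReal.mul_rpow_of_nonneg _ _ hq',
          ENNReal.mul_rpow_of_nonneg _ N hq', ha]
        have h1 : N ^ (1 - 1 / q) * N ^ (1 / q) = N := by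
          rw [← ENNReal.rpow_add_of_nonneg _ _ hθ.le hq', sub_add_cancel, ENNReal.rpow_one]
        calc _ = A * (B : ℝ≥0∞) ^ (1 / q) * (volume (ellipsoid ρ x r) *
              ENNReal.ofReal (φ x r)) ^ (1 / q) * (N ^ (1 - 1 / q) * N ^ (1 / q)) := by ring
          _ = _ := by rw [h1]; ring

end Assembly

end ParabolicMorrey

end

/-! ### The main theorem. -/

theorem theorem1p6 {𝕜 : Type*} [RCLike 𝕜] (n : ℕ) (hn : 2 ≤ n)
    (P : Matrix (Fin n) (Fin n) ℝ) (hP : ParabolicMorrey.HasPositiveEigenvalues P)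
    (γ : ℝ) (hγ : γ = P.trace)
    (ρ : EuclideanSpace ℝ (Fin n) → ℝ) (hρ : ParabolicMorrey.IsQuasiDistance P ρ)
    (s s' : ℝ≥0∞) (hs : 1 < s) (hss' : s.HolderConjugate s')
    (Ω : EuclideanSpace ℝ (Fin n) → ℝ) (hΩ : ParabolicMorrey.IsRoughKernel P s Ω)
    (p q α : ℝ) (hsp : s' < ENNReal.ofReal p ∨ (s' = 1 ∧ p = 1)) (hpq : p < q)
    (hα : 0 < α) (hαp : α < γ / p)
    (φ : EuclideanSpace ℝ (Fin n) → ℝ → ℝ)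
    (hφ_meas : Measurable fun z : EuclideanSpace ℝ (Fin n) × Ioi (0 : ℝ) => φ z.1 z.2)
    (hφ_pos : ∀ x r, 0 < r → 0 < φ x r)
    (hφ_sup : ∃ C : ℝ≥0, ∀ x r, 0 < r →
      ⨆ t ∈ Ioi r, ENNReal.ofReal (t ^ (-γ)) *
        essInf (fun τ : ℝ => ENNReal.ofReal (φ x τ * τ ^ γ)) (volume.restrict (Ioi t))
      ≤ C * ENNReal.ofReal (φ x r))
    (hφ_int : ∃ C : ℝ≥0, ∀ x r, 0 < r →
      ∫⁻ t in Ioi r, ENNReal.ofReal (t ^ α * φ x t ^ (1 / p) / t)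
      ≤ C * ENNReal.ofReal (r ^ (-(α * p / (q - p)))))
    (T : (EuclideanSpace ℝ (Fin n) → 𝕜) → (EuclideanSpace ℝ (Fin n) → 𝕜))
    (hT : ParabolicMorrey.IsSublinearOn
      (ParabolicMorrey.MemMorrey ρ p (fun x r => φ x r ^ (1 / p))) T)
    (hT_size : ∃ C : ℝ≥0, ∀ f, ParabolicMorrey.MemMorrey ρ p (fun x r => φ x r ^ (1 / p)) f →
      ∀ᵐ x, ‖T f x‖ₑ ≤ C * ParabolicMorrey.roughPotential γ α ρ Ω f x)
    (hT_loc : ∃ C : ℝ≥0, ∀ f, ParabolicMorrey.MemMorrey ρ p (fun x r => φ x r ^ (1 / p)) f →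
      ∀ x₀ r, 0 < r → ∀ᵐ x, x ∈ ParabolicMorrey.ellipsoid ρ x₀ r →
        ‖T ((ParabolicMorrey.ellipsoid ρ x₀ r).indicator f) x‖ₑ
          ≤ C * ENNReal.ofReal (r ^ α) * ParabolicMorrey.roughMaximal ρ Ω f x) :
    (1 < p → ∃ C : ℝ≥0, ∀ f,
      ParabolicMorrey.MemMorrey ρ p (fun x r => φ x r ^ (1 / p)) f →
        ParabolicMorrey.MemMorrey ρ q (fun x r => φ x r ^ (1 / q)) (T f) ∧
        ParabolicMorrey.morreyNorm ρ q (fun x r => φ x r ^ (1 / q)) (T f)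
          ≤ C * ParabolicMorrey.morreyNorm ρ p (fun x r => φ x r ^ (1 / p)) f) ∧
    (p = 1 → ∃ C : ℝ≥0, ∀ f,
      ParabolicMorrey.MemMorrey ρ 1 φ f →
        ParabolicMorrey.MemWeakMorrey ρ q (fun x r => φ x r ^ (1 / q)) (T f) ∧
        ParabolicMorrey.weakMorreyNorm ρ q (fun x r => φ x r ^ (1 / q)) (T f)
          ≤ C * ParabolicMorrey.morreyNorm ρ 1 φ f) := by
  have hn0 : 0 < n := by omega
  subst hγ
  have hq : 0 < q := by
    rcases hsp with h | h
    · exact (ENNReal.ofReal_pos.1 (bot_le.trans_lt h)).trans hpq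
    · linarith [h.2]
  have hsp' : s' ≤ ENNReal.ofReal p := by
    rcases hsp with h | ⟨h, rfl⟩
    · exact h.le
    · simp [h]
  have hconj : s'.HolderConjugate s := ENNReal.HolderTriple.symm
  have hp1 : 1 ≤ p := by
    have h1 : (1 : ℝ≥0∞) ≤ ENNReal.ofReal p := (ENNReal.HolderConjugate.one_le s' s).trans hsp'
    exact ENNReal.one_le_ofReal.1 h1
  have hp : 0 < p := by linarith
  have hγ0 : 0 < P.trace := by
    have := hα.trans hαp
    exact (div_pos_iff_of_pos_right hp).1 this
  have hαγ : α < P.trace := hαp.trans_le (div_le_self hγ0.le hp1)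
  have hqp : 0 < q - p := sub_pos.2 hpq
  have hδ : 0 < α * p / (q - p) := by positivity
  -- With `δ = α p / (q - p)` one has `α + δ = α q / (q - p)`: the decay rate in the integral
  -- condition is the one that produces the exponents `p / q` and `1 - p / q`.
  have he2 : α * p / (q - p) / (α + α * p / (q - p)) = p / q := by
    field_simp
    ring
  have he1 : α / (α + α * p / (q - p)) = 1 - p / q := by
    rw [← he2]
    field_simp
    ring
  obtain ⟨C, hC⟩ := hφ_sup
  obtain ⟨A, hA⟩ := ParabolicMorrey.operator_pointwise_bound hn0 hP hρ hss' hΩ hp hsp' hα hαγ hδ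
    hφ_pos hφ_int hT hT_size hT_loc
  rw [he1, he2] at hA
  have hψ : ∀ x r, 0 < r → 0 < φ x r ^ (1 / q) := fun x r hr =>
    Real.rpow_pos_of_pos (hφ_pos x r hr) _
  constructor
  · intro hp1'
    have hsp1 : s' < ENNReal.ofReal p := by
      rcases hsp with h | h
      · exact h
      · linarith [h.2]
    obtain ⟨B, hB⟩ := hρ.roughMaximal_morrey_strong (𝕜 := 𝕜) hn0 hP hγ0 hss' hΩ hsp1 hφ_pos hC
    refine ⟨A * B ^ (1 / q), fun f hf => ?_⟩
    have hle := ParabolicMorrey.morreyNorm_le_of_pointwise hn0 hP hρ hp hpq hφ_pos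
      hf.norm_lt_top.ne (hA f hf) (hB f hf.aestronglyMeasurable hf.norm_lt_top)
    rw [ENNReal.coe_mul, ENNReal.coe_rpow_of_nonneg _ (by positivity : 0 ≤ 1 / q)]
    refine ⟨ParabolicMorrey.MemMorrey.of_morreyNorm_lt_top hn0 hP hρ hq hψ
      (hT.aestronglyMeasurable f hf) (hle.trans_lt ?_), hle⟩
    exact ENNReal.mul_lt_top (ENNReal.mul_lt_top ENNReal.coe_lt_top
      (ENNReal.rpow_lt_top_of_nonneg (by positivity) ENNReal.coe_ne_top)) hf.norm_lt_top
  · intro hp1'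
    subst hp1'
    -- A conjugate exponent is at least `1`, so `s' ≤ p = 1` leaves only the endpoint.
    have hs1 : s' = 1 := le_antisymm (by simpa using hsp') (ENNReal.HolderConjugate.one_le s' s)
    subst hs1
    obtain ⟨B, hB⟩ := hρ.roughMaximal_morrey_weak (𝕜 := 𝕜) hn0 hP hγ0 hss' hΩ hφ_pos hC
    have hφ1 : (fun x r => φ x r ^ (1 / (1 : ℝ))) = φ := by
      funext x r
      simp
    rw [hφ1] at hA hB
    refine ⟨A * B ^ (1 / q), fun f hf => ?_⟩
    have hle := ParabolicMorrey.weakMorreyNorm_le_of_pointwise hn0 hP hρ hpq hφ_pos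
      hf.norm_lt_top.ne (hA f hf) (hB f hf.aestronglyMeasurable hf.norm_lt_top)
    rw [ENNReal.coe_mul, ENNReal.coe_rpow_of_nonneg _ (by positivity : 0 ≤ 1 / q)]
    refine ⟨ParabolicMorrey.MemWeakMorrey.of_weakMorreyNorm_lt_top hn0 hP hρ hq
      (hT.aestronglyMeasurable f (by rwa [hφ1])) (hle.trans_lt ?_), hle⟩
    exact ENNReal.mul_lt_top (ENNReal.mul_lt_top ENNReal.coe_lt_top
      (ENNReal.rpow_lt_top_of_nonneg (by positivity) ENNReal.coe_ne_top)) hf.norm_lt_top
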